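/- Let $F$ be an absolutely continuous probability distribution on $\Theta=[0,1]$ with mean $m^\varnothing$, and let $\mathcal G(F)$ be the set of mean-preserving contractions of $F$ (probability distributions on $[0,1]$ below $F$ in the convex order). For $k\in(0,m^\varnothing)$ let $\underline u_k:=m^\varnothing-k$ and let $\bar u_k$ be the unique $u$ with $k=\int_u^1(\theta-u)\,dF(\theta)$. *The game with $n\ge 1$ brokers and search cost $k$.* In each period in which the agent is still searching he pays $k$ and samples a good whose quality is drawn from $F$ independently across periods. Simultaneously each broker $i\in N=\{1,\dots,n\}$ offers a price $p_i\ge 0$ and a distribution $G_i\in\mathcal G(F)$ of posterior means. The agent then makes a purchase decision $w\in N\cup\{\emptyset\}$, where $\emptyset$ is the null offer with price $0$ and signal degenerate at $m^\varnothing$; he pays $p_w$, a posterior mean $m\sim G_w$ is drawn and publicly observed, and the agent either stops and consumes the good (expected value $m$) or continues to the next period. A history at the beginning of a period is the finite sequence of all past offers, purchase decisions and signal realizations. Brokers' (measurable) behavioral strategies map histories to distributions over offers; the agent's map a history and current offers to a distribution over purchase decisions, and a history, current offers, purchase decision and signal realization to a probability of continuing. There is no discounting: a broker's payoff is the expected sum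 of the prices paid to her until the agent stops, and the agent's payoff is the expected quality of the consumed good ($0$ if he never stops) minus the expected sum of search costs and prices paid, with value $-\infty$ if the latter is infinite. A strategy profile is an equilibrium if it is sequentially rational: at every history no broker has a profitable deviation to another strategy, and at every history, after every profile of current offers, and after every purchase decision and signal realization, the agent has no profitable deviation to another strategy. Let $\mathcal E(n,k)\subseteq\mathbb R^{n+1}_+$ be the set of equilibrium payoff profiles $y$, where $y_i$ is broker $i$'s and $y_{n+1}$ the agent's payoff, and for $E\subseteq\mathbb R^{n+1}_+$ put $\mathcal W(E):=\{\sum_{j=1}^{n+1}y_j: y\in E\}$ and $\mathcal A(E):=\{y_{n+1}:y\in E\}$. **Theorem.** There is a unique $k^*\in(0,m^\varnothing)$ such that for all $n\ge 1$: $\mathcal W(\mathcal E(n,k))=[\underline u_k,\bar u_k]$ for all $k\in(0,k^*]$, and $\sup\mathcal W(\mathcal E(n,k))=\inf\mathcal W(\mathcal E(1,k))=\bar u_k$ for all $k\in(k^*,m^\varnothing)$. For this $k^*$ and all $n\ge 1$: (i) $\mathcal A(\mathcal E(n,k))=[\underline u_k,\bar u_k]$ for all $k\in(0,k^*]$; (ii)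 for all $k\in(k^*,m^\varnothing)$ the sets $\mathcal A(\mathcal E(n,k))$ and $\mathcal A(\mathcal E(1,k))$ are non-empty and $\inf\mathcal A(\mathcal E(n,k))\ \ge\ \sup\mathcal A(\mathcal E(1,k))=\underline u_k$. -/

import Mathlib

open MeasureTheory ProbabilityTheory
open scoped ENNReal NNReal

namespace PersuadedSearch

noncomputable section

/-! ### Search environment

Qualities lie in `unitInterval`; a distribution on qualities (or on posterior means) is represented
by its law, a `ProbabilityMeasure unitInterval`. -/

/-- The mean of a distribution on `[0,1]`; for the quality distribution, the prior mean. -/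
def mean (F : ProbabilityMeasure unitInterval) : ℝ :=
  ∫ θ, (θ : ℝ) ∂(F : Measure unitInterval)

theorem integrable_coe (F : ProbabilityMeasure unitInterval) :
    Integrable (fun θ : unitInterval => (θ : ℝ)) (F : Measure unitInterval) :=
  Integrable.of_bound (C := 1) continuous_subtype_val.measurable.aestronglyMeasurable
    (Filter.Eventually.of_forall fun θ => by
      rw [Real.norm_eq_abs, abs_of_nonneg θ.2.1]; exact θ.2.2)

theorem mean_mem (F : ProbabilityMeasure unitInterval) : mean F ∈ unitInterval := by
  refine ⟨integral_nonneg fun θ => θ.2.1, ?_⟩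
  have h := integral_mono (integrable_coe F) (integrable_const (1 : ℝ)) fun θ => θ.2.2
  simpa [mean] using h

/-- `∫_u^1 (θ - u) dF(θ)`. -/
def excess (F : ProbabilityMeasure unitInterval) (u : ℝ) : ℝ :=
  ∫ θ in {θ : unitInterval | u ≤ (θ : ℝ)}, ((θ : ℝ) - u) ∂(F : Measure unitInterval)

theorem excess_eq (F : ProbabilityMeasure unitInterval) (u : ℝ) :
    excess F u = ∫ θ, max ((θ : ℝ) - u) 0 ∂(F : Measure unitInterval) := by
  have hs : MeasurableSet {θ : unitInterval | u ≤ (θ : ℝ)} :=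
    measurableSet_le measurable_const continuous_subtype_val.measurable
  rw [excess, ← integral_indicator hs]
  refine integral_congr_ae (Filter.Eventually.of_forall fun θ => ?_)
  by_cases h : u ≤ (θ : ℝ)
  · simp [h]
  · simp [h, le_of_not_ge h]

theorem integrable_excess (F : ProbabilityMeasure unitInterval) (u : ℝ) :
    Integrable (fun θ : unitInterval => max ((θ : ℝ) - u) 0) (F : Measure unitInterval) :=
  ((integrable_coe F).sub (integrable_const u)).pos_part

theorem excess_one (F : ProbabilityMeasure unitInterval) : excess F 1 = 0 := by
  rw [excess_eq]
  have : (fun θ : unitInterval => max ((θ : ℝ) - 1) 0) = fun _ => 0 := by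
    funext θ; exact max_eq_right (by linarith [θ.2.2])
  rw [this]; simp

theorem excess_zero (F : ProbabilityMeasure unitInterval) : excess F 0 = mean F := by
  rw [excess_eq, mean]
  refine integral_congr_ae (Filter.Eventually.of_forall fun θ => ?_)
  simp [θ.2.1]

theorem continuous_excess (F : ProbabilityMeasure unitInterval) : Continuous (excess F) := by
  refine (LipschitzWith.of_dist_le_mul (K := 1) fun u v => ?_).continuous
  rw [excess_eq, excess_eq, Real.dist_eq, ← integral_sub (integrable_excess F u)
    (integrable_excess F v), Real.dist_eq]
  have h := norm_integral_le_of_norm_le_const (μ := (F : Measure unitInterval)) (C := |u - v|)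
    (f := fun θ : unitInterval => max ((θ : ℝ) - u) 0 - max ((θ : ℝ) - v) 0)
    (Filter.Eventually.of_forall fun θ => by
      rw [Real.norm_eq_abs]
      refine (abs_max_sub_max_le_abs _ _ _).trans (le_of_eq ?_)
      rw [sub_sub_sub_cancel_left, abs_sub_comm])
  simpa using h

theorem existsUnique_excess_eq (F : ProbabilityMeasure unitInterval) {k : ℝ} (hk : 0 < k)
    (hkm : k < mean F) : ∃! u : ℝ, k = excess F u := by
  have hzero : ∀ v : ℝ, 1 ≤ v → excess F v = 0 := fun v hv => by
    rw [excess_eq]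
    have : (fun θ : unitInterval => max ((θ : ℝ) - v) 0) = fun _ => 0 := by
      funext θ; exact max_eq_right (by linarith [θ.2.2])
    rw [this]; simp
  have key : ∀ u v : ℝ, u < v → k = excess F u → k = excess F v → False := by
    intro u v huv hu hv
    have hv1 : v < 1 := by
      by_contra h
      have := hzero v (not_lt.mp h)
      linarith
    have h1u : 0 < 1 - u := by linarith
    have hle : excess F v ≤ ((1 - v) / (1 - u)) * excess F u := by
      rw [excess_eq, excess_eq, ← integral_const_mul]
      refine integral_mono (integrable_excess F v) ((integrable_excess F u).const_mul _)
        fun θ => ?_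
      have hθ : (θ : ℝ) ≤ 1 := θ.2.2
      refine max_le ?_ (mul_nonneg (div_nonneg (by linarith) h1u.le) (le_max_right _ _))
      refine le_trans ?_ (mul_le_mul_of_nonneg_left (le_max_left _ _)
        (div_nonneg (by linarith) h1u.le))
      rw [div_mul_eq_mul_div, le_div_iff₀ h1u]
      nlinarith
    rw [← hu, ← hv] at hle
    have : (1 - v) / (1 - u) < 1 := by rw [div_lt_one h1u]; linarith
    nlinarith
  obtain ⟨u, -, hu⟩ := intermediate_value_Icc' (zero_le_one' ℝ)
    (continuous_excess F).continuousOn (show k ∈ Set.Icc (excess F 1) (excess F 0) by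
      rw [excess_one, excess_zero]; exact ⟨hk.le, hkm.le⟩)
  refine ⟨u, hu.symm, fun v hv => ?_⟩
  rcases lt_trichotomy u v with h | h | h
  · exact (key u v h hu.symm hv).elim
  · exact h.symm
  · exact (key v u h hv hu.symm).elim

open Classical in
/-- The payoff under free full information: the unique `u` with `k = ∫_u^1 (θ - u) dF(θ)`
(for `0 < k < mean F`, see `existsUnique_excess_eq`). -/
def fullInfoPayoff (F : ProbabilityMeasure unitInterval) (k : ℝ) : ℝ :=
  if h : ∃ u : ℝ, k = excess F u then h.choose else 0

theorem fullInfoPayoff_spec (F : ProbabilityMeasure unitInterval) {k : ℝ} (hk : 0 < k)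
    (hkm : k < mean F) : k = excess F (fullInfoPayoff F k) := by
  have h := (existsUnique_excess_eq F hk hkm).exists
  rw [fullInfoPayoff, dif_pos h]
  exact h.choose_spec

/-- The autarky payoff. -/
def autarkyPayoff (F : ProbabilityMeasure unitInterval) (k : ℝ) : ℝ := mean F - k

/-! ### Signals and offers -/

/-- `G` is a mean-preserving contraction of `F` (convex order; the affine functions force the
means to agree). -/
def IsMPC (G F : ProbabilityMeasure unitInterval) : Prop :=
  ∀ φ : ℝ → ℝ, ConvexOn ℝ Set.univ φ →
    ∫ θ, φ (θ : ℝ) ∂(G : Measure unitInterval) ≤ ∫ θ, φ (θ : ℝ) ∂(F : Measure unitInterval)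

/-- The uninformative signal: the point mass at the prior mean. -/
def nullSignal (F : ProbabilityMeasure unitInterval) : ProbabilityMeasure unitInterval :=
  ⟨Measure.dirac ⟨mean F, mean_mem F⟩, inferInstance⟩

/-- An offer: a nonnegative price and a posterior-mean distribution. -/
abbrev Offer (F : ProbabilityMeasure unitInterval) : Type :=
  ℝ≥0 × {G : ProbabilityMeasure unitInterval // IsMPC G F}

/-- Profiles of offers of the `n` brokers. -/
abbrev Offers (F : ProbabilityMeasure unitInterval) (n : ℕ) : Type := Fin n → Offer F

/-- Purchase decisions: `some i` buys from broker `i`, `none` takes the null offer. -/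
abbrev Purchase (n : ℕ) : Type := Option (Fin n)

instance (n : ℕ) : MeasurableSpace (Purchase n) := ⊤

instance (n : ℕ) : DiscreteMeasurableSpace (Purchase n) := ⟨fun _ => trivial⟩

variable {F : ProbabilityMeasure unitInterval} {n : ℕ}

/-- The price of the chosen offer. -/
def priceOf (O : Offers F n) : Purchase n → ℝ≥0
  | none => 0
  | some i => (O i).1

/-- The posterior-mean distribution of the chosen offer. -/
def signalOf (O : Offers F n) : Purchase n → ProbabilityMeasure unitInterval
  | none => nullSignal F
  | some i => (O i).2.1

/-! ### Histories and strategies -/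

/-- The record of one period: offers, purchase decision, signal realization. -/
abbrev Record (F : ProbabilityMeasure unitInterval) (n : ℕ) : Type :=
  Offers F n × Purchase n × unitInterval

/-- Histories of length `t` at which the agent is still searching. -/
abbrev History (F : ProbabilityMeasure unitInterval) (n t : ℕ) : Type := Fin t → Record F n

/-- The history extended by one more period. -/
def History.extend {t : ℕ} (h : History F n t) (r : Record F n) : History F n (t + 1) :=
  Fin.snoc (α := fun _ => Record F n) h r

/-- A (measurable) behavioral strategy of a broker. -/
structure BrokerStrategy (F : ProbabilityMeasure unitInterval) (n : ℕ) where
  offer : ∀ t, Kernel (History F n t) (Offer F)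
  markov : ∀ t, IsMarkovKernel (offer t)

/-- A (measurable) behavioral strategy of the agent: `buy t (h, O) w` is the probability of the
purchase decision `w`, and `cont t (h, O, w, m)` is the probability of continuing the search. -/
structure AgentStrategy (F : ProbabilityMeasure unitInterval) (n : ℕ) where
  buy : ∀ t, History F n t × Offers F n → Purchase n → ℝ≥0
  measurable_buy : ∀ t w, Measurable fun x => buy t x w
  sum_buy : ∀ t x, ∑ w, buy t x w = 1
  cont : ∀ t, History F n t × Offers F n × Purchase n × unitInterval → unitInterval
  measurable_cont : ∀ t, Measurable (cont t)

/-- A strategy profile. -/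
structure Profile (F : ProbabilityMeasure unitInterval) (n : ℕ) where
  broker : Fin n → BrokerStrategy F n
  agent : AgentStrategy F n

/-- Broker `i` deviates to `s`. -/
def Profile.deviateBroker (σ : Profile F n) (i : Fin n) (s : BrokerStrategy F n) : Profile F n :=
  { σ with broker := Function.update σ.broker i s }

/-- The agent deviates to `a`. -/
def Profile.deviateAgent (σ : Profile F n) (a : AgentStrategy F n) : Profile F n :=
  { σ with agent := a }

/-! ### Expected payoffs

A nonnegative flow `g O w m ends` is collected in every period in which the agent searches, given
that period's offers, purchase, signal realization and stopping decision. For a value function `V`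
of next period's history, the next three definitions are the expected current flow plus
continuation value at the three kinds of nodes within a period: after the signal realization, after
the offers, and at the beginning of the period (where brokers randomize independently). -/

/-- A nonnegative period payoff as a function of offers, purchase, signal and whether the agent
stops. -/
abbrev Flow (F : ProbabilityMeasure unitInterval) (n : ℕ) : Type :=
  Offers F n → Purchase n → unitInterval → Bool → ℝ≥0∞

/-- Value at a node `(h, O, w, m)`. -/
def signalNode (σ : Profile F n) (g : Flow F n) (V : ∀ t, History F n t → ℝ≥0∞)
    (t : ℕ) (h : History F n t) (O : Offers F n) (w : Purchase n) (m : unitInterval) : ℝ≥0∞ :=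
  ENNReal.ofReal (1 - (σ.agent.cont t (h, O, w, m) : ℝ)) * g O w m true +
    ENNReal.ofReal (σ.agent.cont t (h, O, w, m) : ℝ) *
      (g O w m false + V (t + 1) (h.extend (O, w, m)))

/-- Value at a node `(h, O)`. -/
def offerNode (σ : Profile F n) (g : Flow F n) (V : ∀ t, History F n t → ℝ≥0∞)
    (t : ℕ) (h : History F n t) (O : Offers F n) : ℝ≥0∞ :=
  ∑ w, (σ.agent.buy t (h, O) w : ℝ≥0∞) *
    ∫⁻ m, signalNode σ g V t h O w m ∂(signalOf O w : Measure unitInterval)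

/-- Value at a history `h`. -/
def historyNode (σ : Profile F n) (g : Flow F n) (V : ∀ t, History F n t → ℝ≥0∞)
    (t : ℕ) (h : History F n t) : ℝ≥0∞ :=
  ∫⁻ O, offerNode σ g V t h O ∂(Measure.pi fun i => (σ.broker i).offer t h)

/-- Expected total flow over the next `N` periods (or until the agent stops, if earlier), starting
from a history. -/
def totalUpTo (σ : Profile F n) (g : Flow F n) : ℕ → ∀ t, History F n t → ℝ≥0∞
  | 0 => fun _ _ => 0
  | N + 1 => historyNode σ g (totalUpTo σ g N)

/-- Expected total flow from a history until the agent stops (possibly never): the monotone limit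
of the expected totals over finitely many periods. -/
def total (σ : Profile F n) (g : Flow F n) (t : ℕ) (h : History F n t) : ℝ≥0∞ :=
  ⨆ N, totalUpTo σ g N t h

/-- Broker `i` collects her price when the agent buys from her. -/
def revenueFlow (i : Fin n) : Flow F n := fun O w _ _ => if w = some i then (O i).1 else 0

/-- The agent pays the search cost and the price of the chosen offer. -/
def costFlow (k : ℝ) : Flow F n := fun O w _ _ => ENNReal.ofReal k + priceOf O w

/-- On stopping, the agent consumes a good of expected quality `m`. -/
def consumptionFlow : Flow F n := fun _ _ m ends => if ends then ENNReal.ofReal (m : ℝ) else 0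

/-- Broker `i`'s expected payoff from a history. -/
def brokerPayoff (σ : Profile F n) (i : Fin n) (t : ℕ) (h : History F n t) : ℝ≥0∞ :=
  total σ (revenueFlow i) t h

/-- The agent's expected payoff from a history; expected consumption is at most `1`, so the
difference is well defined, with value `⊥` if expected costs are infinite. -/
def agentPayoff (k : ℝ) (σ : Profile F n) (t : ℕ) (h : History F n t) : EReal :=
  (total σ consumptionFlow t h : EReal) - (total σ (costFlow k) t h : EReal)

/-- The agent's expected payoff (from the current period on) after history `h` and offers `O`. -/
def agentPayoffOffer (k : ℝ) (σ : Profile F n) (t : ℕ) (h : History F n t) (O : Offers F n) :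
    EReal :=
  (offerNode σ consumptionFlow (total σ consumptionFlow) t h O : EReal) -
    (offerNode σ (costFlow k) (total σ (costFlow k)) t h O : EReal)

/-- The agent's expected payoff (from the current period on, including the current period's
already incurred costs) after history `h`, offers `O`, purchase `w` and signal realization `m`. -/
def agentPayoffSignal (k : ℝ) (σ : Profile F n) (t : ℕ) (h : History F n t) (O : Offers F n)
    (w : Purchase n) (m : unitInterval) : EReal :=
  (signalNode σ consumptionFlow (total σ consumptionFlow) t h O w m : EReal) -
    (signalNode σ (costFlow k) (total σ (costFlow k)) t h O w m : EReal)

/-! ### Equilibrium -/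

/-- Sequential rationality: no broker gains by deviating at any history, and the agent does not gain
by deviating at any history nor at any of his decision nodes (after any profile of offers, and
after any purchase decision and signal realization). -/
structure IsEquilibrium (k : ℝ) (σ : Profile F n) : Prop where
  broker_opt : ∀ (i : Fin n) (s : BrokerStrategy F n) (t : ℕ) (h : History F n t),
    brokerPayoff (σ.deviateBroker i s) i t h ≤ brokerPayoff σ i t h
  agent_opt : ∀ (a : AgentStrategy F n) (t : ℕ) (h : History F n t),
    agentPayoff k (σ.deviateAgent a) t h ≤ agentPayoff k σ t h
  agent_opt_offer : ∀ (a : AgentStrategy F n) (t : ℕ) (h : History F n t) (O : Offers F n),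
    agentPayoffOffer k (σ.deviateAgent a) t h O ≤ agentPayoffOffer k σ t h O
  agent_opt_signal : ∀ (a : AgentStrategy F n) (t : ℕ) (h : History F n t) (O : Offers F n)
    (w : Purchase n) (m : unitInterval),
    agentPayoffSignal k (σ.deviateAgent a) t h O w m ≤ agentPayoffSignal k σ t h O w m

/-- The equilibrium payoff profiles with `n` brokers and search cost `k`; the last coordinate is the
agent's payoff. -/
def equilibriumPayoffs (F : ProbabilityMeasure unitInterval) (n : ℕ) (k : ℝ) :
    Set (Fin (n + 1) → ℝ) :=
  {y | ∃ σ : Profile F n, IsEquilibrium k σ ∧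
    (∀ i : Fin n, (y i.castSucc : EReal) = (brokerPayoff σ i 0 Fin.elim0 : EReal)) ∧
    (y (Fin.last n) : EReal) = agentPayoff k σ 0 Fin.elim0}

/-- The total surplus set of a set of payoff profiles. -/
def surplusSet (E : Set (Fin (n + 1) → ℝ)) : Set ℝ := (fun y => ∑ j, y j) '' E

/-- The agent's payoff set of a set of payoff profiles. -/
def agentSet (E : Set (Fin (n + 1) → ℝ)) : Set ℝ := (fun y => y (Fin.last n)) '' E

/-- The defining property of the threshold search cost, in terms of equilibrium total surplus:
below it every feasible surplus level is attained whatever the number of brokers, and above it the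
highest surplus under `n` brokers and the lowest surplus under monopoly both equal the payoff under
free full information. -/
def IsSurplusThreshold (F : ProbabilityMeasure unitInterval) (kstar : ℝ) : Prop :=
  kstar ∈ Set.Ioo 0 (mean F) ∧ ∀ n : ℕ, 1 ≤ n →
    (∀ k, 0 < k → k ≤ kstar →
      surplusSet (equilibriumPayoffs F n k) =
        Set.Icc (autarkyPayoff F k) (fullInfoPayoff F k)) ∧
    (∀ k, kstar < k → k < mean F →
      IsLUB (surplusSet (equilibriumPayoffs F n k)) (fullInfoPayoff F k) ∧
      IsGLB (surplusSet (equilibriumPayoffs F 1 k)) (fullInfoPayoff F k))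

end

end PersuadedSearch

/-! Write m for `mean F`, ū for `fullInfoPayoff F k`, u̲ = m - k for `autarkyPayoff F k`, and S(G,u)
= ∫ max(x,u) dG(x) for `stopValue G u`, the value of a signal G when continuing is worth u. Since
max(·,u) is convex, S(G,u) ≤ S(F,u) for every feasible G, and ū is characterized by S(F,ū) = ū + k.

For every k, prices are transfers, so total surplus is at most ū
(`total_consumption_add_revenue_le`), and the agent secures u̲ by taking the null offer and
stopping. Surplus ū is attained: with two or more brokers by free full information
(`snoc_zero_fullInfoPayoff_mem`), under monopoly by selling a binary signal at a price that leaves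
the agent u̲ (`snoc_monopoly_mem`).

The threshold k* is the zero of the strictly decreasing function `costGap`, that is, the cost at
which S(F,u̲) = ū. If S(F,u̲) ≤ ū, the agent prefers rejecting any unexpected offer and getting ū
afterwards to accepting even free full information and getting u̲ afterwards. So brokers can be held
to zero while the agent receives any amount between u̲ and ū, by an initial lottery over two
continuations (`snoc_zero_mem_equilibriumPayoffs`).

If S(F,u̲) > ū, this punishment fails against a monopolist. Let r be the infimum of her payoffs over
all histories, so the agent's continuation value never exceeds ū - r. Were ū - r ≥ m, she could sell
full information at a price above r after every history. Hence ū - r < m and the null offer is worth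
only m before the search cost; then selling the binary signal at almost its full value forces r ≥ ū
- u̲ (`IsEquilibrium.le_brokerPayoff_of_costGap_neg`). All monopoly payoffs are thereby determined.

The agent's optimality in the constructed equilibria is reduced to one-period conditions by
`AgentCertificate`. Uniqueness of k* holds because the interval from u̲ to ū is nondegenerate at k*
and just above it, where it cannot have infimum ū. -/

namespace PersuadedSearch

noncomputable section

/-! ### Stopping values -/

/-- The value of observing a draw from `G` with the option of taking `u` instead. -/
def stopValue (G : ProbabilityMeasure unitInterval) (u : ℝ) : ℝ :=
  ∫ x, max (x : ℝ) u ∂(G : Measure unitInterval)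

theorem integrable_of_continuous (G : ProbabilityMeasure unitInterval) {f : unitInterval → ℝ}
    (hf : Continuous f) : Integrable f (G : Measure unitInterval) := by
  obtain ⟨C, hC⟩ := (isCompact_range hf).isBounded.exists_norm_le
  exact Integrable.of_bound (C := C) hf.measurable.aestronglyMeasurable
    (Filter.Eventually.of_forall fun x => hC _ ⟨x, rfl⟩)

theorem integrable_max (G : ProbabilityMeasure unitInterval) (u : ℝ) :
    Integrable (fun x : unitInterval => max (x : ℝ) u) (G : Measure unitInterval) :=
  integrable_of_continuous G (by fun_prop)

theorem stopValue_eq (G : ProbabilityMeasure unitInterval) (u : ℝ) :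
    stopValue G u = u + excess G u := by
  have h : (fun x : unitInterval => max (x : ℝ) u) = fun x : unitInterval => u + max ((x : ℝ) - u) 0 := by
    funext x
    rw [← max_add_add_left]; simp
  rw [stopValue, excess_eq, h, integral_add (integrable_const u) (integrable_excess G u)]
  simp

theorem lintegral_max (G : ProbabilityMeasure unitInterval) {u : ℝ} (hu : 0 ≤ u) :
    ∫⁻ x, max (ENNReal.ofReal (x : ℝ)) (ENNReal.ofReal u) ∂(G : Measure unitInterval) =
      ENNReal.ofReal (stopValue G u) := by
  rw [stopValue, ofReal_integral_eq_lintegral_ofReal (integrable_max G u)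
    (Filter.Eventually.of_forall fun x => le_max_of_le_right hu)]
  simp_rw [ENNReal.ofReal_max]

theorem le_stopValue (G : ProbabilityMeasure unitInterval) (u : ℝ) : u ≤ stopValue G u := by
  have := integral_mono (integrable_const u) (integrable_max G u) fun _ => le_max_right _ _
  simpa [stopValue] using this

theorem mean_le_stopValue (G : ProbabilityMeasure unitInterval) (u : ℝ) :
    mean G ≤ stopValue G u :=
  integral_mono (integrable_coe G) (integrable_max G u) fun _ => le_max_left _ _

theorem stopValue_mono (G : ProbabilityMeasure unitInterval) : Monotone (stopValue G) :=
  fun _ _ h => integral_mono (integrable_max G _) (integrable_max G _)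
    fun _ => max_le_max le_rfl h

theorem stopValue_nullSignal (F : ProbabilityMeasure unitInterval) (u : ℝ) :
    stopValue (nullSignal F) u = max (mean F) u := by
  change ∫ x, max (x : ℝ) u ∂(Measure.dirac (⟨mean F, mean_mem F⟩ : unitInterval)) = _
  rw [integral_dirac]

/-- The map max(·,u) is convex, so full information is the most valuable signal whatever the
continuation value. -/
theorem IsMPC.stopValue_le {G F : ProbabilityMeasure unitInterval} (h : IsMPC G F) (u : ℝ) :
    stopValue G u ≤ stopValue F u :=
  h (fun x => max x u) ((convexOn_id convex_univ).sup (convexOn_const u convex_univ))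

theorem IsMPC.mean_eq {G F : ProbabilityMeasure unitInterval} (h : IsMPC G F) :
    mean G = mean F := by
  have h1 : mean G ≤ mean F := h (fun x => x) (convexOn_id convex_univ)
  have h2 := h (fun x => -x) (concaveOn_id convex_univ).neg
  rw [integral_neg, integral_neg] at h2
  exact le_antisymm h1 (neg_le_neg_iff.mp h2)

theorem IsMPC.refl (F : ProbabilityMeasure unitInterval) : IsMPC F F := fun _ _ => le_rfl

theorem continuous_of_convexOn {φ : ℝ → ℝ} (hφ : ConvexOn ℝ Set.univ φ) : Continuous φ :=
  continuousOn_univ.mp (hφ.continuousOn isOpen_univ)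

theorem isMPC_nullSignal (F : ProbabilityMeasure unitInterval) : IsMPC (nullSignal F) F := by
  intro φ hφ
  have hc := continuous_of_convexOn hφ
  change ∫ x, φ (x : ℝ) ∂(Measure.dirac (⟨mean F, mean_mem F⟩ : unitInterval)) ≤ _
  rw [integral_dirac]
  exact hφ.map_integral_le hc.continuousOn isClosed_univ (by simp) (integrable_coe F)
    (integrable_of_continuous F (hc.comp continuous_subtype_val))

/-! ### The excess function -/

theorem excess_nonneg (F : ProbabilityMeasure unitInterval) (u : ℝ) : 0 ≤ excess F u := by
  rw [excess_eq]; exact integral_nonneg fun _ => le_max_right _ _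

theorem excess_antitone (F : ProbabilityMeasure unitInterval) : Antitone (excess F) := by
  intro u v h
  rw [excess_eq, excess_eq]
  exact integral_mono (integrable_excess F v) (integrable_excess F u)
    fun _ => max_le_max (by linarith) le_rfl

theorem excess_le_add (F : ProbabilityMeasure unitInterval) {u v : ℝ} (h : u ≤ v) :
    excess F u ≤ excess F v + (v - u) := by
  have := stopValue_mono F h
  rw [stopValue_eq, stopValue_eq] at this
  linarith

theorem mean_sub_le_excess (F : ProbabilityMeasure unitInterval) (u : ℝ) :
    mean F - u ≤ excess F u := by
  have := mean_le_stopValue F u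
  rw [stopValue_eq] at this
  linarith

/-- The excess is convex and vanishes at 1, so it lies below the chord from u to 1; pointwise,
(θ-v)⁺ ≤ (1-v)/(1-u)·(θ-u)⁺ for θ ≤ 1. -/
theorem excess_lt (F : ProbabilityMeasure unitInterval) {u v : ℝ} (huv : u < v)
    (hu : 0 < excess F u) : excess F v < excess F u := by
  rcases le_or_gt 1 v with hv | hv
  · have := excess_antitone F hv
    rw [excess_one] at this
    linarith
  have h1u : 0 < 1 - u := by linarith
  have hle : excess F v ≤ ((1 - v) / (1 - u)) * excess F u := by
    rw [excess_eq, excess_eq, ← integral_const_mul]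
    refine integral_mono (integrable_excess F v) ((integrable_excess F u).const_mul _)
      fun θ => ?_
    have hθ : (θ : ℝ) ≤ 1 := θ.2.2
    refine max_le ?_ (mul_nonneg (div_nonneg (by linarith) h1u.le) (le_max_right _ _))
    refine le_trans ?_ (mul_le_mul_of_nonneg_left (le_max_left _ _)
      (div_nonneg (by linarith) h1u.le))
    rw [div_mul_eq_mul_div, le_div_iff₀ h1u]
    nlinarith
  have : (1 - v) / (1 - u) < 1 := by rw [div_lt_one h1u]; linarith
  nlinarith

theorem le_of_excess_le (F : ProbabilityMeasure unitInterval) {u v : ℝ} (hv : 0 < excess F v)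
    (h : excess F v ≤ excess F u) : u ≤ v := by
  by_contra hlt
  exact absurd (excess_lt F (not_le.mp hlt) hv) (not_lt.mpr h)

section Environment

variable {F : ProbabilityMeasure unitInterval} {k : ℝ}

theorem excess_fullInfoPayoff (hk : 0 < k) (hkm : k < mean F) :
    excess F (fullInfoPayoff F k) = k := (fullInfoPayoff_spec F hk hkm).symm

theorem stopValue_fullInfoPayoff (hk : 0 < k) (hkm : k < mean F) :
    stopValue F (fullInfoPayoff F k) = fullInfoPayoff F k + k := by
  rw [stopValue_eq, excess_fullInfoPayoff hk hkm]

theorem autarkyPayoff_le_fullInfoPayoff (hk : 0 < k) (hkm : k < mean F) :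
    autarkyPayoff F k ≤ fullInfoPayoff F k := by
  have := mean_sub_le_excess F (fullInfoPayoff F k)
  rw [excess_fullInfoPayoff hk hkm] at this
  unfold autarkyPayoff
  linarith

theorem autarkyPayoff_pos (hkm : k < mean F) : 0 < autarkyPayoff F k := by
  unfold autarkyPayoff; linarith

theorem fullInfoPayoff_lt_one (hk : 0 < k) (hkm : k < mean F) : fullInfoPayoff F k < 1 := by
  by_contra h
  have := excess_antitone F (not_lt.mp h)
  rw [excess_one, excess_fullInfoPayoff hk hkm] at this
  linarith

/-! ### The threshold search cost -/

/-- The only consequence of absolute continuity that the proof needs: quality is not almost surely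
constant. -/
theorem not_ae_eq_const (hF : (F : Measure unitInterval) ≪ volume) (c : ℝ) :
    ¬ ∀ᵐ θ : unitInterval ∂(F : Measure unitInterval), (θ : ℝ) = c := by
  intro h
  have h0 : (volume : Measure unitInterval) {θ : unitInterval | (θ : ℝ) = c} = 0 := by
    refine Set.Subsingleton.measure_zero (fun a ha b hb => ?_) _
    exact Subtype.ext (ha.trans hb.symm)
  have h1 : (F : Measure unitInterval) Set.univ = 0 := by
    refine measure_mono_null (fun θ _ => ?_) (measure_union_null (hF h0) h)
    by_cases hθ : (θ : ℝ) = c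
    · exact Or.inl hθ
    · exact Or.inr hθ
  simp at h1

/-- The stopping value c is the mean of max(θ,u). With no mass above c, max(θ,u) would equal its
mean almost surely, and c > u would make θ itself constant. At u = m this makes `costGap` positive
at zero cost. -/
theorem excess_stopValue_pos (hF : (F : Measure unitInterval) ≪ volume) (u : ℝ)
    (hu : 0 < excess F u) : 0 < excess F (stopValue F u) := by
  refine (excess_nonneg F _).lt_of_ne fun h0 => ?_
  set c := stopValue F u with hc
  have huc : u < c := by rw [hc, stopValue_eq]; linarith
  have hle : ∀ᵐ θ : unitInterval ∂(F : Measure unitInterval), (θ : ℝ) ≤ c := by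
    rw [excess_eq] at h0
    have := (integral_eq_zero_iff_of_nonneg (fun _ => le_max_right _ _)
      (integrable_excess F c)).mp h0.symm
    filter_upwards [this] with θ hθ
    have h := le_max_left ((θ : ℝ) - c) 0
    rw [show max ((θ : ℝ) - c) 0 = 0 from hθ] at h
    linarith
  have hintegral : ∫ θ, (c - max (θ : ℝ) u) ∂(F : Measure unitInterval) = 0 := by
    rw [integral_sub (integrable_const c) (integrable_max F u)]
    simp [hc, stopValue]
  have hz := (integral_eq_zero_iff_of_nonneg_ae
    (by
      filter_upwards [hle] with θ hθ
      simpa using ⟨hθ, huc.le⟩)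
    ((integrable_const c).sub (integrable_max F u))).mp hintegral
  refine not_ae_eq_const hF c ?_
  filter_upwards [hz] with θ hθ
  have hθ' : c - max (θ : ℝ) u = 0 := hθ
  rcases max_cases (θ : ℝ) u with h | h
  · linarith [h.1]
  · linarith [h.1]

theorem mean_pos (hF : (F : Measure unitInterval) ≪ volume) : 0 < mean F := by
  refine (mean_mem F).1.lt_of_ne fun h0 => not_ae_eq_const hF 0 ?_
  exact (integral_eq_zero_iff_of_nonneg (fun θ => θ.2.1) (integrable_coe F)).mp h0.symm

theorem excess_mean_pos (hF : (F : Measure unitInterval) ≪ volume) : 0 < excess F (mean F) := by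
  refine (excess_nonneg F _).lt_of_ne fun h0 => not_ae_eq_const hF (mean F) ?_
  have hle : ∀ᵐ θ : unitInterval ∂(F : Measure unitInterval), (θ : ℝ) ≤ mean F := by
    rw [excess_eq] at h0
    have := (integral_eq_zero_iff_of_nonneg (fun _ => le_max_right _ _)
      (integrable_excess F (mean F))).mp h0.symm
    filter_upwards [this] with θ hθ
    have h := le_max_left ((θ : ℝ) - mean F) 0
    rw [show max ((θ : ℝ) - mean F) 0 = 0 from hθ] at h
    linarith
  have hintegral : ∫ θ, (mean F - (θ : ℝ)) ∂(F : Measure unitInterval) = 0 := by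
    rw [integral_sub (integrable_const _) (integrable_coe F)]
    simp [mean]
  have hz := (integral_eq_zero_iff_of_nonneg_ae
    (by filter_upwards [hle] with θ hθ using sub_nonneg.mpr hθ)
    ((integrable_const (mean F)).sub (integrable_coe F))).mp hintegral
  filter_upwards [hz] with θ hθ
  have hθ' : mean F - (θ : ℝ) = 0 := hθ
  linarith

/-- Its sign tells whether `fullInfoPayoff F k` is at least `stopValue F (mean F - k)`. -/
def costGap (F : ProbabilityMeasure unitInterval) (k : ℝ) : ℝ :=
  excess F (stopValue F (mean F - k)) - k

theorem continuous_costGap (F : ProbabilityMeasure unitInterval) : Continuous (costGap F) := by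
  have h := continuous_excess F
  unfold costGap
  simp_rw [stopValue_eq]
  fun_prop

/-- Let s be the stopping value at m - k. When k rises by δ, s falls by strictly less than δ, since
the excess at m - k strictly rises. The excess is 1-Lipschitz, so its value at s gains less than the
δ that is subtracted. -/
theorem costGap_lt (hF : (F : Measure unitInterval) ≪ volume) {k₁ k₂ : ℝ} (h0 : 0 ≤ k₁)
    (h : k₁ < k₂) : costGap F k₂ < costGap F k₁ := by
  have hpos : 0 < excess F (mean F - k₂) :=
    (excess_mean_pos hF).trans_le (excess_antitone F (by linarith))
  have hlt := excess_lt F (show mean F - k₂ < mean F - k₁ by linarith) hpos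
  have hmono := stopValue_mono F (show mean F - k₂ ≤ mean F - k₁ by linarith)
  have hlip := excess_le_add F hmono
  unfold costGap
  rw [stopValue_eq F (mean F - k₁), stopValue_eq F (mean F - k₂)] at *
  linarith

theorem exists_thresholdCost (hF : (F : Measure unitInterval) ≪ volume) :
    ∃ kstar ∈ Set.Ioo 0 (mean F), costGap F kstar = 0 := by
  have hm := mean_pos hF
  have h0 : 0 < costGap F 0 := by
    have := excess_stopValue_pos hF _ (excess_mean_pos hF)
    simpa [costGap] using this
  have h1 : costGap F (mean F) < 0 := by
    have : excess F (mean F) < excess F 0 := excess_lt F hm (by rw [excess_zero]; exact hm)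
    rw [excess_zero] at this
    simp only [costGap, sub_self, stopValue_eq, excess_zero, zero_add]
    linarith
  obtain ⟨c, hc, hc0⟩ := intermediate_value_Ioo' hm.le (continuous_costGap F).continuousOn
    (show (0 : ℝ) ∈ Set.Ioo (costGap F (mean F)) (costGap F 0) from ⟨h1, h0⟩)
  exact ⟨c, hc, hc0⟩

/-- What makes rejection a credible punishment: full information now followed by autarky is worth no
more than waiting for free full information. As the excess at ū is k > 0, the comparison of excesses
can be inverted. -/
theorem stopValue_autarky_le (hk : 0 < k) (hkm : k < mean F) (h : 0 ≤ costGap F k) :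
    stopValue F (autarkyPayoff F k) ≤ fullInfoPayoff F k := by
  refine le_of_excess_le F (by rwa [excess_fullInfoPayoff hk hkm]) ?_
  rw [excess_fullInfoPayoff hk hkm]
  unfold costGap at h
  unfold autarkyPayoff
  linarith

/-- Above the threshold even the best continuation does not make the agent reject free full
information. -/
theorem fullInfoPayoff_lt_stopValue (hk : 0 < k) (hkm : k < mean F) (h : costGap F k < 0) :
    fullInfoPayoff F k < stopValue F (autarkyPayoff F k) := by
  by_contra hle
  have := excess_antitone F (not_lt.mp hle)
  rw [excess_fullInfoPayoff hk hkm] at this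
  unfold costGap at h
  unfold autarkyPayoff at this
  linarith

theorem autarkyPayoff_lt_fullInfoPayoff_iff (hk : 0 < k) (hkm : k < mean F) :
    autarkyPayoff F k < fullInfoPayoff F k ↔ k < excess F (mean F - k) := by
  constructor
  · intro h
    have h2 : autarkyPayoff F k = mean F - k := rfl
    rw [← h2]
    refine lt_of_lt_of_le ?_ le_rfl
    have hpos : 0 < excess F (autarkyPayoff F k) :=
      lt_of_lt_of_le (by rw [excess_fullInfoPayoff hk hkm]; exact hk) (excess_antitone F h.le)
    have := excess_lt F h hpos
    rwa [excess_fullInfoPayoff hk hkm] at this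
  · intro h
    refine (autarkyPayoff_le_fullInfoPayoff hk hkm).lt_of_ne fun he => ?_
    have h2 : excess F (autarkyPayoff F k) = k := by rw [he, excess_fullInfoPayoff hk hkm]
    unfold autarkyPayoff at h2
    linarith

/-- At the threshold, ū ≥ S(F,u̲) ≥ m > u̲. By continuity of the excess the strict inequality
persists for slightly larger costs, which rules out larger candidates for the threshold. -/
theorem exists_gt_autarkyPayoff_lt {kstar : ℝ} (hk : kstar ∈ Set.Ioo 0 (mean F))
    (h0 : costGap F kstar = 0) {b : ℝ} (hb : kstar < b) :
    ∃ k, kstar < k ∧ k < b ∧ k < mean F ∧ autarkyPayoff F k < fullInfoPayoff F k := by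
  have hle := stopValue_autarky_le hk.1 hk.2 h0.ge
  have hm := mean_le_stopValue F (autarkyPayoff F kstar)
  have hlt : autarkyPayoff F kstar < fullInfoPayoff F kstar := by
    have : autarkyPayoff F kstar = mean F - kstar := rfl
    have := hk.1
    linarith
  rw [autarkyPayoff_lt_fullInfoPayoff_iff hk.1 hk.2] at hlt
  have hcont : Continuous fun k => excess F (mean F - k) - k := by
    have := continuous_excess F
    fun_prop
  have hev : ∀ᶠ k in nhdsWithin kstar (Set.Ioi kstar), 0 < excess F (mean F - k) - k :=
    (hcont.continuousAt.eventually (lt_mem_nhds (show 0 < excess F (mean F - kstar) - kstar by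
      linarith))).filter_mono nhdsWithin_le_nhds
  have hev2 : ∀ᶠ k in nhdsWithin kstar (Set.Ioi kstar), k ∈ Set.Ioo kstar (min b (mean F)) :=
    Ioo_mem_nhdsGT (lt_min hb hk.2)
  obtain ⟨k, h1, h2⟩ := (hev.and hev2).exists
  have hkb := lt_min_iff.mp h2.2
  exact ⟨k, h2.1, hkb.1, hkb.2,
    (autarkyPayoff_lt_fullInfoPayoff_iff (hk.1.trans h2.1) hkb.2).mpr (by linarith)⟩

/-! ### The efficient threshold signal -/

/-- Jensen's inequality on one cell of a partition, weighted by its mass so that null cells are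
allowed. Summed over two cells, it shows that pooling each cell at its mean is a mean-preserving
contraction. -/
theorem measureReal_mul_jensen (F : ProbabilityMeasure unitInterval) (A : Set unitInterval)
    {φ : ℝ → ℝ} (hφ : ConvexOn ℝ Set.univ φ) :
    (F : Measure unitInterval).real A * φ (⨍ θ in A, (θ : ℝ) ∂(F : Measure unitInterval)) ≤
      ∫ θ in A, φ (θ : ℝ) ∂(F : Measure unitInterval) := by
  have hc := continuous_of_convexOn hφ
  rcases eq_or_ne ((F : Measure unitInterval) A) 0 with h0 | h0
  · rw [setIntegral_measure_zero _ h0, measureReal_def, h0]; simp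
  have hpos : 0 < (F : Measure unitInterval).real A :=
    ENNReal.toReal_pos h0 (measure_ne_top _ _)
  have h := hφ.map_set_average_le hc.continuousOn isClosed_univ h0 (measure_ne_top _ _)
    (by simp) (integrable_coe F).integrableOn
    (integrable_of_continuous F (hc.comp continuous_subtype_val)).integrableOn
  rw [setAverage_eq (f := fun θ : unitInterval => φ (θ : ℝ)), smul_eq_mul] at h
  calc _ ≤ (F : Measure unitInterval).real A * (((F : Measure unitInterval).real A)⁻¹ *
        ∫ θ in A, φ (θ : ℝ) ∂(F : Measure unitInterval)) :=
        mul_le_mul_of_nonneg_left h hpos.le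
    _ = _ := by rw [mul_inv_cancel_left₀ hpos.ne']

theorem setAverage_mem (F : ProbabilityMeasure unitInterval) (A : Set unitInterval) :
    ⨍ θ in A, (θ : ℝ) ∂(F : Measure unitInterval) ∈ unitInterval := by
  rw [setAverage_eq, smul_eq_mul]
  have h0 : 0 ≤ ∫ θ in A, (θ : ℝ) ∂(F : Measure unitInterval) :=
    integral_nonneg fun θ => θ.2.1
  refine ⟨mul_nonneg (inv_nonneg.mpr measureReal_nonneg) h0, ?_⟩
  have h1 : ∫ θ in A, (θ : ℝ) ∂(F : Measure unitInterval) ≤ (F : Measure unitInterval).real A := by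
    have := setIntegral_mono (s := A) (integrable_coe F).integrableOn
      (integrable_const (1 : ℝ)).integrableOn (fun θ => θ.2.2)
    simpa using this
  exact inv_mul_le_one_of_le₀ h1 measureReal_nonneg

theorem measureReal_mul_setAverage (F : ProbabilityMeasure unitInterval) (A : Set unitInterval) :
    (F : Measure unitInterval).real A * ⨍ θ in A, (θ : ℝ) ∂(F : Measure unitInterval) =
      ∫ θ in A, (θ : ℝ) ∂(F : Measure unitInterval) := by
  have := measure_smul_setAverage (fun θ : unitInterval => (θ : ℝ))
    (measure_ne_top (F : Measure unitInterval) A)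
  simpa using this

/-- There is a binary signal that tells whether the quality exceeds the free-full-information
payoff: with probability `q` the posterior mean is `lo`, otherwise it is `hi`. -/
theorem exists_thresholdSignal (hk : 0 < k) (hkm : k < mean F) :
    ∃ (G : {G : ProbabilityMeasure unitInterval // IsMPC G F}) (q : ℝ) (lo hi : unitInterval),
      (G.1 : Measure unitInterval) =
        ENNReal.ofReal q • Measure.dirac lo + ENNReal.ofReal (1 - q) • Measure.dirac hi ∧
      0 ≤ q ∧ q < 1 ∧ q * lo + (1 - q) * hi = mean F ∧
      (1 - q) * (hi - fullInfoPayoff F k) = k ∧ (q = 0 ∨ (lo : ℝ) < fullInfoPayoff F k) := by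
  set u := fullInfoPayoff F k with hu
  set μ := (F : Measure unitInterval) with hμ
  -- Pool the qualities below ū and those above ū at their conditional means.
  set A : Set unitInterval := {θ | (θ : ℝ) < u} with hA
  have hAm : MeasurableSet A := measurableSet_lt continuous_subtype_val.measurable measurable_const
  have hAc : Aᶜ = {θ : unitInterval | u ≤ (θ : ℝ)} := by ext θ; simp [hA]
  have hex : ∫ θ in Aᶜ, ((θ : ℝ) - u) ∂μ = k := by
    rw [hAc]; exact excess_fullInfoPayoff hk hkm
  have hq1 : μ.real Aᶜ = 1 - μ.real A := by
    rw [measureReal_compl hAm]; simp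
  have hcpos : 0 < μ.real Aᶜ := by
    refine measureReal_nonneg.lt_of_ne fun h0 => ?_
    have : μ Aᶜ = 0 := (measureReal_eq_zero_iff).mp h0.symm
    rw [setIntegral_measure_zero _ this] at hex
    linarith
  set lo : unitInterval := ⟨_, setAverage_mem F A⟩ with hlo
  set hi : unitInterval := ⟨_, setAverage_mem F Aᶜ⟩ with hhi
  have hqlo : μ.real A * (lo : ℝ) = ∫ θ in A, (θ : ℝ) ∂μ := measureReal_mul_setAverage F A
  have hqhi : μ.real Aᶜ * (hi : ℝ) = ∫ θ in Aᶜ, (θ : ℝ) ∂μ := measureReal_mul_setAverage F Aᶜ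
  have hprob : IsProbabilityMeasure (ENNReal.ofReal (μ.real A) • Measure.dirac lo +
      ENNReal.ofReal (1 - μ.real A) • Measure.dirac hi) := by
    constructor
    simp only [Measure.coe_add, Measure.coe_smul, Pi.add_apply, Pi.smul_apply, measure_univ,
      smul_eq_mul, mul_one]
    rw [← ENNReal.ofReal_add measureReal_nonneg (by linarith)]
    simp
  refine ⟨⟨⟨_, hprob⟩, ?_⟩, μ.real A, lo, hi, rfl, measureReal_nonneg, by linarith, ?_, ?_, ?_⟩
  · intro φ hφ
    have hc := continuous_of_convexOn hφ
    have hi1 : Integrable (fun θ : unitInterval => φ θ) (Measure.dirac lo) :=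
      integrable_of_continuous ⟨Measure.dirac lo, inferInstance⟩ (hc.comp continuous_subtype_val)
    have hi2 : Integrable (fun θ : unitInterval => φ θ) (Measure.dirac hi) :=
      integrable_of_continuous ⟨Measure.dirac hi, inferInstance⟩ (hc.comp continuous_subtype_val)
    change ∫ θ, φ θ ∂(ENNReal.ofReal (μ.real A) • Measure.dirac lo +
      ENNReal.ofReal (1 - μ.real A) • Measure.dirac hi) ≤ _
    rw [integral_add_measure (hi1.smul_measure ENNReal.ofReal_ne_top)
      (hi2.smul_measure ENNReal.ofReal_ne_top), integral_smul_measure, integral_smul_measure,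
      integral_dirac, integral_dirac, ENNReal.toReal_ofReal measureReal_nonneg,
      ENNReal.toReal_ofReal (by linarith), smul_eq_mul, smul_eq_mul, ← hq1,
      ← integral_add_compl hAm (f := fun θ : unitInterval => φ θ)
        (integrable_of_continuous F (hc.comp continuous_subtype_val))]
    exact add_le_add (measureReal_mul_jensen F A hφ) (measureReal_mul_jensen F Aᶜ hφ)
  · rw [← hq1, hqlo, hqhi, integral_add_compl hAm (integrable_coe F)]; rfl
  · rw [integral_sub (integrable_coe F).integrableOn (integrable_const u).integrableOn,
      ← hqhi] at hex
    simp only [integral_const, measureReal_restrict_apply_univ, smul_eq_mul] at hex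
    rw [← hq1, mul_sub]
    exact hex
  · rcases eq_or_ne (μ.real A) 0 with h0 | h0
    · exact Or.inl h0
    right
    have hApos : 0 < μ.real A := measureReal_nonneg.lt_of_ne h0.symm
    have hintegral : 0 < ∫ θ in A, (u - (θ : ℝ)) ∂μ := by
      rw [setIntegral_pos_iff_support_of_nonneg_ae]
      · have : (Function.support fun θ : unitInterval => u - (θ : ℝ)) ∩ A = A := by
          refine Set.inter_eq_right.mpr fun θ hθ => ?_
          have : (θ : ℝ) < u := hθ
          simp only [Function.mem_support]
          linarith
        rw [this]
        exact (ENNReal.toReal_pos_iff.mp hApos).1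
      · refine (ae_restrict_iff' hAm).mpr (Filter.Eventually.of_forall fun θ hθ => ?_)
        have : (θ : ℝ) < u := hθ
        simp only [Pi.zero_apply]
        linarith
      · exact ((integrable_const u).sub (integrable_coe F)).integrableOn
    rw [integral_sub (integrable_const u).integrableOn (integrable_coe F).integrableOn,
      ← hqlo] at hintegral
    simp only [integral_const, measureReal_restrict_apply_univ, smul_eq_mul] at hintegral
    nlinarith

end Environment

variable {F : ProbabilityMeasure unitInterval} {n : ℕ}

/-! ### Measurability of single offers -/

theorem measurable_apply_offer {A : Set unitInterval} (hA : MeasurableSet A) :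
    Measurable fun o : Offer F => (o.2.1 : Measure unitInterval) A :=
  (Measure.measurable_coe hA).comp
    (measurable_subtype_coe.comp (measurable_subtype_coe.comp measurable_snd))

theorem probabilityMeasure_ext_of_Ioo_rat {G H : ProbabilityMeasure unitInterval}
    (h : ∀ a b : ℚ, (G : Measure unitInterval) (Subtype.val ⁻¹' Set.Ioo (a : ℝ) b) =
      (H : Measure unitInterval) (Subtype.val ⁻¹' Set.Ioo (a : ℝ) b)) : G = H := by
  have hmap : (G : Measure unitInterval).map Subtype.val =
      (H : Measure unitInterval).map Subtype.val := by
    refine Real.measure_ext_Ioo_rat fun a b => ?_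
    rw [Measure.map_apply measurable_subtype_coe measurableSet_Ioo,
      Measure.map_apply measurable_subtype_coe measurableSet_Ioo, h]
  have hemb : MeasurableEmbedding (Subtype.val : unitInterval → ℝ) :=
    MeasurableEmbedding.subtype_coe measurableSet_Icc
  apply Subtype.ext
  have h1 := congrArg (Measure.comap (Subtype.val : unitInterval → ℝ)) hmap
  rwa [hemb.comap_map, hemb.comap_map] at h1

/-- A law on [0,1] is determined by its values on countably many rational intervals. Measurable
singletons let strategies test for a particular offer profile, and allow integration against point
masses without measurability of the integrand. -/
instance : MeasurableSingletonClass (Offer F) := by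
  refine ⟨fun o => ?_⟩
  have : ({o} : Set (Offer F)) = {o' | o'.1 = o.1} ∩ ⋂ a : ℚ, ⋂ b : ℚ,
      {o' : Offer F | (o'.2.1 : Measure unitInterval) (Subtype.val ⁻¹' Set.Ioo (a : ℝ) b) =
        (o.2.1 : Measure unitInterval) (Subtype.val ⁻¹' Set.Ioo (a : ℝ) b)} := by
    ext o'
    simp only [Set.mem_singleton_iff, Set.mem_inter_iff, Set.mem_iInter]
    constructor
    · rintro rfl; exact ⟨rfl, fun _ _ => rfl⟩
    · rintro ⟨h1, h2⟩
      exact Prod.ext h1 (Subtype.ext (probabilityMeasure_ext_of_Ioo_rat h2))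
  rw [this]
  refine (measurableSet_eq_fun measurable_fst measurable_const).inter
    (MeasurableSet.iInter fun a => MeasurableSet.iInter fun b => ?_)
  exact measurableSet_eq_fun
    (measurable_apply_offer (measurable_subtype_coe measurableSet_Ioo)) measurable_const

/-! ### Product laws supported on at most two offer profiles -/

theorem dirac_univ_pi {ι X : Type*} [Fintype ι] [MeasurableSpace X] (c : ι → X)
    {s : ι → Set X} (hs : ∀ i, MeasurableSet (s i)) :
    Measure.dirac c (Set.univ.pi s) = ∏ i, Measure.dirac (c i) (s i) := by
  rw [Measure.dirac_apply' _ (MeasurableSet.univ_pi hs)]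
  simp_rw [Measure.dirac_apply' _ (hs _)]
  by_cases hc : c ∈ Set.univ.pi s
  · rw [Set.indicator_of_mem hc]
    refine (Finset.prod_eq_one fun i _ => ?_).symm
    rw [Set.indicator_of_mem (hc i trivial)]; rfl
  · rw [Set.indicator_of_notMem hc]
    simp only [Set.mem_pi, Set.mem_univ, true_implies, not_forall] at hc
    obtain ⟨i, hi⟩ := hc
    exact (Finset.prod_eq_zero (Finset.mem_univ i) (by rw [Set.indicator_of_notMem hi])).symm

theorem pi_dirac {ι X : Type*} [Fintype ι] [MeasurableSpace X] (b : ι → X) :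
    Measure.pi (fun i => Measure.dirac (b i)) = Measure.dirac b :=
  Measure.pi_eq fun _ hs => dirac_univ_pi b hs

theorem pi_two_point {ι X : Type*} [Fintype ι] [DecidableEq ι] [MeasurableSpace X]
    (b : ι → X) (i₀ : ι) (a : X) (l : ℝ≥0∞) (μ : ι → Measure X)
    [∀ i, IsProbabilityMeasure (μ i)]
    (h₀ : μ i₀ = l • Measure.dirac a + (1 - l) • Measure.dirac (b i₀))
    (h : ∀ i, i ≠ i₀ → μ i = Measure.dirac (b i)) :
    Measure.pi μ =
      l • Measure.dirac (Function.update b i₀ a) + (1 - l) • Measure.dirac b := by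
  refine Measure.pi_eq fun s hs => ?_
  have hrest : ∏ i ∈ Finset.univ.erase i₀, μ i (s i) =
      ∏ i ∈ Finset.univ.erase i₀, Measure.dirac (b i) (s i) :=
    Finset.prod_congr rfl fun i hi => by rw [h i (Finset.ne_of_mem_erase hi)]
  have hrest' : ∏ i ∈ Finset.univ.erase i₀, Measure.dirac (Function.update b i₀ a i) (s i) =
      ∏ i ∈ Finset.univ.erase i₀, Measure.dirac (b i) (s i) :=
    Finset.prod_congr rfl fun i hi => by
      rw [Function.update_of_ne (Finset.ne_of_mem_erase hi)]
  simp only [Measure.coe_add, Measure.coe_smul, Pi.add_apply, Pi.smul_apply, smul_eq_mul,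
    dirac_univ_pi _ hs]
  rw [← Finset.mul_prod_erase _ (fun i => μ i (s i)) (Finset.mem_univ i₀),
    ← Finset.mul_prod_erase _ (fun i => Measure.dirac (Function.update b i₀ a i) (s i))
      (Finset.mem_univ i₀),
    ← Finset.mul_prod_erase _ (fun i => Measure.dirac (b i) (s i)) (Finset.mem_univ i₀),
    hrest, hrest', h₀, Function.update_self]
  simp only [Measure.coe_add, Measure.coe_smul, Pi.add_apply, Pi.smul_apply, smul_eq_mul]
  ring

/-! ### Elementary properties of expected totals -/

theorem isProbabilityMeasure_offers (σ : Profile F n) (t : ℕ) (h : History F n t) :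
    IsProbabilityMeasure (Measure.pi fun i => (σ.broker i).offer t h) := by
  have := fun i => (σ.broker i).markov t
  infer_instance

theorem sum_buy_coe (a : AgentStrategy F n) (t : ℕ) (x : History F n t × Offers F n) :
    ∑ w, (a.buy t x w : ℝ≥0∞) = 1 := by
  exact_mod_cast congrArg ((↑) : ℝ≥0 → ℝ≥0∞) (a.sum_buy t x)

theorem ofReal_one_sub_add (c : unitInterval) :
    ENNReal.ofReal (1 - (c : ℝ)) + ENNReal.ofReal (c : ℝ) = 1 := by
  rw [← ENNReal.ofReal_add (by linarith [c.2.2]) c.2.1]; simp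

theorem historyNode_mono (σ : Profile F n) (g : Flow F n) {V W : ∀ t, History F n t → ℝ≥0∞}
    (hVW : ∀ t h, V t h ≤ W t h) (t : ℕ) (h : History F n t) :
    historyNode σ g V t h ≤ historyNode σ g W t h := by
  unfold historyNode offerNode signalNode
  refine lintegral_mono fun O => Finset.sum_le_sum fun w _ => ?_
  gcongr
  exact hVW _ _

theorem totalUpTo_mono (σ : Profile F n) (g : Flow F n) (t : ℕ) (h : History F n t) :
    Monotone fun N => totalUpTo σ g N t h := by
  refine monotone_nat_of_le_succ fun N => ?_
  induction N generalizing t h with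
  | zero => exact zero_le
  | succ N ih => exact historyNode_mono σ g (fun t h => ih t h) t h

theorem totalUpTo_le_total (σ : Profile F n) (g : Flow F n) (N t : ℕ) (h : History F n t) :
    totalUpTo σ g N t h ≤ total σ g t h := le_iSup (fun N => totalUpTo σ g N t h) N

/-- For a flow that does not depend on the stopping decision. -/
theorem signalNode_of_const (σ : Profile F n) {g : Flow F n} (V : ∀ t, History F n t → ℝ≥0∞)
    (t : ℕ) (h : History F n t) (O : Offers F n) (w : Purchase n) (m : unitInterval) {r : ℝ≥0∞}
    (hg : ∀ b, g O w m b = r) :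
    signalNode σ g V t h O w m =
      r + ENNReal.ofReal (σ.agent.cont t (h, O, w, m) : ℝ) * V (t + 1) (h.extend (O, w, m)) := by
  rw [signalNode, hg, hg, mul_add, ← add_assoc, ← add_mul, ofReal_one_sub_add, one_mul]

theorem signalNode_consumption (σ : Profile F n) (V : ∀ t, History F n t → ℝ≥0∞)
    (t : ℕ) (h : History F n t) (O : Offers F n) (w : Purchase n) (m : unitInterval) :
    signalNode σ consumptionFlow V t h O w m =
      ENNReal.ofReal (1 - (σ.agent.cont t (h, O, w, m) : ℝ)) * ENNReal.ofReal (m : ℝ) +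
      ENNReal.ofReal (σ.agent.cont t (h, O, w, m) : ℝ) * V (t + 1) (h.extend (O, w, m)) := by
  simp [signalNode, consumptionFlow]

theorem offerNode_le_of_signalNode_le (σ : Profile F n) {g : Flow F n}
    {V : ∀ t, History F n t → ℝ≥0∞} {t : ℕ} {h : History F n t} {O : Offers F n} {c : ℝ≥0∞}
    (hc : ∀ w m, signalNode σ g V t h O w m ≤ c) : offerNode σ g V t h O ≤ c := by
  calc offerNode σ g V t h O
      ≤ ∑ w, (σ.agent.buy t (h, O) w : ℝ≥0∞) * c := by
        refine Finset.sum_le_sum fun w _ => mul_le_mul_right ?_ _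
        calc _ ≤ ∫⁻ _, c ∂(signalOf O w : Measure unitInterval) := lintegral_mono fun m => hc w m
          _ = c := by simp
    _ = c := by rw [← Finset.sum_mul, sum_buy_coe, one_mul]

theorem signalNode_consumption_le_one (σ : Profile F n) {V : ∀ t, History F n t → ℝ≥0∞}
    (hV : ∀ t h, V t h ≤ 1) (t : ℕ) (h : History F n t) (O : Offers F n) (w : Purchase n)
    (m : unitInterval) : signalNode σ consumptionFlow V t h O w m ≤ 1 := by
  rw [signalNode_consumption, ← ofReal_one_sub_add (σ.agent.cont t (h, O, w, m))]
  refine add_le_add (mul_le_of_le_one_right' ?_) (mul_le_of_le_one_right' (hV _ _))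
  exact ENNReal.ofReal_le_one.mpr m.2.2

theorem totalUpTo_consumption_le_one (σ : Profile F n) (N t : ℕ) (h : History F n t) :
    totalUpTo σ consumptionFlow N t h ≤ 1 := by
  induction N generalizing t h with
  | zero => exact zero_le
  | succ N ih =>
    have := isProbabilityMeasure_offers σ t h
    calc _ ≤ ∫⁻ _, 1 ∂(Measure.pi fun i => (σ.broker i).offer t h) :=
          lintegral_mono fun O => offerNode_le_of_signalNode_le σ
            fun w m => signalNode_consumption_le_one σ ih t h O w m
      _ = 1 := by simp

theorem total_consumption_le_one (σ : Profile F n) (t : ℕ) (h : History F n t) :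
    total σ consumptionFlow t h ≤ 1 := iSup_le fun N => totalUpTo_consumption_le_one σ N t h

/-! ### One-step comparison of consumption and costs -/

theorem weighted_le_max {c : unitInterval} {x b v r : ℝ≥0∞} (h : v ≤ b + r) :
    ENNReal.ofReal (1 - (c : ℝ)) * x + ENNReal.ofReal (c : ℝ) * v ≤
      max x b + ENNReal.ofReal (c : ℝ) * r := by
  calc _ ≤ ENNReal.ofReal (1 - (c : ℝ)) * max x b +
        ENNReal.ofReal (c : ℝ) * (max x b + r) := by
        gcongr
        · exact le_max_left _ _
        · exact h.trans (add_le_add (le_max_right _ _) le_rfl)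
    _ = _ := by rw [mul_add, ← add_assoc, ← add_mul, ofReal_one_sub_add, one_mul]

/-- One Bellman step in additive form, so that infinite costs need no special treatment. `B` bounds
the net continuation value, `D` the value gross of the fixed cost `κ`, and `r` is the part of the
flow that depends on the purchase. With r = 0 it gives the surplus bound, with r the price it gives
the agent's bound. -/
theorem offerNode_consumption_le (σ : Profile F n) {g : Flow F n}
    {Vc Vg : ∀ t, History F n t → ℝ≥0∞} {t : ℕ} {h : History F n t} {O : Offers F n}
    {κ D : ℝ≥0∞} {r B : Purchase n → ℝ≥0∞} (hg : ∀ w m b, g O w m b = κ + r w)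
    (hV : ∀ w m, Vc (t + 1) (h.extend (O, w, m)) ≤ B w + Vg (t + 1) (h.extend (O, w, m)))
    (hD : ∀ w, ∫⁻ x : unitInterval, max (ENNReal.ofReal (x : ℝ)) (B w)
      ∂(signalOf O w : Measure unitInterval) ≤ D + r w) :
    offerNode σ consumptionFlow Vc t h O + κ ≤ D + offerNode σ g Vg t h O := by
  have key : ∀ w, ∫⁻ m, signalNode σ consumptionFlow Vc t h O w m
        ∂(signalOf O w : Measure unitInterval) + κ ≤
      D + ∫⁻ m, signalNode σ g Vg t h O w m ∂(signalOf O w : Measure unitInterval) := by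
    intro w
    simp_rw [signalNode_of_const σ Vg t h O w _ (hg w _), signalNode_consumption]
    rw [lintegral_add_left measurable_const, lintegral_const, measure_univ, mul_one]
    calc _ ≤ (∫⁻ m, (max (ENNReal.ofReal (m : ℝ)) (B w) +
            ENNReal.ofReal (σ.agent.cont t (h, O, w, m) : ℝ) * Vg (t + 1) (h.extend (O, w, m)))
            ∂(signalOf O w : Measure unitInterval)) + κ := by
          exact add_le_add (lintegral_mono fun m => weighted_le_max (hV w m)) le_rfl
      _ ≤ D + r w + (∫⁻ m, ENNReal.ofReal (σ.agent.cont t (h, O, w, m) : ℝ) *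
            Vg (t + 1) (h.extend (O, w, m)) ∂(signalOf O w : Measure unitInterval)) + κ := by
          rw [lintegral_add_left (by fun_prop)]
          gcongr
          exact hD w
      _ = _ := by ring
  unfold offerNode
  have h1 : κ = ∑ w, (σ.agent.buy t (h, O) w : ℝ≥0∞) * κ := by
    rw [← Finset.sum_mul, sum_buy_coe, one_mul]
  have h2 : D = ∑ w, (σ.agent.buy t (h, O) w : ℝ≥0∞) * D := by
    rw [← Finset.sum_mul, sum_buy_coe, one_mul]
  rw [h1, h2, ← Finset.sum_add_distrib, ← Finset.sum_add_distrib]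
  refine Finset.sum_le_sum fun w _ => ?_
  rw [← mul_add, ← mul_add]
  exact mul_le_mul_right (key w) _

/-! ### The surplus bound -/

/-- The search cost alone. -/
def searchFlow (k : ℝ) : Flow F n := fun _ _ _ _ => ENNReal.ofReal k

theorem isMPC_signalOf (O : Offers F n) (w : Purchase n) : IsMPC (signalOf O w) F := by
  cases w with
  | none => exact isMPC_nullSignal F
  | some i => exact (O i).2.2

/-- Backward induction for a planner who ignores prices: if continuing is worth at most ū, any
signal is worth at most S(F,ū) = ū + k, and paying k leaves ū. -/
theorem totalUpTo_consumption_le (σ : Profile F n) {k : ℝ} (hk : 0 < k) (hkm : k < mean F)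
    (N t : ℕ) (h : History F n t) :
    totalUpTo σ consumptionFlow N t h ≤
      ENNReal.ofReal (fullInfoPayoff F k) + totalUpTo σ (searchFlow k) N t h := by
  induction N generalizing t h with
  | zero => exact zero_le
  | succ N ih =>
    have hu : 0 ≤ fullInfoPayoff F k :=
      (autarkyPayoff_pos hkm).le.trans (autarkyPayoff_le_fullInfoPayoff hk hkm)
    have := isProbabilityMeasure_offers σ t h
    calc totalUpTo σ consumptionFlow (N + 1) t h
        ≤ ∫⁻ O, (ENNReal.ofReal (fullInfoPayoff F k) +
            offerNode σ (searchFlow k) (totalUpTo σ (searchFlow k) N) t h O)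
            ∂(Measure.pi fun i => (σ.broker i).offer t h) := by
          refine lintegral_mono fun O => ?_
          have := offerNode_consumption_le σ (g := searchFlow k) (h := h) (O := O)
            (κ := ENNReal.ofReal k) (r := 0)
            (D := ENNReal.ofReal (fullInfoPayoff F k) + ENNReal.ofReal k)
            (B := fun _ => ENNReal.ofReal (fullInfoPayoff F k))
            (by simp [searchFlow]) (fun w m => ih _ _) (fun w => by
              rw [lintegral_max _ hu, ← ENNReal.ofReal_add hu hk.le,
                ← stopValue_fullInfoPayoff hk hkm]
              simpa using ENNReal.ofReal_le_ofReal ((isMPC_signalOf O w).stopValue_le _))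
          rw [add_right_comm] at this
          exact (ENNReal.add_le_add_iff_right ENNReal.ofReal_ne_top).mp this
      _ = _ := by
          rw [lintegral_add_left measurable_const, lintegral_const, measure_univ, mul_one]
          rfl

/-- Value functions are not shown to be measurable. The lower integral is superadditive for
arbitrary functions, and this one direction is enough for the surplus bound. -/
theorem totalUpTo_add_le (σ : Profile F n) (g₁ g₂ : Flow F n) (N t : ℕ) (h : History F n t) :
    totalUpTo σ g₁ N t h + totalUpTo σ g₂ N t h ≤ totalUpTo σ (g₁ + g₂) N t h := by
  induction N generalizing t h with
  | zero => simp [totalUpTo]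
  | succ N ih =>
    refine (le_lintegral_add _ _).trans (lintegral_mono fun O => ?_)
    unfold offerNode
    rw [← Finset.sum_add_distrib]
    refine Finset.sum_le_sum fun w _ => ?_
    rw [← mul_add]
    refine mul_le_mul_right ((le_lintegral_add _ _).trans (lintegral_mono fun m => ?_)) _
    unfold signalNode
    calc _ = ENNReal.ofReal (1 - (σ.agent.cont t (h, O, w, m) : ℝ)) * (g₁ + g₂) O w m true +
          ENNReal.ofReal (σ.agent.cont t (h, O, w, m) : ℝ) * ((g₁ + g₂) O w m false +
            (totalUpTo σ g₁ N (t + 1) (h.extend (O, w, m)) +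
              totalUpTo σ g₂ N (t + 1) (h.extend (O, w, m)))) := by
          simp only [Pi.add_apply]; ring
      _ ≤ _ := by gcongr; exact ih _ _

theorem total_add_le (σ : Profile F n) (g₁ g₂ : Flow F n) (t : ℕ) (h : History F n t) :
    total σ g₁ t h + total σ g₂ t h ≤ total σ (g₁ + g₂) t h := by
  unfold total
  rw [ENNReal.iSup_add_iSup_of_monotone (totalUpTo_mono σ g₁ t h) (totalUpTo_mono σ g₂ t h)]
  exact iSup_mono fun N => totalUpTo_add_le σ g₁ g₂ N t h

theorem sum_total_le (σ : Profile F n) {ι : Type*} (s : Finset ι) (g : ι → Flow F n) (t : ℕ)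
    (h : History F n t) : ∑ i ∈ s, total σ (g i) t h ≤ total σ (∑ i ∈ s, g i) t h := by
  classical
  induction s using Finset.induction_on with
  | empty => simp
  | insert i s hi ih =>
    rw [Finset.sum_insert hi, Finset.sum_insert hi]
    exact (add_le_add le_rfl ih).trans (total_add_le σ _ _ t h)

theorem costFlow_eq (k : ℝ) :
    (costFlow k : Flow F n) = searchFlow k + ∑ i, revenueFlow i := by
  funext O w m b
  simp only [costFlow, searchFlow, Pi.add_apply, Finset.sum_apply, revenueFlow]
  congr 1
  cases w with
  | none => simp [priceOf]
  | some j => simp [priceOf]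

/-- The agent's costs are search costs plus all brokers' revenues, so the prices cancel from the
surplus and the planner's bound applies. -/
theorem total_consumption_add_revenue_le (σ : Profile F n) {k : ℝ} (hk : 0 < k)
    (hkm : k < mean F) (t : ℕ) (h : History F n t) :
    total σ consumptionFlow t h + ∑ i, brokerPayoff σ i t h ≤
      ENNReal.ofReal (fullInfoPayoff F k) + total σ (costFlow k) t h := by
  have h1 : total σ consumptionFlow t h ≤
      ENNReal.ofReal (fullInfoPayoff F k) + total σ (searchFlow k) t h :=
    iSup_le fun N => (totalUpTo_consumption_le σ hk hkm N t h).trans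
      (add_le_add le_rfl (totalUpTo_le_total σ _ N t h))
  have h2 := total_add_le σ (searchFlow k) (∑ i, revenueFlow i) t h
  rw [← costFlow_eq] at h2
  have h3 := sum_total_le σ Finset.univ revenueFlow t h
  calc _ ≤ ENNReal.ofReal (fullInfoPayoff F k) + total σ (searchFlow k) t h +
        total σ (∑ i, revenueFlow i) t h := add_le_add h1 h3
    _ ≤ _ := by rw [add_assoc]; gcongr

/-! ### Payoffs as real numbers -/

theorem sub_toEReal {A B : ℝ≥0∞} (hA : A ≠ ⊤) (hB : B ≠ ⊤) :
    (A : EReal) - (B : EReal) = ((A.toReal - B.toReal : ℝ) : EReal) := by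
  rw [← EReal.coe_toReal (x := (A : EReal)) (by simpa using hA) (by simp),
    ← EReal.coe_toReal (x := (B : EReal)) (by simpa using hB) (by simp)]
  simp

theorem sub_top_toEReal (A : ℝ≥0∞) : (A : EReal) - ((⊤ : ℝ≥0∞) : EReal) = ⊥ := by
  simp [sub_eq_add_neg]

/-- Comparison of payoffs through a common upper bound `D` that is attained. -/
theorem sub_le_sub_toEReal {A B A' B' D κ : ℝ≥0∞} (hA : A ≠ ⊤) (hA' : A' ≠ ⊤) (hκ : κ ≠ ⊤)
    (h' : A' + κ ≤ D + B') (h : D + B ≤ A + κ) :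
    (A' : EReal) - (B' : EReal) ≤ (A : EReal) - (B : EReal) := by
  rcases eq_or_ne B' ⊤ with hB' | hB'
  · rw [hB', sub_top_toEReal]; exact bot_le
  have hfin : D + B ≠ ⊤ := ne_top_of_le_ne_top (ENNReal.add_ne_top.mpr ⟨hA, hκ⟩) h
  obtain ⟨hD, hB⟩ := ENNReal.add_ne_top.mp hfin
  rw [sub_toEReal hA hB, sub_toEReal hA' hB', EReal.coe_le_coe_iff]
  have e' := (ENNReal.toReal_le_toReal (ENNReal.add_ne_top.mpr ⟨hA', hκ⟩)
    (ENNReal.add_ne_top.mpr ⟨hD, hB'⟩)).mpr h'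
  have e := (ENNReal.toReal_le_toReal hfin (ENNReal.add_ne_top.mpr ⟨hA, hκ⟩)).mpr h
  rw [ENNReal.toReal_add, ENNReal.toReal_add] at e e' <;> try assumption
  linarith

theorem sum_le_fullInfoPayoff (σ : Profile F n) {k : ℝ} (hk : 0 < k) (hkm : k < mean F)
    (t : ℕ) (h : History F n t) {y : Fin n → ℝ} {u : ℝ}
    (hy : ∀ i, (y i : EReal) = (brokerPayoff σ i t h : EReal))
    (hu : (u : EReal) = agentPayoff k σ t h) : ∑ i, y i + u ≤ fullInfoPayoff F k := by
  have hC : total σ consumptionFlow t h ≠ ⊤ :=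
    ne_top_of_le_ne_top ENNReal.one_ne_top (total_consumption_le_one σ t h)
  have hK : total σ (costFlow k) t h ≠ ⊤ := by
    intro htop
    rw [agentPayoff, htop, sub_top_toEReal] at hu
    exact EReal.coe_ne_bot _ hu
  have hR : ∀ i, brokerPayoff σ i t h ≠ ⊤ := by
    intro i htop
    have := hy i
    rw [htop] at this
    exact EReal.coe_ne_top _ this
  have hyR : ∀ i, y i = (brokerPayoff σ i t h).toReal := by
    intro i
    have := hy i
    rw [← EReal.coe_toReal (x := (brokerPayoff σ i t h : EReal)) (by simpa using hR i)
      (by simp)] at this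
    simpa using this
  rw [agentPayoff, sub_toEReal hC hK, EReal.coe_eq_coe_iff] at hu
  have hu0 : 0 ≤ fullInfoPayoff F k :=
    (autarkyPayoff_pos hkm).le.trans (autarkyPayoff_le_fullInfoPayoff hk hkm)
  have hS : ∑ i, brokerPayoff σ i t h ≠ ⊤ := ENNReal.sum_ne_top.mpr fun i _ => hR i
  have := total_consumption_add_revenue_le σ hk hkm t h
  have := (ENNReal.toReal_le_toReal (ENNReal.add_ne_top.mpr ⟨hC, hS⟩)
    (ENNReal.add_ne_top.mpr ⟨ENNReal.ofReal_ne_top, hK⟩)).mpr this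
  rw [ENNReal.toReal_add hC hS, ENNReal.toReal_add ENNReal.ofReal_ne_top hK,
    ENNReal.toReal_ofReal hu0, ENNReal.toReal_sum fun i _ => hR i] at this
  simp_rw [hyR]
  linarith

/-! ### Verification of the agent's optimality -/

/-- A certificate that the agent best responds and obtains `U`. After offers `O` and purchase `w`
the continuation value is `next O w`, whatever the signal, and `V O` is the best value attainable
after the offers `O`. Offers are supported on at most two profiles, at which the search goes on
with probability at most `ρ`. -/
structure AgentCertificate (k : ℝ) (σ : Profile F n) (next : Offers F n → Purchase n → ℝ≥0∞)
    (V : Offers F n → ℝ≥0∞) (U : ∀ t, History F n t → ℝ≥0∞) (ρ : ℝ≥0∞) : Prop where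
  lintegral_max_le : ∀ O w, ∫⁻ x : unitInterval, max (ENNReal.ofReal (x : ℝ)) (next O w)
    ∂(signalOf O w : Measure unitInterval) ≤ V O + priceOf O w
  le_lintegral_max : ∀ t h O w, σ.agent.buy t (h, O) w ≠ 0 → V O + priceOf O w ≤
    ∫⁻ x : unitInterval, max (ENNReal.ofReal (x : ℝ)) (next O w)
      ∂(signalOf O w : Measure unitInterval)
  cont_eq : ∀ t h O w m, σ.agent.cont t (h, O, w, m) =
    if ENNReal.ofReal (m : ℝ) < next O w then 1 else 0
  extend_eq : ∀ t (h : History F n t) O w m, U (t + 1) (h.extend (O, w, m)) = next O w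
  le_one : ∀ t h, U t h ≤ 1
  law : ∀ t h, ∃ (l : ℝ≥0∞) (O₁ O₂ : Offers F n), l ≤ 1 ∧
    (Measure.pi fun i => (σ.broker i).offer t h) =
      l • Measure.dirac O₁ + (1 - l) • Measure.dirac O₂ ∧
    U t h + ENNReal.ofReal k = l * V O₁ + (1 - l) * V O₂ ∧
    ∀ O, O = O₁ ∨ O = O₂ → ∀ w, σ.agent.buy t (h, O) w ≠ 0 →
      ∫⁻ x : unitInterval, (if ENNReal.ofReal (x : ℝ) < next O w then 1 else 0)
        ∂(signalOf O w : Measure unitInterval) ≤ ρ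
  lt_one : ρ < 1

theorem lintegral_two_point {X : Type*} [MeasurableSpace X] [MeasurableSingletonClass X]
    (l l' : ℝ≥0∞) (x y : X) (f : X → ℝ≥0∞) :
    ∫⁻ z, f z ∂(l • Measure.dirac x + l' • Measure.dirac y) = l * f x + l' * f y := by
  rw [lintegral_add_measure, lintegral_smul_measure, lintegral_smul_measure, lintegral_dirac,
    lintegral_dirac, smul_eq_mul, smul_eq_mul]

namespace AgentCertificate

variable {k : ℝ} {σ : Profile F n} {next : Offers F n → Purchase n → ℝ≥0∞}
  {V : Offers F n → ℝ≥0∞} {U : ∀ t, History F n t → ℝ≥0∞} {ρ : ℝ≥0∞}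

/-- The agent's deviation leaves the law of offers unchanged, and a two-point law replaces the
integral over offers by a finite sum. -/
theorem historyNode_eq (a : AgentStrategy F n) (g : Flow F n) (W : ∀ t, History F n t → ℝ≥0∞)
    {t : ℕ} {h : History F n t} {l : ℝ≥0∞} {O₁ O₂ : Offers F n}
    (hl : (Measure.pi fun i => (σ.broker i).offer t h) =
      l • Measure.dirac O₁ + (1 - l) • Measure.dirac O₂) :
    historyNode (σ.deviateAgent a) g W t h =
      l * offerNode (σ.deviateAgent a) g W t h O₁ +
        (1 - l) * offerNode (σ.deviateAgent a) g W t h O₂ := by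
  unfold historyNode
  change ∫⁻ O, _ ∂(Measure.pi fun i => (σ.broker i).offer t h) = _
  rw [hl, lintegral_two_point]

theorem offerNode_le (C : AgentCertificate k σ next V U ρ) (a : AgentStrategy F n)
    {Vc Vg : ∀ t, History F n t → ℝ≥0∞} (hV : ∀ t h, Vc t h ≤ U t h + Vg t h) (t : ℕ)
    (h : History F n t) (O : Offers F n) :
    offerNode (σ.deviateAgent a) consumptionFlow Vc t h O + ENNReal.ofReal k ≤
      V O + offerNode (σ.deviateAgent a) (costFlow k) Vg t h O :=
  offerNode_consumption_le _ (r := fun w => priceOf O w) (B := next O) (fun _ _ _ => rfl)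
    (fun w m => by rw [← C.extend_eq t h O w m]; exact hV _ _) (C.lintegral_max_le O)

/-- The upper half of the verification. No transversality condition is needed: an agent still
searching at the horizon has consumed nothing, and U ≥ 0. -/
theorem totalUpTo_le (C : AgentCertificate k σ next V U ρ) (a : AgentStrategy F n) (N t : ℕ)
    (h : History F n t) :
    totalUpTo (σ.deviateAgent a) consumptionFlow N t h ≤
      U t h + totalUpTo (σ.deviateAgent a) (costFlow k) N t h := by
  induction N generalizing t h with
  | zero => exact zero_le
  | succ N ih =>
    obtain ⟨l, O₁, O₂, hl, hlaw, hU, -⟩ := C.law t h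
    have h1 := C.offerNode_le a ih t h O₁
    have h2 := C.offerNode_le a ih t h O₂
    refine (ENNReal.add_le_add_iff_right (ENNReal.ofReal_ne_top (r := k))).mp ?_
    rw [add_right_comm, hU]
    change historyNode _ _ _ t h + _ ≤ _ + historyNode _ _ _ t h
    rw [historyNode_eq a _ _ hlaw,
      historyNode_eq a _ _ hlaw]
    calc _ = l * (offerNode (σ.deviateAgent a) consumptionFlow
            (totalUpTo (σ.deviateAgent a) consumptionFlow N) t h O₁ + ENNReal.ofReal k) +
          (1 - l) * (offerNode (σ.deviateAgent a) consumptionFlow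
            (totalUpTo (σ.deviateAgent a) consumptionFlow N) t h O₂ + ENNReal.ofReal k) := by
          have hk1 : ENNReal.ofReal k = l * ENNReal.ofReal k + (1 - l) * ENNReal.ofReal k := by
            rw [← add_mul, add_tsub_cancel_of_le hl, one_mul]
          rw [mul_add, mul_add, add_add_add_comm, ← hk1]
      _ ≤ l * (V O₁ + offerNode (σ.deviateAgent a) (costFlow k)
            (totalUpTo (σ.deviateAgent a) (costFlow k) N) t h O₁) +
          (1 - l) * (V O₂ + offerNode (σ.deviateAgent a) (costFlow k)
            (totalUpTo (σ.deviateAgent a) (costFlow k) N) t h O₂) := by gcongr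
      _ = _ := by ring

theorem total_le (C : AgentCertificate k σ next V U ρ) (a : AgentStrategy F n) (t : ℕ)
    (h : History F n t) :
    total (σ.deviateAgent a) consumptionFlow t h ≤
      U t h + total (σ.deviateAgent a) (costFlow k) t h :=
  iSup_le fun N => (C.totalUpTo_le a N t h).trans (add_le_add le_rfl (totalUpTo_le_total _ _ _ _ _))

theorem signalNode_le (C : AgentCertificate k σ next V U ρ) (a : AgentStrategy F n) (t : ℕ)
    (h : History F n t) (O : Offers F n) (w : Purchase n) (m : unitInterval) :
    signalNode (σ.deviateAgent a) consumptionFlow (total (σ.deviateAgent a) consumptionFlow)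
        t h O w m + (ENNReal.ofReal k + priceOf O w) ≤
      max (ENNReal.ofReal (m : ℝ)) (next O w) +
        signalNode (σ.deviateAgent a) (costFlow k) (total (σ.deviateAgent a) (costFlow k))
          t h O w m := by
  rw [signalNode_of_const _ (g := costFlow k) _ t h O w m
      (r := ENNReal.ofReal k + priceOf O w) (fun _ => rfl), signalNode_consumption]
  have h1 := C.total_le a (t + 1) (h.extend (O, w, m))
  rw [C.extend_eq t h O w m] at h1
  exact (add_le_add (weighted_le_max h1) le_rfl).trans_eq (by ring)

/-- The lower half of the verification: along the prescribed strategy the Bellman inequality is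
reversed, and the error `ε` is inherited only where the search continues. `le_offerNode` thus
multiplies it by the probability of continuing. -/
theorem le_signalNode (C : AgentCertificate k σ next V U ρ)
    {Vc Vg : ∀ t, History F n t → ℝ≥0∞} {ε : ℝ≥0∞} (hV : ∀ t h, U t h + Vg t h ≤ Vc t h + ε)
    (t : ℕ) (h : History F n t) (O : Offers F n) (w : Purchase n) (m : unitInterval) :
    max (ENNReal.ofReal (m : ℝ)) (next O w) + signalNode σ (costFlow k) Vg t h O w m ≤
      signalNode σ consumptionFlow Vc t h O w m +
        (if ENNReal.ofReal (m : ℝ) < next O w then 1 else 0) * ε +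
        (ENNReal.ofReal k + priceOf O w) := by
  rw [signalNode_of_const _ (g := costFlow k) _ t h O w m
      (r := ENNReal.ofReal k + priceOf O w) (fun _ => rfl), signalNode_consumption,
    C.cont_eq]
  have := hV (t + 1) (h.extend (O, w, m))
  rw [C.extend_eq] at this
  split_ifs with hlt
  · rw [max_eq_right hlt.le]
    simp only [Set.Icc.coe_one, ENNReal.ofReal_one, one_mul, sub_self, ENNReal.ofReal_zero,
      zero_mul, zero_add]
    calc _ = (next O w + Vg (t + 1) (h.extend (O, w, m))) +
          (ENNReal.ofReal k + priceOf O w) := by ring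
      _ ≤ _ := add_le_add this le_rfl
  · rw [max_eq_left (not_lt.mp hlt)]
    simp

theorem le_offerNode (C : AgentCertificate k σ next V U ρ)
    {Vc Vg : ∀ t, History F n t → ℝ≥0∞} {ε η : ℝ≥0∞} (hV : ∀ t h, U t h + Vg t h ≤ Vc t h + ε)
    (t : ℕ) (h : History F n t) (O : Offers F n)
    (hη : ∀ w, σ.agent.buy t (h, O) w ≠ 0 →
      ∫⁻ x : unitInterval, (if ENNReal.ofReal (x : ℝ) < next O w then 1 else 0)
        ∂(signalOf O w : Measure unitInterval) ≤ η) :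
    V O + offerNode σ (costFlow k) Vg t h O ≤
      offerNode σ consumptionFlow Vc t h O + η * ε + ENNReal.ofReal k := by
  have key : ∀ w, σ.agent.buy t (h, O) w ≠ 0 →
      V O + ∫⁻ m, signalNode σ (costFlow k) Vg t h O w m
        ∂(signalOf O w : Measure unitInterval) ≤
      ∫⁻ m, signalNode σ consumptionFlow Vc t h O w m
        ∂(signalOf O w : Measure unitInterval) + η * ε + ENNReal.ofReal k := by
    intro w hw
    have hind : Measurable fun m : unitInterval =>
        (if ENNReal.ofReal (m : ℝ) < next O w then (1 : ℝ≥0∞) else 0) :=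
      Measurable.ite (measurableSet_lt (by fun_prop) measurable_const) measurable_const
        measurable_const
    have h1 := lintegral_mono (μ := (signalOf O w : Measure unitInterval))
      fun m => C.le_signalNode hV t h O w m
    rw [lintegral_add_left (by fun_prop), lintegral_add_right _ measurable_const,
      lintegral_add_right _ (hind.mul_const ε), lintegral_mul_const _ hind, lintegral_const,
      measure_univ, mul_one] at h1
    have h2 := C.le_lintegral_max t h O w hw
    refine (ENNReal.add_le_add_iff_right (ENNReal.coe_ne_top (r := priceOf O w))).mp ?_
    calc _ = (V O + priceOf O w) + ∫⁻ m, signalNode σ (costFlow k) Vg t h O w m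
          ∂(signalOf O w : Measure unitInterval) := by ring
      _ ≤ _ := add_le_add h2 le_rfl
      _ ≤ _ := h1
      _ ≤ ∫⁻ m, signalNode σ consumptionFlow Vc t h O w m
            ∂(signalOf O w : Measure unitInterval) + η * ε +
            (ENNReal.ofReal k + priceOf O w) := by gcongr; exact hη w hw
      _ = _ := by ring
  unfold offerNode
  have hsum : ∀ c : ℝ≥0∞, c = ∑ w, (σ.agent.buy t (h, O) w : ℝ≥0∞) * c := fun c => by
    rw [← Finset.sum_mul, sum_buy_coe, one_mul]
  rw [hsum (V O), hsum (η * ε), hsum (ENNReal.ofReal k), ← Finset.sum_add_distrib,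
    ← Finset.sum_add_distrib, ← Finset.sum_add_distrib]
  refine Finset.sum_le_sum fun w _ => ?_
  rw [← mul_add, ← mul_add, ← mul_add]
  rcases eq_or_ne (σ.agent.buy t (h, O) w) 0 with h0 | h0
  · simp [h0]
  · exact mul_le_mul_right (key w h0) _

/-- The initial error is at most 1 since U ≤ 1, and each period contracts it by `ρ` because the
on-path search continues with probability at most `ρ`. -/
theorem le_totalUpTo (C : AgentCertificate k σ next V U ρ) (N t : ℕ) (h : History F n t) :
    U t h + totalUpTo σ (costFlow k) N t h ≤ totalUpTo σ consumptionFlow N t h + ρ ^ N := by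
  induction N generalizing t h with
  | zero => simpa [totalUpTo] using C.le_one t h
  | succ N ih =>
    obtain ⟨l, O₁, O₂, hl, hlaw, hU, hstopping⟩ := C.law t h
    have h1 := C.le_offerNode ih t h O₁ (hstopping O₁ (Or.inl rfl))
    have h2 := C.le_offerNode ih t h O₂ (hstopping O₂ (Or.inr rfl))
    refine (ENNReal.add_le_add_iff_right (ENNReal.ofReal_ne_top (r := k))).mp ?_
    rw [add_right_comm, hU]
    change _ + historyNode _ _ _ t h ≤ historyNode _ _ _ t h + _ + _
    have e : σ = σ.deviateAgent σ.agent := rfl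
    rw [e, historyNode_eq _ _ _ hlaw,
      historyNode_eq _ _ _ hlaw, ← e]
    calc _ = l * (V O₁ + offerNode σ (costFlow k) (totalUpTo σ (costFlow k) N) t h O₁) +
          (1 - l) * (V O₂ + offerNode σ (costFlow k) (totalUpTo σ (costFlow k) N) t h O₂) := by
          ring
      _ ≤ l * (offerNode σ consumptionFlow (totalUpTo σ consumptionFlow N) t h O₁ +
            ρ * ρ ^ N + ENNReal.ofReal k) +
          (1 - l) * (offerNode σ consumptionFlow (totalUpTo σ consumptionFlow N) t h O₂ +
            ρ * ρ ^ N + ENNReal.ofReal k) := by gcongr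
      _ = l * offerNode σ consumptionFlow (totalUpTo σ consumptionFlow N) t h O₁ +
          (1 - l) * offerNode σ consumptionFlow (totalUpTo σ consumptionFlow N) t h O₂ +
          (l + (1 - l)) * (ρ ^ (N + 1) + ENNReal.ofReal k) := by ring
      _ = _ := by rw [add_tsub_cancel_of_le hl, one_mul, ← add_assoc]

theorem le_total (C : AgentCertificate k σ next V U ρ) (t : ℕ) (h : History F n t) :
    U t h + total σ (costFlow k) t h ≤ total σ consumptionFlow t h := by
  have hlim : Filter.Tendsto (fun N => total σ consumptionFlow t h + ρ ^ N) Filter.atTop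
      (nhds (total σ consumptionFlow t h + 0)) :=
    (ENNReal.tendsto_pow_atTop_nhds_zero_of_lt_one C.lt_one).const_add _
  have hlim' : Filter.Tendsto (fun N => U t h + totalUpTo σ (costFlow k) N t h) Filter.atTop
      (nhds (U t h + total σ (costFlow k) t h)) :=
    (tendsto_atTop_iSup (totalUpTo_mono σ (costFlow k) t h)).const_add _
  rw [add_zero] at hlim
  exact le_of_tendsto_of_tendsto' hlim' hlim fun N => (C.le_totalUpTo N t h).trans
    (add_le_add (totalUpTo_le_total _ _ _ _ _) le_rfl)

theorem agentPayoff_eq (C : AgentCertificate k σ next V U ρ) (t : ℕ) (h : History F n t) :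
    agentPayoff k σ t h = (((U t h).toReal : ℝ) : EReal) := by
  have h1 := C.total_le σ.agent t h
  have h2 := C.le_total t h
  have hC : total σ consumptionFlow t h ≠ ⊤ :=
    ne_top_of_le_ne_top ENNReal.one_ne_top (total_consumption_le_one σ t h)
  obtain ⟨hU, hK⟩ := ENNReal.add_ne_top.mp (ne_top_of_le_ne_top hC h2)
  have he : total σ consumptionFlow t h = U t h + total σ (costFlow k) t h := le_antisymm h1 h2
  rw [agentPayoff, sub_toEReal hC hK, he, ENNReal.toReal_add hU hK]
  simp

/-- With a certificate for the agent, only the brokers' incentives remain to be checked. -/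
theorem isEquilibrium (C : AgentCertificate k σ next V U ρ)
    (hb : ∀ (i : Fin n) (s : BrokerStrategy F n) (t : ℕ) (h : History F n t),
      brokerPayoff (σ.deviateBroker i s) i t h ≤ brokerPayoff σ i t h) : IsEquilibrium k σ := by
  have hle : ∀ (τ : Profile F n) t h, total τ consumptionFlow t h ≤ 1 :=
    total_consumption_le_one
  have hsig : ∀ (τ : Profile F n) t h O w m,
      signalNode τ consumptionFlow (total τ consumptionFlow) t h O w m ≤ 1 :=
    fun τ => signalNode_consumption_le_one τ (hle τ)
  have h0 : ∀ t h, U t h + total σ (costFlow k) t h ≤ total σ consumptionFlow t h + 0 :=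
    fun t h => by rw [add_zero]; exact C.le_total t h
  refine ⟨hb, fun a t h => ?_, fun a t h O => ?_, fun a t h O w m => ?_⟩
  · refine sub_le_sub_toEReal (D := U t h) (κ := 0)
      (ne_top_of_le_ne_top ENNReal.one_ne_top (hle _ _ _))
      (ne_top_of_le_ne_top ENNReal.one_ne_top (hle _ _ _)) (by simp) ?_ ?_
    · rw [add_zero]; exact C.total_le a t h
    · rw [add_zero]; exact C.le_total t h
  · refine sub_le_sub_toEReal (D := V O) (κ := ENNReal.ofReal k)
      (ne_top_of_le_ne_top ENNReal.one_ne_top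
        (offerNode_le_of_signalNode_le _ fun w m => hsig _ t h O w m))
      (ne_top_of_le_ne_top ENNReal.one_ne_top
        (offerNode_le_of_signalNode_le _ fun w m => hsig _ t h O w m))
      ENNReal.ofReal_ne_top (C.offerNode_le a (C.total_le a) t h O) ?_
    -- After arbitrary offers no bound `ρ` is available, but the limiting error is already 0, so the
    -- trivial bound 1 on continuing suffices.
    have := C.le_offerNode h0 t h O (η := 1) (fun w _ => by
      calc _ ≤ ∫⁻ _, 1 ∂(signalOf O w : Measure unitInterval) :=
            lintegral_mono fun x => by split_ifs <;> simp
        _ = 1 := by simp)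
    simpa using this
  · refine sub_le_sub_toEReal (D := max (ENNReal.ofReal (m : ℝ)) (next O w))
      (κ := ENNReal.ofReal k + priceOf O w)
      (ne_top_of_le_ne_top ENNReal.one_ne_top (hsig _ t h O w m))
      (ne_top_of_le_ne_top ENNReal.one_ne_top (hsig _ t h O w m))
      (by simp) (C.signalNode_le a t h O w m) ?_
    simpa using C.le_signalNode h0 t h O w m

end AgentCertificate

/-! ### Building blocks for equilibria -/

/-- Positive excess at u means that a signal above u has positive probability, so a threshold rule
stops with positive probability. This supplies the contraction factor of certificates. -/
theorem lintegral_lt_one (G : ProbabilityMeasure unitInterval) {u : ℝ} (hu : 0 < excess G u) :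
    ∫⁻ x : unitInterval, (if ENNReal.ofReal (x : ℝ) < ENNReal.ofReal u then 1 else 0)
      ∂(G : Measure unitInterval) < 1 := by
  set A : Set unitInterval := {x | ENNReal.ofReal (x : ℝ) < ENNReal.ofReal u} with hA
  have hAm : MeasurableSet A := measurableSet_lt (by fun_prop) measurable_const
  have he : ∫⁻ x : unitInterval, (if ENNReal.ofReal (x : ℝ) < ENNReal.ofReal u then 1 else 0)
      ∂(G : Measure unitInterval) = (G : Measure unitInterval) A := by
    rw [← lintegral_indicator_one hAm]
    refine lintegral_congr fun x => ?_
    simp [hA, Set.indicator_apply]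
  rw [he]
  refine prob_le_one.lt_of_ne fun h1 => hu.ne' ?_
  have hae : ∀ᵐ x ∂(G : Measure unitInterval), x ∈ A := (prob_compl_eq_zero_iff hAm).mpr h1
  rw [excess_eq]
  refine integral_eq_zero_of_ae ?_
  filter_upwards [hae] with x hx
  have := (ENNReal.ofReal_lt_ofReal_iff_of_nonneg x.2.1).mp hx
  exact max_eq_right (by linarith)

/-- Full information for free. -/
def fullOffer (F : ProbabilityMeasure unitInterval) : Offer F := (0, ⟨F, IsMPC.refl F⟩)

/-- No information for free. -/
def nullOffer (F : ProbabilityMeasure unitInterval) : Offer F :=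
  (0, ⟨nullSignal F, isMPC_nullSignal F⟩)

open Classical in
/-- The agent buys according to `choice` and stops unless the signal falls short of `next`. -/
def pureAgent (choice : Offers F n → Purchase n) (hc : Measurable choice)
    (next : Offers F n → Purchase n → ℝ≥0∞)
    (hn : Measurable fun p : Offers F n × Purchase n => next p.1 p.2) : AgentStrategy F n where
  buy _ x w := if choice x.2 = w then 1 else 0
  measurable_buy _ w := Measurable.ite (hc.comp measurable_snd (measurableSet_singleton w))
    measurable_const measurable_const
  sum_buy _ x := by simp
  cont _ x := if ENNReal.ofReal (x.2.2.2 : ℝ) < next x.2.1 x.2.2.1 then 1 else 0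
  measurable_cont _ := by
    refine Measurable.ite (measurableSet_lt (by fun_prop) ?_) measurable_const measurable_const
    exact hn.comp (by fun_prop : Measurable fun x :
      History F n _ × Offers F n × Purchase n × unitInterval => (x.2.1, x.2.2.1))

theorem pureAgent_buy_ne_zero {choice : Offers F n → Purchase n} {hc : Measurable choice}
    {next : Offers F n → Purchase n → ℝ≥0∞}
    {hn : Measurable fun p : Offers F n × Purchase n => next p.1 p.2} {t : ℕ} {h : History F n t}
    {O : Offers F n} {w : Purchase n} (hw : (pureAgent choice hc next hn).buy t (h, O) w ≠ 0) :
    choice O = w := by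
  by_contra hne
  exact hw (if_neg hne)

theorem totalUpTo_revenue_eq_zero (σ : Profile F n) (i : Fin n)
    (hp : ∀ t h, ∀ᵐ O ∂(Measure.pi fun j => (σ.broker j).offer t h),
      σ.agent.buy t (h, O) (some i) ≠ 0 → (O i).1 = 0) (N t : ℕ) (h : History F n t) :
    totalUpTo σ (revenueFlow i) N t h = 0 := by
  induction N generalizing t h with
  | zero => rfl
  | succ N ih =>
    change ∫⁻ O, _ ∂_ = 0
    rw [lintegral_eq_zero_of_ae_eq_zero]
    filter_upwards [hp t h] with O hO
    refine Finset.sum_eq_zero fun w _ => ?_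
    rcases eq_or_ne (σ.agent.buy t (h, O) w) 0 with h0 | h0
    · simp [h0]
    have hz : ∀ m, signalNode σ (revenueFlow i) (totalUpTo σ (revenueFlow i) N) t h O w m = 0 := by
      intro m
      rw [signalNode_of_const (r := 0), ih, mul_zero, add_zero]
      intro b
      simp only [revenueFlow]
      split_ifs with hw
      · subst hw; simp [hO h0]
      · rfl
    simp [hz]

theorem brokerPayoff_eq_zero (σ : Profile F n) (i : Fin n)
    (hp : ∀ t h, ∀ᵐ O ∂(Measure.pi fun j => (σ.broker j).offer t h),
      σ.agent.buy t (h, O) (some i) ≠ 0 → (O i).1 = 0) (t : ℕ) (h : History F n t) :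
    brokerPayoff σ i t h = 0 := by
  simp [brokerPayoff, total, totalUpTo_revenue_eq_zero σ i hp]

theorem snoc_mem_equilibriumPayoffs {k : ℝ} {σ : Profile F n} (hσ : IsEquilibrium k σ)
    {v : Fin n → ℝ} {u : ℝ} (hv0 : ∀ i, 0 ≤ v i)
    (hv : ∀ i, brokerPayoff σ i 0 Fin.elim0 = ENNReal.ofReal (v i))
    (hu : agentPayoff k σ 0 Fin.elim0 = (u : EReal)) :
    (Fin.snoc v u : Fin (n + 1) → ℝ) ∈ equilibriumPayoffs F n k := by
  refine ⟨σ, hσ, fun i => ?_, ?_⟩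
  · rw [Fin.snoc_castSucc, hv i, EReal.coe_ennreal_ofReal, max_eq_left (hv0 i)]
  · rw [Fin.snoc_last, hu]

/-! ### Equilibria in which the brokers earn nothing -/

section Punishment

/-- No broker offers information. -/
def nullProfile (F : ProbabilityMeasure unitInterval) (n : ℕ) : Offers F n := fun _ => nullOffer F

/-- Broker `i₀` alone offers free full information. -/
def fullProfile (F : ProbabilityMeasure unitInterval) (i₀ : Fin n) : Offers F n :=
  Function.update (nullProfile F n) i₀ (fullOffer F)

/-- The outcomes after which free full information is offered forever: it was offered in the
current period, or the agent rejected unexpected offers. -/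
def IsRewarded (i₀ : Fin n) (O : Offers F n) (w : Purchase n) : Prop :=
  O = fullProfile F i₀ ∨ (O ≠ nullProfile F n ∧ w = none)

theorem measurableSet_isRewarded (i₀ : Fin n) :
    MeasurableSet {p : Offers F n × Purchase n | IsRewarded i₀ p.1 p.2} := by
  have h1 : MeasurableSet {p : Offers F n × Purchase n | p.1 = fullProfile F i₀} :=
    measurable_fst (measurableSet_singleton _)
  have h2 : MeasurableSet {p : Offers F n × Purchase n | p.1 = nullProfile F n} :=
    measurable_fst (measurableSet_singleton _)
  have h3 : MeasurableSet {p : Offers F n × Purchase n | p.2 = none} :=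
    measurable_snd (measurableSet_singleton _)
  exact h1.union (h2.compl.inter h3)

open Classical in
/-- The continuation value as a function of offers and purchase. -/
def rewardNext (k : ℝ) (i₀ : Fin n) (O : Offers F n) (w : Purchase n) : ℝ≥0∞ :=
  ENNReal.ofReal (if IsRewarded i₀ O w then fullInfoPayoff F k else autarkyPayoff F k)

theorem measurable_rewardNext (k : ℝ) (i₀ : Fin n) :
    Measurable fun p : Offers F n × Purchase n => rewardNext k i₀ p.1 p.2 :=
  ENNReal.measurable_ofReal.comp
    (Measurable.ite (measurableSet_isRewarded i₀) measurable_const measurable_const)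

open Classical in
/-- The agent accepts only the free full information of broker `i₀`. -/
def rewardChoice (i₀ : Fin n) (O : Offers F n) : Purchase n :=
  if O = fullProfile F i₀ then some i₀ else none

theorem measurable_rewardChoice (i₀ : Fin n) :
    Measurable (rewardChoice i₀ : Offers F n → Purchase n) :=
  Measurable.ite (measurableSet_singleton _) measurable_const measurable_const

open Classical in
/-- The agent's value after offers `O`. -/
def rewardValue (k : ℝ) (i₀ : Fin n) (O : Offers F n) : ℝ≥0∞ :=
  ENNReal.ofReal (if O = fullProfile F i₀ then fullInfoPayoff F k + k
    else if O = nullProfile F n then mean F else fullInfoPayoff F k)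

open Classical in
/-- The probability that broker `i₀` offers full information. -/
def rewardProb (l : ℝ≥0∞) (i₀ : Fin n) : ∀ t, History F n t → ℝ≥0∞
  | 0, _ => l
  | t + 1, h => if IsRewarded i₀ (h (Fin.last t)).1 (h (Fin.last t)).2.1 then 1 else 0

theorem measurable_rewardProb (l : ℝ≥0∞) (i₀ : Fin n) (t : ℕ) :
    Measurable (rewardProb (F := F) l i₀ t) := by
  cases t with
  | zero => exact measurable_const
  | succ t =>
    refine Measurable.ite ?_ measurable_const measurable_const
    exact (by fun_prop : Measurable fun h : History F n (t + 1) =>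
      ((h (Fin.last t)).1, (h (Fin.last t)).2.1)) (measurableSet_isRewarded i₀)

theorem rewardProb_le_one {l : ℝ≥0∞} (hl : l ≤ 1) (i₀ : Fin n) (t : ℕ) (h : History F n t) :
    rewardProb l i₀ t h ≤ 1 := by
  cases t with
  | zero => exact hl
  | succ t => simp only [rewardProb]; split_ifs <;> simp

open Classical in
/-- Broker `i₀` mixes between free full information and no information; the others are inactive. -/
def rewardBroker {l : ℝ≥0∞} (hl : l ≤ 1) (i₀ i : Fin n) : BrokerStrategy F n where
  offer t := if i = i₀ then
      { toFun := fun h => rewardProb l i₀ t h • Measure.dirac (fullOffer F) +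
          (1 - rewardProb l i₀ t h) • Measure.dirac (nullOffer F)
        measurable' := by
          refine Measure.measurable_of_measurable_coe _ fun s _ => ?_
          have := measurable_rewardProb (F := F) l i₀ t
          simp only [Measure.coe_add, Measure.coe_smul, Pi.add_apply, Pi.smul_apply, smul_eq_mul]
          fun_prop }
    else Kernel.const _ (Measure.dirac (nullOffer F))
  markov t := by
    split_ifs
    · refine ⟨fun h => ⟨?_⟩⟩
      change (rewardProb l i₀ t h • Measure.dirac (fullOffer F) +
          (1 - rewardProb l i₀ t h) • Measure.dirac (nullOffer F)) Set.univ = 1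
      simp only [Measure.coe_add, Measure.coe_smul, Pi.add_apply, Pi.smul_apply, smul_eq_mul,
        measure_univ, mul_one]
      exact add_tsub_cancel_of_le (rewardProb_le_one hl i₀ t h)
    · infer_instance

/-- The profile in which deviating brokers are punished by rewarding the agent's rejections. -/
def rewardProfile (k : ℝ) {l : ℝ≥0∞} (hl : l ≤ 1) (i₀ : Fin n) : Profile F n where
  broker := rewardBroker hl i₀
  agent := pureAgent (rewardChoice i₀) (measurable_rewardChoice i₀) (rewardNext k i₀)
    (measurable_rewardNext k i₀)

theorem rewardProfile_buy_ne_zero {k : ℝ} {l : ℝ≥0∞} {hl : l ≤ 1} {i₀ : Fin n} {t : ℕ}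
    {h : History F n t} {O : Offers F n} {w : Purchase n}
    (hw : (rewardProfile (F := F) k hl i₀).agent.buy t (h, O) w ≠ 0) : rewardChoice i₀ O = w :=
  pureAgent_buy_ne_zero (hc := measurable_rewardChoice i₀) (hn := measurable_rewardNext k i₀) hw

/-- The agent's value at a history. -/
def rewardPayoff (k : ℝ) (l : ℝ≥0∞) (i₀ : Fin n) (t : ℕ) (h : History F n t) : ℝ≥0∞ :=
  rewardProb l i₀ t h * ENNReal.ofReal (fullInfoPayoff F k) +
    (1 - rewardProb l i₀ t h) * ENNReal.ofReal (autarkyPayoff F k)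

/-- A nondegenerate F differs from the point mass at its mean; otherwise the rewarded and unrewarded
states could not be told apart. -/
theorem fullProfile_ne_nullProfile (hF : (F : Measure unitInterval) ≪ volume) (i₀ : Fin n) :
    fullProfile F i₀ ≠ nullProfile F n := by
  intro h
  have h1 := congrFun h i₀
  rw [fullProfile, Function.update_self] at h1
  have h2 : F = nullSignal F := congrArg (fun o : Offer F => o.2.1) h1
  refine not_ae_eq_const hF (mean F) ?_
  rw [h2]
  change ∀ᵐ θ : unitInterval ∂(Measure.dirac (⟨mean F, mean_mem F⟩ : unitInterval)),
    (θ : ℝ) = mean (nullSignal F)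
  rw [ae_dirac_eq, ← h2]
  rfl

theorem priceOf_nullProfile (w : Purchase n) : priceOf (nullProfile F n) w = 0 := by
  cases w <;> rfl

theorem signalOf_nullProfile (w : Purchase n) : signalOf (nullProfile F n) w = nullSignal F := by
  cases w <;> rfl

theorem priceOf_fullProfile (i₀ : Fin n) (w : Purchase n) :
    priceOf (fullProfile F i₀) w = 0 := by
  cases w with
  | none => rfl
  | some i =>
    by_cases hi : i = i₀
    · subst hi; simp [priceOf, fullProfile, fullOffer]
    · simp [priceOf, fullProfile, hi, nullProfile, nullOffer]

theorem signalOf_fullProfile (i₀ : Fin n) : signalOf (fullProfile F i₀) (some i₀) = F := by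
  simp [signalOf, fullProfile, fullOffer]

/-- There are three kinds of offers. Free full information is followed by ū and is worth S(F,ū) = ū
+ k. The null profile is followed by u̲ and is worth m = u̲ + k. After anything else, rejecting
leads to ū, while buying leads to u̲ and is worth at most S(F,u̲) ≤ ū even at price 0. -/
theorem rewardProfile_certificate (hF : (F : Measure unitInterval) ≪ volume) {k : ℝ} (hk : 0 < k)
    (hkm : k < mean F) (hgap : 0 ≤ costGap F k) {l : ℝ≥0∞} (hl : l ≤ 1) (i₀ : Fin n) :
    ∃ ρ, AgentCertificate k (rewardProfile (F := F) k hl i₀) (rewardNext k i₀) (rewardValue k i₀)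
      (rewardPayoff k l i₀) ρ := by
  classical
  have hu0 := autarkyPayoff_pos hkm
  have huu := autarkyPayoff_le_fullInfoPayoff hk hkm
  have hu1 := fullInfoPayoff_lt_one hk hkm
  have hgap' := stopValue_autarky_le hk hkm hgap
  -- Needed for the reward: having rejected, the agent searches on for ū instead of consuming the
  -- good worth m.
  have hmu : mean F ≤ fullInfoPayoff F k := (mean_le_stopValue F _).trans hgap'
  have hne := fullProfile_ne_nullProfile hF i₀
  have haut : autarkyPayoff F k = mean F - k := rfl
  have hrF : ∀ w, IsRewarded i₀ (fullProfile F i₀) w := fun w => Or.inl rfl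
  have hrN : ∀ w, ¬ IsRewarded i₀ (nullProfile F n) w := by
    rintro w (h | h)
    · exact hne h.symm
    · exact h.1 rfl
  have hval0 : ∀ O w, (0 : ℝ) ≤
      if IsRewarded (F := F) i₀ O w then fullInfoPayoff F k else autarkyPayoff F k := by
    intro O w; split_ifs <;> linarith
  refine ⟨max (∫⁻ x : unitInterval,
      (if ENNReal.ofReal (x : ℝ) < ENNReal.ofReal (fullInfoPayoff F k) then 1 else 0)
        ∂(F : Measure unitInterval))
    (∫⁻ x : unitInterval,
      (if ENNReal.ofReal (x : ℝ) < ENNReal.ofReal (autarkyPayoff F k) then 1 else 0)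
        ∂(nullSignal F : Measure unitInterval)), ?_, ?_, ?_, ?_, ?_, ?_, ?_⟩
  · intro O w
    unfold rewardNext rewardValue
    rw [lintegral_max _ (hval0 O w)]
    by_cases hOF : O = fullProfile F i₀
    · subst hOF
      rw [if_pos (hrF w), if_pos rfl, priceOf_fullProfile, ENNReal.coe_zero, add_zero,
        ← stopValue_fullInfoPayoff hk hkm]
      exact ENNReal.ofReal_le_ofReal ((isMPC_signalOf _ w).stopValue_le _)
    rw [if_neg hOF]
    by_cases hON : O = nullProfile F n
    · subst hON
      rw [if_neg (hrN w), if_pos rfl, priceOf_nullProfile, ENNReal.coe_zero, add_zero,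
        signalOf_nullProfile, stopValue_nullSignal, max_eq_left (by linarith)]
    rw [if_neg hON]
    cases w with
    | none =>
      rw [if_pos (show IsRewarded i₀ O none from Or.inr ⟨hON, rfl⟩)]
      change ENNReal.ofReal (stopValue (nullSignal F) _) ≤ _ + ((0 : ℝ≥0) : ℝ≥0∞)
      rw [stopValue_nullSignal, max_eq_right hmu, ENNReal.coe_zero, add_zero]
    | some i =>
      rw [if_neg (show ¬ IsRewarded i₀ O (some i) by
        rintro (h | h); exacts [hOF h, by simpa using h.2])]
      exact (ENNReal.ofReal_le_ofReal (((isMPC_signalOf O (some i)).stopValue_le _).trans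
        hgap')).trans le_self_add
  · intro t h O w hw
    have hw' : rewardChoice i₀ O = w := rewardProfile_buy_ne_zero hw
    unfold rewardNext rewardValue
    rw [lintegral_max _ (hval0 O w)]
    by_cases hOF : O = fullProfile F i₀
    · subst hOF
      have : w = some i₀ := by rw [← hw', rewardChoice, if_pos rfl]
      subst this
      rw [if_pos (hrF _), if_pos rfl, priceOf_fullProfile, ENNReal.coe_zero, add_zero,
        signalOf_fullProfile, stopValue_fullInfoPayoff hk hkm]
    have : w = none := by rw [← hw', rewardChoice, if_neg hOF]
    subst this
    rw [if_neg hOF]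
    change _ + ((0 : ℝ≥0) : ℝ≥0∞) ≤ ENNReal.ofReal (stopValue (nullSignal F) _)
    rw [ENNReal.coe_zero, add_zero, stopValue_nullSignal]
    by_cases hON : O = nullProfile F n
    · rw [if_pos hON]
      exact ENNReal.ofReal_le_ofReal (le_max_left _ _)
    · rw [if_neg hON, if_pos (show IsRewarded i₀ O none from Or.inr ⟨hON, rfl⟩)]
      exact ENNReal.ofReal_le_ofReal (le_max_right _ _)
  · intro t h O w m
    rfl
  · intro t h O w m
    have e : (h.extend (O, w, m)) (Fin.last t) = (O, w, m) := Fin.snoc_last _ _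
    simp only [rewardPayoff, rewardProb, rewardNext, e]
    split_ifs <;> simp
  · intro t h
    have h1 := rewardProb_le_one hl i₀ t h
    calc rewardPayoff k l i₀ t h
        ≤ rewardProb l i₀ t h * 1 + (1 - rewardProb l i₀ t h) * 1 := by
          unfold rewardPayoff
          gcongr
          · exact ENNReal.ofReal_le_one.mpr hu1.le
          · exact ENNReal.ofReal_le_one.mpr (by linarith)
      _ = 1 := by rw [mul_one, mul_one, add_tsub_cancel_of_le h1]
  · intro t h
    have h1 := rewardProb_le_one hl i₀ t h
    refine ⟨rewardProb l i₀ t h, fullProfile F i₀, nullProfile F n, h1, ?_, ?_, ?_⟩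
    · have := fun i => ((rewardProfile (F := F) k hl i₀).broker i).markov t
      refine pi_two_point (nullProfile F n) i₀ (fullOffer F) (rewardProb l i₀ t h) _ ?_ ?_
      · simp only [rewardProfile, rewardBroker, if_true]; rfl
      · intro i hi
        simp only [rewardProfile, rewardBroker, if_neg hi]; rfl
    · unfold rewardPayoff rewardValue
      rw [if_pos rfl, if_neg hne.symm, if_pos rfl,
        show mean F = autarkyPayoff F k + k by rw [haut]; ring,
        ENNReal.ofReal_add (hu0.le.trans huu) hk.le, ENNReal.ofReal_add hu0.le hk.le,
        mul_add, mul_add]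
      nth_rw 1 [← one_mul (ENNReal.ofReal k)]
      rw [show (1 : ℝ≥0∞) * ENNReal.ofReal k =
        (rewardProb l i₀ t h + (1 - rewardProb l i₀ t h)) * ENNReal.ofReal k by
          rw [add_tsub_cancel_of_le h1]]
      ring
    · rintro O (rfl | rfl) w hw
      · have hw' : rewardChoice i₀ (fullProfile F i₀) = w := rewardProfile_buy_ne_zero hw
        rw [rewardChoice, if_pos rfl] at hw'
        subst hw'
        rw [signalOf_fullProfile]
        simp only [rewardNext, if_pos (hrF _)]
        exact le_max_left _ _
      · rw [signalOf_nullProfile]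
        simp only [rewardNext, if_neg (hrN _)]
        exact le_max_right _ _
  · refine max_lt (lintegral_lt_one F (by rwa [excess_fullInfoPayoff hk hkm]))
      (lintegral_lt_one _ ?_)
    have := stopValue_nullSignal F (autarkyPayoff F k)
    rw [stopValue_eq] at this
    have := le_max_left (mean F) (autarkyPayoff F k)
    linarith

/-- If the search cost is below the threshold, the agent can get any payoff between autarky and
free full information while the brokers earn nothing. -/
theorem snoc_zero_mem_equilibriumPayoffs (hF : (F : Measure unitInterval) ≪ volume) {k : ℝ}
    (hk : 0 < k) (hkm : k < mean F) (hgap : 0 ≤ costGap F k) (i₀ : Fin n) {u : ℝ}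
    (hu : u ∈ Set.Icc (autarkyPayoff F k) (fullInfoPayoff F k)) :
    (Fin.snoc (fun _ => 0) u : Fin (n + 1) → ℝ) ∈ equilibriumPayoffs F n k := by
  have hu0 := autarkyPayoff_pos hkm
  have huu := autarkyPayoff_le_fullInfoPayoff hk hkm
  -- The weight `b` becomes the initial probability of free full information.
  obtain ⟨a, b, ha, hb, hab, hcomb⟩ : u ∈ segment ℝ (autarkyPayoff F k) (fullInfoPayoff F k) := by
    rwa [segment_eq_Icc huu]
  have hl : ENNReal.ofReal b ≤ 1 := ENNReal.ofReal_le_one.mpr (by linarith)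
  obtain ⟨ρ, C⟩ := rewardProfile_certificate hF hk hkm hgap hl i₀
  -- The agent only ever buys at price 0, so brokers earn nothing whatever they offer; hence no
  -- broker deviation is profitable.
  have hzero : ∀ (σ : Profile F n), σ.agent = (rewardProfile (F := F) k hl i₀).agent →
      ∀ i t h, brokerPayoff σ i t h = 0 := by
    intro σ hσ i
    refine brokerPayoff_eq_zero σ i fun t h => Filter.Eventually.of_forall fun O hO => ?_
    rw [hσ] at hO
    have hc : rewardChoice i₀ O = some i := rewardProfile_buy_ne_zero hO
    by_cases hOF : O = fullProfile F i₀
    · subst hOF; exact priceOf_fullProfile i₀ (some i)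
    · rw [rewardChoice, if_neg hOF] at hc; cases hc
  refine snoc_mem_equilibriumPayoffs (C.isEquilibrium fun i s t h => ?_) (fun _ => le_rfl)
    (fun i => ?_) ?_
  · rw [hzero (Profile.deviateBroker _ i s) rfl]; exact zero_le
  · rw [hzero _ rfl]; simp
  · rw [C.agentPayoff_eq, EReal.coe_eq_coe_iff, rewardPayoff]
    change (ENNReal.ofReal b * ENNReal.ofReal (fullInfoPayoff F k) +
      (1 - ENNReal.ofReal b) * ENNReal.ofReal (autarkyPayoff F k)).toReal = u
    rw [← ENNReal.ofReal_one, ← ENNReal.ofReal_sub _ hb, ← ENNReal.ofReal_mul hb,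
      ← ENNReal.ofReal_mul (by linarith), ← ENNReal.ofReal_add (mul_nonneg hb (hu0.le.trans huu))
        (mul_nonneg (by linarith) hu0.le), ENNReal.toReal_ofReal (add_nonneg (mul_nonneg hb
          (hu0.le.trans huu)) (mul_nonneg (by linarith) hu0.le)), ← hcomb, ← hab]
    simp only [smul_eq_mul]
    ring

end Punishment

/-! ### Stationary equilibria -/

section Stationary

/-- The agent's value of the purchase `w` if the continuation value is `u`. -/
def purchaseValue (u : ℝ) (O : Offers F n) (w : Purchase n) : ℝ :=
  stopValue (signalOf O w) u - priceOf O w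

theorem measurable_purchaseValue {u : ℝ} (hu : 0 ≤ u) (w : Purchase n) :
    Measurable fun O : Offers F n => purchaseValue u O w := by
  cases w with
  | none =>
    exact (measurable_const : Measurable fun _ : Offers F n =>
      stopValue (nullSignal F) u - ((0 : ℝ≥0) : ℝ))
  | some i =>
    have h1 : Measurable fun O : Offers F n => stopValue (O i).2.1 u := by
      have h2 : (fun O : Offers F n => stopValue (O i).2.1 u) = fun O =>
          (∫⁻ x, max (ENNReal.ofReal (x : ℝ)) (ENNReal.ofReal u)
            ∂((O i).2.1 : Measure unitInterval)).toReal := by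
        funext O
        rw [lintegral_max _ hu, ENNReal.toReal_ofReal (hu.trans (le_stopValue _ _))]
      rw [h2]
      refine ENNReal.measurable_toReal.comp ((Measure.measurable_lintegral (by fun_prop)).comp ?_)
      exact measurable_subtype_coe.comp (measurable_subtype_coe.comp
        (measurable_snd.comp (measurable_pi_apply i)))
    have h3 : Measurable fun O : Offers F n => (((O i).1 : ℝ≥0) : ℝ) :=
      measurable_coe_nnreal_real.comp (measurable_fst.comp (measurable_pi_apply i))
    exact h1.sub h3

/-- Ties are broken by rank, so that the null offer is chosen only if it is strictly best. -/
def purchaseRank : Purchase n → ℕ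
  | none => 0
  | some i => i + 1

theorem purchaseRank_injective : Function.Injective (purchaseRank (n := n)) := by
  rintro (_ | i) (_ | j) h
  · rfl
  · simp [purchaseRank] at h
  · simp [purchaseRank] at h
  · simp only [purchaseRank, add_left_inj] at h
    rw [Fin.ext h]

/-- `w` is the highest-ranked optimal purchase. -/
def IsBestPurchase (u : ℝ) (O : Offers F n) (w : Purchase n) : Prop :=
  ∀ w', purchaseValue u O w' < purchaseValue u O w ∨
    (purchaseValue u O w' = purchaseValue u O w ∧ purchaseRank w' ≤ purchaseRank w)

theorem exists_isBestPurchase (u : ℝ) (O : Offers F n) : ∃ w, IsBestPurchase u O w := by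
  obtain ⟨w, -, hw⟩ := Finset.exists_max_image Finset.univ
    (fun w : Purchase n => toLex (purchaseValue u O w, purchaseRank w)) Finset.univ_nonempty
  exact ⟨w, fun w' => Prod.Lex.le_iff.mp (hw w' (Finset.mem_univ _))⟩

theorem IsBestPurchase.unique {u : ℝ} {O : Offers F n} {w w' : Purchase n}
    (h : IsBestPurchase u O w) (h' : IsBestPurchase u O w') : w = w' := by
  rcases h w' with h1 | h1 <;> rcases h' w with h2 | h2
  · exact absurd h1 h2.asymm
  · exact absurd h1 (by rw [h2.1]; exact lt_irrefl _)
  · exact absurd h2 (by rw [h1.1]; exact lt_irrefl _)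
  · exact purchaseRank_injective (le_antisymm h2.2 h1.2)

/-- The agent's optimal purchase if the continuation value is `u`. -/
def bestPurchase (u : ℝ) (O : Offers F n) : Purchase n := (exists_isBestPurchase u O).choose

theorem bestPurchase_spec (u : ℝ) (O : Offers F n) : IsBestPurchase u O (bestPurchase u O) :=
  (exists_isBestPurchase u O).choose_spec

theorem purchaseValue_le_best (u : ℝ) (O : Offers F n) (w : Purchase n) :
    purchaseValue u O w ≤ purchaseValue u O (bestPurchase u O) :=
  (bestPurchase_spec u O w).elim le_of_lt fun h => h.1.le

/-- The injective rank makes the optimal purchase unique, so each preimage is a finite intersection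
of comparisons between measurable values. -/
theorem measurable_bestPurchase {u : ℝ} (hu : 0 ≤ u) :
    Measurable (bestPurchase u : Offers F n → Purchase n) := by
  refine measurable_to_countable' fun w => ?_
  have : bestPurchase u ⁻¹' {w} = ⋂ w' : Purchase n, {O : Offers F n |
      purchaseValue u O w' < purchaseValue u O w ∨
        (purchaseValue u O w' = purchaseValue u O w ∧ purchaseRank w' ≤ purchaseRank w)} := by
    ext O
    rw [Set.mem_iInter]
    constructor
    · intro h
      rw [← show bestPurchase u O = w from h]
      exact bestPurchase_spec u O
    · intro h
      exact (bestPurchase_spec u O).unique h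
  rw [this]
  refine MeasurableSet.iInter fun w' => ?_
  exact (measurableSet_lt (measurable_purchaseValue hu w') (measurable_purchaseValue hu w)).union
    ((measurableSet_eq_fun (measurable_purchaseValue hu w')
      (measurable_purchaseValue hu w)).inter (MeasurableSet.const _))

theorem purchaseValue_none (u : ℝ) (O : Offers F n) :
    purchaseValue u O none = max (mean F) u := by
  change stopValue (nullSignal F) u - ((0 : ℝ≥0) : ℝ) = _
  rw [stopValue_nullSignal]; simp

/-- The brokers make the offers `O₀` in every period and the agent acts as if the continuation
value were always `u`. -/
def stationaryProfile {u : ℝ} (hu : 0 ≤ u) (O₀ : Offers F n) : Profile F n where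
  broker i :=
    { offer := fun _ => Kernel.const _ (Measure.dirac (O₀ i))
      markov := fun _ => inferInstance }
  agent := pureAgent (bestPurchase u) (measurable_bestPurchase hu) (fun _ _ => ENNReal.ofReal u)
    measurable_const

theorem stationaryProfile_buy_ne_zero {u : ℝ} {hu : 0 ≤ u} {O₀ : Offers F n} {t : ℕ}
    {h : History F n t} {O : Offers F n} {w : Purchase n}
    (hw : (stationaryProfile hu O₀).agent.buy t (h, O) w ≠ 0) : bestPurchase u O = w :=
  pureAgent_buy_ne_zero (hc := measurable_bestPurchase hu)
    (next := fun _ _ => ENNReal.ofReal u) (hn := measurable_const) hw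

theorem ofReal_purchaseValue_add {u : ℝ} (hu : 0 ≤ u) {O : Offers F n} {w : Purchase n} {c : ℝ}
    (hc : 0 ≤ c) :
    stopValue (signalOf O w) u ≤ c + priceOf O w ↔
      ∫⁻ x : unitInterval, max (ENNReal.ofReal (x : ℝ)) (ENNReal.ofReal u)
        ∂(signalOf O w : Measure unitInterval) ≤ ENNReal.ofReal c + priceOf O w := by
  rw [lintegral_max _ hu, ← ENNReal.ofReal_coe_nnreal, ← ENNReal.ofReal_add hc (by positivity),
    ENNReal.ofReal_le_ofReal_iff (by positivity)]

/-- The hypothesis on `O₀` is the Bellman equation: a period gross of its search cost is worth u +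
k, so u reproduces itself. It also makes the excess of the chosen signal at u at least k > 0, so the
search ends. -/
theorem stationaryProfile_certificate {u k : ℝ} (hu : 0 ≤ u) (hu1 : u ≤ 1) (hk : 0 < k)
    {O₀ : Offers F n} (hO₀ : purchaseValue u O₀ (bestPurchase u O₀) = u + k) :
    ∃ ρ, AgentCertificate k (stationaryProfile hu O₀) (fun _ _ => ENNReal.ofReal u)
      (fun O => ENNReal.ofReal (purchaseValue u O (bestPurchase u O)))
      (fun _ _ => ENNReal.ofReal u) ρ := by
  have hpos : ∀ O : Offers F n, 0 ≤ purchaseValue u O (bestPurchase u O) := fun O =>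
    hu.trans ((le_max_right _ _).trans ((purchaseValue_none u O).symm.le.trans
      (purchaseValue_le_best u O none)))
  refine ⟨∫⁻ x : unitInterval,
      (if ENNReal.ofReal (x : ℝ) < ENNReal.ofReal u then 1 else 0)
        ∂(signalOf O₀ (bestPurchase u O₀) : Measure unitInterval), ?_, ?_, ?_, ?_, ?_, ?_, ?_⟩
  · intro O w
    rw [← ofReal_purchaseValue_add hu (hpos O)]
    have := purchaseValue_le_best u O w
    unfold purchaseValue at this ⊢
    linarith
  · intro t h O w hw
    have := stationaryProfile_buy_ne_zero hw
    subst this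
    rw [lintegral_max _ hu, ← ENNReal.ofReal_coe_nnreal,
      ← ENNReal.ofReal_add (hpos O) (by positivity)]
    refine ENNReal.ofReal_le_ofReal ?_
    unfold purchaseValue
    linarith
  · intro t h O w m
    rfl
  · intro t h O w m
    rfl
  · intro t h
    exact ENNReal.ofReal_le_one.mpr hu1
  · intro t h
    refine ⟨1, O₀, O₀, le_rfl, ?_, ?_, ?_⟩
    · rw [one_smul, tsub_self, zero_smul, add_zero]
      exact pi_dirac O₀
    · rw [one_mul, tsub_self, zero_mul, add_zero, hO₀, ENNReal.ofReal_add hu hk.le]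
    · rintro O (rfl | rfl) w hw <;>
      · rw [stationaryProfile_buy_ne_zero hw]
  · refine lintegral_lt_one _ ?_
    rw [purchaseValue, stopValue_eq] at hO₀
    have : (0 : ℝ) ≤ priceOf O₀ (bestPurchase u O₀) := NNReal.coe_nonneg _
    linarith

/-! ### Competition: at least two brokers give full information for free -/

/-- Bertrand competition: whatever one broker does, another still offers full information for free,
worth ū + k. A signal sold at price p is worth at most ū + k - p, so nothing sells at a positive
price. -/
theorem snoc_zero_fullInfoPayoff_mem {k : ℝ} (hk : 0 < k) (hkm : k < mean F) (hn : 2 ≤ n) :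
    (Fin.snoc (fun _ => 0) (fullInfoPayoff F k) : Fin (n + 1) → ℝ) ∈
      equilibriumPayoffs F n k := by
  have hu : 0 ≤ fullInfoPayoff F k :=
    (autarkyPayoff_pos hkm).le.trans (autarkyPayoff_le_fullInfoPayoff hk hkm)
  have hfull : ∀ (O : Offers F n) (j : Fin n), O j = fullOffer F →
      purchaseValue (fullInfoPayoff F k) O (some j) = fullInfoPayoff F k + k := by
    intro O j hj
    simp only [purchaseValue, signalOf, priceOf, hj, fullOffer, stopValue_fullInfoPayoff hk hkm]
    simp
  have hle : ∀ (O : Offers F n) (w : Purchase n), purchaseValue (fullInfoPayoff F k) O w ≤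
      fullInfoPayoff F k + k - priceOf O w := by
    intro O w
    have := (isMPC_signalOf O w).stopValue_le (fullInfoPayoff F k)
    rw [stopValue_fullInfoPayoff hk hkm] at this
    unfold purchaseValue
    linarith
  have hzero : ∀ (O : Offers F n) (i j : Fin n), O j = fullOffer F →
      bestPurchase (fullInfoPayoff F k) O = some i → (O i).1 = 0 := by
    intro O i j hj hi
    have h1 := purchaseValue_le_best (fullInfoPayoff F k) O (some j)
    rw [hfull O j hj, hi] at h1
    have h2 := hle O (some i)
    have h3 : ((O i).1 : ℝ) ≤ 0 := by
      change _ ≤ _ - ((O i).1 : ℝ) at h2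
      linarith
    exact le_antisymm (by exact_mod_cast h3) zero_le
  set O₀ : Offers F n := fun _ => fullOffer F with hO₀
  have hbest : purchaseValue (fullInfoPayoff F k) O₀ (bestPurchase (fullInfoPayoff F k) O₀) =
      fullInfoPayoff F k + k := by
    refine le_antisymm ((hle _ _).trans (sub_le_self _ (NNReal.coe_nonneg _))) ?_
    rw [← hfull O₀ ⟨0, by omega⟩ rfl]
    exact purchaseValue_le_best _ _ _
  obtain ⟨ρ, C⟩ := stationaryProfile_certificate hu (fullInfoPayoff_lt_one hk hkm).le hk hbest
  have hdev : ∀ (i : Fin n) (s : BrokerStrategy F n) (t : ℕ) (h : History F n t),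
      brokerPayoff ((stationaryProfile hu O₀).deviateBroker i s) i t h = 0 := by
    intro i s
    refine brokerPayoff_eq_zero _ i fun t h => ?_
    obtain ⟨j, hj⟩ : ∃ j : Fin n, j ≠ i := by
      have : Nontrivial (Fin n) := Fin.nontrivial_iff_two_le.mpr hn
      exact exists_ne i
    have := fun j => (((stationaryProfile hu O₀).deviateBroker i s).broker j).markov t
    have hj' : ∀ᵐ o ∂((((stationaryProfile hu O₀).deviateBroker i s).broker j).offer t h),
        o = fullOffer F := by
      have e : ((stationaryProfile hu O₀).deviateBroker i s).broker j =
          (stationaryProfile hu O₀).broker j := Function.update_of_ne hj _ _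
      rw [e]
      change ∀ᵐ o ∂(Measure.dirac (fullOffer F)), o = fullOffer F
      rw [ae_dirac_eq]
      rfl
    filter_upwards [(Measure.tendsto_eval_ae_ae (μ := fun j =>
      (((stationaryProfile hu O₀).deviateBroker i s).broker j).offer t h)).eventually hj']
      with O hO hbuy
    exact hzero O i j hO (stationaryProfile_buy_ne_zero (hu := hu) (O₀ := O₀) hbuy)
  have hself : ∀ (i : Fin n) (t : ℕ) (h : History F n t),
      brokerPayoff (stationaryProfile hu O₀) i t h = 0 := by
    intro i t h
    have := hdev i ((stationaryProfile hu O₀).broker i) t h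
    rwa [Profile.deviateBroker, Function.update_eq_self] at this
  refine snoc_mem_equilibriumPayoffs (C.isEquilibrium fun i s t h => ?_) (fun _ => le_rfl)
    (fun i => ?_) ?_
  · rw [hdev]; exact zero_le
  · rw [hself]; simp
  · rw [C.agentPayoff_eq, ENNReal.toReal_ofReal hu]

/-! ### Monopoly: the broker extracts the whole surplus -/

/-- The null offer caps the price of G at S(G,u̲) - m. Future revenue is at most ū - u̲ and arises
only after signals below u̲, so it is dominated by max(x,ū) - max(x,u̲). Together these give at most
S(G,ū) - m ≤ S(F,ū) - m = ū - u̲, which reproduces the bound. -/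
theorem totalUpTo_revenue_le {k : ℝ} (hk : 0 < k) (hkm : k < mean F)
    (hu : 0 ≤ autarkyPayoff F k) (O₀ : Offers F n) (σ : Profile F n)
    (hσ : σ.agent = (stationaryProfile hu O₀).agent) (i : Fin n) (N t : ℕ) (h : History F n t) :
    totalUpTo σ (revenueFlow i) N t h ≤
      ENNReal.ofReal (fullInfoPayoff F k - autarkyPayoff F k) := by
  have huu := autarkyPayoff_le_fullInfoPayoff hk hkm
  set B := fullInfoPayoff F k - autarkyPayoff F k with hB
  have hB0 : 0 ≤ B := sub_nonneg.mpr huu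
  induction N generalizing t h with
  | zero => exact zero_le
  | succ N ih =>
    have := isProbabilityMeasure_offers σ t h
    have key : ∀ O, offerNode σ (revenueFlow i) (totalUpTo σ (revenueFlow i) N) t h O ≤
        ENNReal.ofReal B := by
      intro O
      calc offerNode σ (revenueFlow i) (totalUpTo σ (revenueFlow i) N) t h O
          ≤ ∑ w, (σ.agent.buy t (h, O) w : ℝ≥0∞) * ENNReal.ofReal B := ?_
        _ = ENNReal.ofReal B := by rw [← Finset.sum_mul, sum_buy_coe, one_mul]
      refine Finset.sum_le_sum fun w _ => ?_
      rcases eq_or_ne (σ.agent.buy t (h, O) w) 0 with h0 | h0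
      · simp [h0]
      refine mul_le_mul_right ?_ _
      have hw : bestPurchase (autarkyPayoff F k) O = w := by
        rw [hσ] at h0; exact stationaryProfile_buy_ne_zero h0
      have hprice : (priceOf O w : ℝ) ≤
          stopValue (signalOf O w) (autarkyPayoff F k) - mean F := by
        have h1 := purchaseValue_le_best (autarkyPayoff F k) O none
        rw [hw, purchaseValue_none] at h1
        have h2 := le_max_left (mean F) (autarkyPayoff F k)
        unfold purchaseValue at h1
        linarith
      have hintegral : Integrable (fun x : unitInterval => max (x : ℝ) (fullInfoPayoff F k) -
          max (x : ℝ) (autarkyPayoff F k)) (signalOf O w : Measure unitInterval) :=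
        (integrable_max _ _).sub (integrable_max _ _)
      have hnn : ∀ x : unitInterval, 0 ≤ max (x : ℝ) (fullInfoPayoff F k) -
          max (x : ℝ) (autarkyPayoff F k) := fun x =>
        sub_nonneg.mpr (max_le_max le_rfl huu)
      calc ∫⁻ m, signalNode σ (revenueFlow i) (totalUpTo σ (revenueFlow i) N) t h O w m
            ∂(signalOf O w : Measure unitInterval)
          ≤ ∫⁻ m : unitInterval, ((priceOf O w : ℝ≥0∞) + ENNReal.ofReal
              (max (m : ℝ) (fullInfoPayoff F k) - max (m : ℝ) (autarkyPayoff F k)))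
              ∂(signalOf O w : Measure unitInterval) := by
            refine lintegral_mono fun m => ?_
            have hr : ∀ b, revenueFlow i O w m b = if w = some i then ((O i).1 : ℝ≥0∞) else 0 :=
              fun _ => rfl
            rw [signalNode_of_const σ _ t h O w m hr]
            refine add_le_add ?_ ?_
            · split_ifs with hwi
              · subst hwi; exact le_rfl
              · exact zero_le
            · rw [hσ]
              change ENNReal.ofReal ((if ENNReal.ofReal (m : ℝ) < ENNReal.ofReal (autarkyPayoff F k)
                then 1 else 0 : unitInterval) : ℝ) * _ ≤ _
              split_ifs with hm
              · have hm' := (ENNReal.ofReal_lt_ofReal_iff_of_nonneg m.2.1).mp hm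
                simp only [Set.Icc.coe_one, ENNReal.ofReal_one, one_mul]
                refine (ih _ _).trans (ENNReal.ofReal_le_ofReal ?_)
                rw [max_eq_right hm'.le, max_eq_right (hm'.le.trans huu)]
              · simp
        _ = ENNReal.ofReal (priceOf O w + (stopValue (signalOf O w) (fullInfoPayoff F k) -
              stopValue (signalOf O w) (autarkyPayoff F k))) := by
            rw [lintegral_add_left measurable_const, lintegral_const, measure_univ, mul_one,
              ← ofReal_integral_eq_lintegral_ofReal hintegral (Filter.Eventually.of_forall hnn),
              integral_sub (integrable_max _ _) (integrable_max _ _),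
              ENNReal.ofReal_add (NNReal.coe_nonneg _)
                (sub_nonneg.mpr (stopValue_mono _ huu)), ENNReal.ofReal_coe_nnreal]
            rfl
        _ ≤ ENNReal.ofReal B := by
            refine ENNReal.ofReal_le_ofReal ?_
            have h1 := (isMPC_signalOf O w).stopValue_le (fullInfoPayoff F k)
            rw [stopValue_fullInfoPayoff hk hkm] at h1
            rw [hB]
            unfold autarkyPayoff at *
            linarith
    calc totalUpTo σ (revenueFlow i) (N + 1) t h
        ≤ ∫⁻ _, ENNReal.ofReal B ∂(Measure.pi fun i => (σ.broker i).offer t h) :=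
          lintegral_mono key
      _ = ENNReal.ofReal B := by simp

theorem stopValue_two_point {G : ProbabilityMeasure unitInterval} {q : ℝ} {lo hi : unitInterval}
    (hG : (G : Measure unitInterval) =
      ENNReal.ofReal q • Measure.dirac lo + ENNReal.ofReal (1 - q) • Measure.dirac hi)
    (hq0 : 0 ≤ q) (hq1 : q < 1) (u : ℝ) :
    stopValue G u = q * max (lo : ℝ) u + (1 - q) * max (hi : ℝ) u := by
  have h1 : Integrable (fun x : unitInterval => max (x : ℝ) u) (Measure.dirac lo) :=
    integrable_max ⟨Measure.dirac lo, inferInstance⟩ u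
  have h2 : Integrable (fun x : unitInterval => max (x : ℝ) u) (Measure.dirac hi) :=
    integrable_max ⟨Measure.dirac hi, inferInstance⟩ u
  rw [stopValue, hG, integral_add_measure (h1.smul_measure ENNReal.ofReal_ne_top)
      (h2.smul_measure ENNReal.ofReal_ne_top), integral_smul_measure, integral_smul_measure,
      integral_dirac, integral_dirac, ENNReal.toReal_ofReal hq0,
      ENNReal.toReal_ofReal (by linarith), smul_eq_mul, smul_eq_mul]

theorem sum_purchase_one (f : Purchase 1 → ℝ≥0∞) : ∑ w, f w = f none + f (some 0) := by
  rw [Fintype.sum_option]; simp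

/-- The binary signal is sold every period at S(G,u̲) - m, which leaves the agent indifferent to the
null offer; ties favour the broker. The price is (1-q)(ū - u̲), so with continuation probability q
her expected revenues sum to ū - u̲. -/
theorem snoc_monopoly_mem {k : ℝ} (hk : 0 < k) (hkm : k < mean F) :
    (Fin.snoc (fun _ => fullInfoPayoff F k - autarkyPayoff F k) (autarkyPayoff F k) :
      Fin (1 + 1) → ℝ) ∈ equilibriumPayoffs F 1 k := by
  have hu : 0 ≤ autarkyPayoff F k := (autarkyPayoff_pos hkm).le
  have huu := autarkyPayoff_le_fullInfoPayoff hk hkm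
  have hu1 := fullInfoPayoff_lt_one hk hkm
  have haut : autarkyPayoff F k = mean F - k := rfl
  obtain ⟨G, q, lo, hi, hG, hq0, hq1, hmean, hexc, hlo⟩ := exists_thresholdSignal hk hkm
  have hp0 : 0 ≤ stopValue G.1 (autarkyPayoff F k) - mean F := by
    have := mean_le_stopValue G.1 (autarkyPayoff F k)
    rw [G.2.mean_eq] at this
    linarith
  set p : ℝ≥0 := ⟨_, hp0⟩ with hp
  set O₀ : Offers F 1 := fun _ => (p, G) with hO₀
  have hsome : purchaseValue (autarkyPayoff F k) O₀ (some 0) = mean F := by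
    change stopValue G.1 _ - (stopValue G.1 (autarkyPayoff F k) - mean F) = _
    ring
  have hnone : purchaseValue (autarkyPayoff F k) O₀ none = mean F := by
    rw [purchaseValue_none, max_eq_left (by linarith)]
  have hbest : bestPurchase (autarkyPayoff F k) O₀ = some 0 := by
    rcases hb : bestPurchase (autarkyPayoff F k) O₀ with _ | i
    · have := bestPurchase_spec (autarkyPayoff F k) O₀ (some 0)
      rw [hb, hsome, hnone] at this
      simp [purchaseRank] at this
    · rw [Subsingleton.elim i 0]
  obtain ⟨ρ, C⟩ := stationaryProfile_certificate (O₀ := O₀) hu (huu.trans hu1.le) hk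
    (by rw [hbest, hsome, haut]; ring)
  set σ := stationaryProfile hu O₀ with hσ
  set B := fullInfoPayoff F k - autarkyPayoff F k with hB
  have hB0 : 0 ≤ B := sub_nonneg.mpr huu
  have hle : ∀ (i : Fin 1) (s : BrokerStrategy F 1) (t : ℕ) (h : History F 1 t),
      brokerPayoff (σ.deviateBroker i s) i t h ≤ ENNReal.ofReal B := fun i s t h =>
    iSup_le fun N => totalUpTo_revenue_le hk hkm hu O₀ (σ.deviateBroker i s) rfl i N t h
  -- The revenue missing after N periods is at most q^N, starting from ū - u̲ ≤ 1.
  have hlow : ∀ (N t : ℕ) (h : History F 1 t),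
      ENNReal.ofReal B ≤ totalUpTo σ (revenueFlow 0) N t h + ENNReal.ofReal q ^ N := by
    intro N
    induction N with
    | zero =>
      intro t h
      simp only [totalUpTo, pow_zero, zero_add]
      exact ENNReal.ofReal_le_one.mpr (by linarith)
    | succ N ih =>
      intro t h
      rcases hlo with hq | hlo
      -- A signal that is never low has hi = m, hence ū = u̲.
      · have : B = 0 := by
          rw [hq] at hmean hexc
          rw [hB, haut]; linarith
        rw [this]; simp
      -- The two moment identities give u̲ = q·lo + (1-q)·ū, and lo < ū.
      have hlou : (lo : ℝ) < autarkyPayoff F k := by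
        rw [haut]
        nlinarith
      have hhiu : autarkyPayoff F k ≤ hi := by
        by_contra hlt
        have : (1 - q) * ((hi : ℝ) - fullInfoPayoff F k) ≤ 0 :=
          mul_nonpos_of_nonneg_of_nonpos (by linarith) (by linarith)
        linarith
      have hpB : (p : ℝ) + q * B = B := by
        change stopValue G.1 (autarkyPayoff F k) - mean F + q * B = B
        rw [stopValue_two_point hG hq0 hq1, max_eq_right hlou.le, max_eq_left hhiu, hB]
        linarith
      have hbuy : σ.agent.buy t (h, O₀) (some 0) = 1 := if_pos hbest
      have hcont : σ.agent.cont t (h, O₀, some 0, lo) = 1 :=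
        if_pos ((ENNReal.ofReal_lt_ofReal_iff_of_nonneg lo.2.1).mpr hlou)
      have hnode : (p : ℝ≥0∞) + ENNReal.ofReal q *
          totalUpTo σ (revenueFlow 0) N (t + 1) (h.extend (O₀, some 0, lo)) ≤
          totalUpTo σ (revenueFlow 0) (N + 1) t h := by
        have h1 : totalUpTo σ (revenueFlow 0) (N + 1) t h =
            offerNode σ (revenueFlow 0) (totalUpTo σ (revenueFlow 0) N) t h O₀ := by
          change ∫⁻ O, _ ∂(Measure.pi fun i => Measure.dirac (O₀ i)) = _
          rw [pi_dirac, lintegral_dirac]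
        rw [h1, offerNode, sum_purchase_one, hbuy, ENNReal.coe_one, one_mul]
        refine le_add_left ?_
        have hr : ∀ m b, revenueFlow 0 O₀ (some 0) m b = (p : ℝ≥0∞) := fun m b => by
          simp [revenueFlow, hO₀]
        simp_rw [signalNode_of_const σ _ t h O₀ (some 0) _ (hr _)]
        rw [lintegral_add_left measurable_const, lintegral_const, measure_univ, mul_one]
        gcongr
        change _ ≤ ∫⁻ m, _ ∂(G.1 : Measure unitInterval)
        rw [hG, lintegral_two_point, hcont]
        refine le_add_right ?_
        simp
      calc ENNReal.ofReal B = (p : ℝ≥0∞) + ENNReal.ofReal q * ENNReal.ofReal B := by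
            rw [← ENNReal.ofReal_coe_nnreal, ← ENNReal.ofReal_mul hq0,
              ← ENNReal.ofReal_add (NNReal.coe_nonneg _) (mul_nonneg hq0 hB0), hpB]
        _ ≤ (p : ℝ≥0∞) + ENNReal.ofReal q *
              (totalUpTo σ (revenueFlow 0) N (t + 1) (h.extend (O₀, some 0, lo)) +
                ENNReal.ofReal q ^ N) := by
            gcongr; exact ih _ _
        _ = (p : ℝ≥0∞) + ENNReal.ofReal q *
              totalUpTo σ (revenueFlow 0) N (t + 1) (h.extend (O₀, some 0, lo)) +
                ENNReal.ofReal q ^ (N + 1) := by ring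
        _ ≤ _ := add_le_add hnode le_rfl
  have hge : ∀ (i : Fin 1) (t : ℕ) (h : History F 1 t),
      ENNReal.ofReal B ≤ brokerPayoff σ i t h := by
    intro i t h
    rw [Subsingleton.elim i 0]
    have hlim : Filter.Tendsto (fun N => brokerPayoff σ 0 t h + ENNReal.ofReal q ^ N)
        Filter.atTop (nhds (brokerPayoff σ 0 t h + 0)) :=
      (ENNReal.tendsto_pow_atTop_nhds_zero_of_lt_one
        (by rw [← ENNReal.ofReal_one]; exact (ENNReal.ofReal_lt_ofReal_iff one_pos).mpr hq1)
        ).const_add _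
    rw [add_zero] at hlim
    exact ge_of_tendsto' hlim fun N => (hlow N t h).trans
      (add_le_add (totalUpTo_le_total _ _ _ _ _) le_rfl)
  refine snoc_mem_equilibriumPayoffs
    (C.isEquilibrium fun i s t h => (hle i s t h).trans (hge i t h)) (fun _ => hB0)
    (fun i => le_antisymm ?_ (hge i 0 _)) ?_
  · have := hle i (σ.broker i) 0 Fin.elim0
    rwa [Profile.deviateBroker, Function.update_eq_self] at this
  · rw [C.agentPayoff_eq, ENNReal.toReal_ofReal hu]

end Stationary

/-! ### Bounds on equilibrium payoffs -/

/-! ### One-period deviations -/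

theorem totalUpTo_congr {σ τ : Profile F n} {T : ℕ}
    (hb : ∀ t, T ≤ t → ∀ i, (σ.broker i).offer t = (τ.broker i).offer t)
    (ha : ∀ t, T ≤ t → σ.agent.buy t = τ.agent.buy t ∧ σ.agent.cont t = τ.agent.cont t)
    (g : Flow F n) (N t : ℕ) (ht : T ≤ t) (h : History F n t) :
    totalUpTo σ g N t h = totalUpTo τ g N t h := by
  induction N generalizing t with
  | zero => rfl
  | succ N ih =>
    simp only [totalUpTo, historyNode, offerNode, signalNode, hb t ht, ha t ht,
      ih (t + 1) (by omega)]

theorem total_congr {σ τ : Profile F n} {T : ℕ}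
    (hb : ∀ t, T ≤ t → ∀ i, (σ.broker i).offer t = (τ.broker i).offer t)
    (ha : ∀ t, T ≤ t → σ.agent.buy t = τ.agent.buy t ∧ σ.agent.cont t = τ.agent.cont t)
    (g : Flow F n) (t : ℕ) (ht : T ≤ t) (h : History F n t) :
    total σ g t h = total τ g t h := by
  simp only [total, totalUpTo_congr hb ha g _ t ht]

/-- Act as `b` in period `T` and as `a` in all other periods. -/
def spliceAgent (T : ℕ) (b a : AgentStrategy F n) : AgentStrategy F n where
  buy t := if t = T then b.buy t else a.buy t
  measurable_buy t w := by
    split_ifs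
    exacts [b.measurable_buy t w, a.measurable_buy t w]
  sum_buy t x := by
    split_ifs
    exacts [b.sum_buy t x, a.sum_buy t x]
  cont t := if t = T then b.cont t else a.cont t
  measurable_cont t := by
    split_ifs
    exacts [b.measurable_cont t, a.measurable_cont t]

/-- Histories of length T + 1 lie past the modified period, so continuation values are those of `σ`.
The next two lemmas thus evaluate a change of behaviour in one period against the equilibrium's own
continuation. -/
theorem total_spliceAgent (σ : Profile F n) (T : ℕ) (b : AgentStrategy F n) (g : Flow F n)
    (h : History F n (T + 1)) :
    total (σ.deviateAgent (spliceAgent T b σ.agent)) g (T + 1) h = total σ g (T + 1) h := by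
  refine total_congr (σ := σ.deviateAgent (spliceAgent T b σ.agent)) (τ := σ) (T := T + 1)
     (fun _ _ _ => rfl) (fun t ht => ?_) g _ le_rfl h
  have : t ≠ T := by omega
  simp [Profile.deviateAgent, spliceAgent, this]

theorem signalNode_spliceAgent (σ : Profile F n) (T : ℕ) (b : AgentStrategy F n) (g : Flow F n)
    (h : History F n T) (O : Offers F n) (w : Purchase n) (m : unitInterval) :
    signalNode (σ.deviateAgent (spliceAgent T b σ.agent)) g
      (total (σ.deviateAgent (spliceAgent T b σ.agent)) g) T h O w m =
    signalNode (σ.deviateAgent b) g (total σ g) T h O w m := by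
  unfold signalNode
  rw [total_spliceAgent]
  simp [Profile.deviateAgent, spliceAgent]

theorem offerNode_spliceAgent (σ : Profile F n) (T : ℕ) (b : AgentStrategy F n) (g : Flow F n)
    (h : History F n T) (O : Offers F n) :
    offerNode (σ.deviateAgent (spliceAgent T b σ.agent)) g
      (total (σ.deviateAgent (spliceAgent T b σ.agent)) g) T h O =
    offerNode (σ.deviateAgent b) g (total σ g) T h O := by
  unfold offerNode
  simp_rw [signalNode_spliceAgent]
  simp [Profile.deviateAgent, spliceAgent]

theorem offerNode_of_buy_eq_one (σ : Profile F n) (g : Flow F n)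
    (V : ∀ t, History F n t → ℝ≥0∞) {t : ℕ} {h : History F n t} {O : Offers F n} {w : Purchase n}
    (hw : σ.agent.buy t (h, O) w = 1) :
    offerNode σ g V t h O =
      ∫⁻ m, signalNode σ g V t h O w m ∂(signalOf O w : Measure unitInterval) := by
  have hsum := σ.agent.sum_buy t (h, O)
  rw [← Finset.add_sum_erase _ _ (Finset.mem_univ w), hw] at hsum
  have hz : ∑ w' ∈ Finset.univ.erase w, σ.agent.buy t (h, O) w' = 0 := by
    simpa using hsum
  rw [Finset.sum_eq_zero_iff] at hz
  rw [offerNode, ← Finset.add_sum_erase _ _ (Finset.mem_univ w), hw, Finset.sum_eq_zero, add_zero,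
    ENNReal.coe_one, one_mul]
  intro w' hw'
  rw [hz w' hw', ENNReal.coe_zero, zero_mul]

/-- The agent can always take the null offer and stop at once. -/
theorem IsEquilibrium.autarkyPayoff_le {k : ℝ} {σ : Profile F n} (hσ : IsEquilibrium k σ)
    (hk : 0 < k) (t : ℕ) (h : History F n t) :
    ((autarkyPayoff F k : ℝ) : EReal) ≤ agentPayoff k σ t h := by
  set a : AgentStrategy F n := pureAgent (fun _ => none) measurable_const (fun _ _ => 0)
    measurable_const with ha
  set τ := σ.deviateAgent a with hτ
  have hbuy : ∀ t h O, τ.agent.buy t (h, O) none = 1 := fun _ _ _ => by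
    simp [hτ, Profile.deviateAgent, ha, pureAgent]
  have hcont : ∀ t h O w m, τ.agent.cont t (h, O, w, m) = 0 := fun _ _ _ _ _ =>
    if_neg not_lt_zero
  have hcost : total τ (costFlow k) t h ≤ ENNReal.ofReal k := by
    refine iSup_le fun N => ?_
    cases N with
    | zero => exact zero_le
    | succ N =>
      have := isProbabilityMeasure_offers τ t h
      calc totalUpTo τ (costFlow k) (N + 1) t h
          = ∫⁻ _, ENNReal.ofReal k ∂(Measure.pi fun i => (τ.broker i).offer t h) := by
            refine lintegral_congr fun O => ?_
            rw [offerNode_of_buy_eq_one τ _ _ (hbuy t h O)]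
            simp_rw [signalNode_of_const τ (g := costFlow k) _ t h O none _
              (r := ENNReal.ofReal k + priceOf O none) (fun _ => rfl), hcont]
            simp [priceOf]
        _ = ENNReal.ofReal k := by simp
        _ ≤ _ := le_rfl
  have hcons : ENNReal.ofReal (mean F) ≤ total τ consumptionFlow t h := by
    refine le_trans ?_ (totalUpTo_le_total τ _ 1 t h)
    have := isProbabilityMeasure_offers τ t h
    refine le_of_eq ?_
    calc ENNReal.ofReal (mean F)
        = ∫⁻ _, ENNReal.ofReal (mean F) ∂(Measure.pi fun i => (τ.broker i).offer t h) := by simp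
      _ = totalUpTo τ consumptionFlow 1 t h := by
        refine lintegral_congr fun O => ?_
        rw [offerNode_of_buy_eq_one τ _ _ (hbuy t h O)]
        simp_rw [signalNode_consumption, hcont]
        change _ = ∫⁻ m, _ ∂(Measure.dirac (⟨mean F, mean_mem F⟩ : unitInterval))
        rw [lintegral_dirac]
        simp
  refine le_trans ?_ (hσ.agent_opt a t h)
  have hm : ((mean F : ℝ) : EReal) ≤ (total τ consumptionFlow t h : EReal) := by
    have := EReal.coe_ennreal_le_coe_ennreal_iff.mpr hcons
    rwa [EReal.coe_ennreal_ofReal, max_eq_left (mean_mem F).1] at this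
  have hc : (total τ (costFlow k) t h : EReal) ≤ ((k : ℝ) : EReal) := by
    have := EReal.coe_ennreal_le_coe_ennreal_iff.mpr hcost
    rwa [EReal.coe_ennreal_ofReal, max_eq_left hk.le] at this
  rw [autarkyPayoff, EReal.coe_sub]
  exact EReal.sub_le_sub hm hc

/-- Infinite expected costs would give payoff ⊥, below autarky. Costs are therefore finite in
equilibrium and the autarky bound can be written additively. -/
theorem IsEquilibrium.ofReal_autarkyPayoff_add_le {k : ℝ} {σ : Profile F n}
    (hσ : IsEquilibrium k σ) (hk : 0 < k) (hkm : k < mean F) (t : ℕ) (h : History F n t) :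
    ENNReal.ofReal (autarkyPayoff F k) + total σ (costFlow k) t h ≤
      total σ consumptionFlow t h := by
  have h1 := hσ.autarkyPayoff_le hk t h
  have hC : total σ consumptionFlow t h ≠ ⊤ :=
    ne_top_of_le_ne_top ENNReal.one_ne_top (total_consumption_le_one σ t h)
  have hK : total σ (costFlow k) t h ≠ ⊤ := by
    intro htop
    rw [agentPayoff, htop, sub_top_toEReal, le_bot_iff] at h1
    exact EReal.coe_ne_bot _ h1
  rw [agentPayoff, sub_toEReal hC hK, EReal.coe_le_coe_iff] at h1
  rw [← ENNReal.ofReal_toReal hK, ← ENNReal.ofReal_toReal hC,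
    ← ENNReal.ofReal_add (autarkyPayoff_pos hkm).le ENNReal.toReal_nonneg]
  exact ENNReal.ofReal_le_ofReal (by linarith)

theorem IsEquilibrium.total_cost_le_one {k : ℝ} {σ : Profile F n} (hσ : IsEquilibrium k σ)
    (hk : 0 < k) (hkm : k < mean F) (t : ℕ) (h : History F n t) :
    total σ (costFlow k) t h ≤ 1 :=
  le_add_self.trans ((hσ.ofReal_autarkyPayoff_add_le hk hkm t h).trans
    (total_consumption_le_one σ t h))

theorem toReal_sub_le_of_toEReal {A B A' B' : ℝ≥0∞} (hA : A ≠ ⊤) (hB : B ≠ ⊤) (hA' : A' ≠ ⊤)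
    (hB' : B' ≠ ⊤) (h : (A : EReal) - (B : EReal) ≤ (A' : EReal) - (B' : EReal)) :
    A.toReal - B.toReal ≤ A'.toReal - B'.toReal := by
  rwa [sub_toEReal hA hB, sub_toEReal hA' hB', EReal.coe_le_coe_iff] at h

/-- After a signal below the autarky payoff the agent goes on searching. -/
theorem IsEquilibrium.cont_eq_one {k : ℝ} {σ : Profile F n} (hσ : IsEquilibrium k σ)
    (hk : 0 < k) (hkm : k < mean F) (t : ℕ) (h : History F n t) (O : Offers F n) (w : Purchase n)
    {m : unitInterval} (hm : (m : ℝ) < autarkyPayoff F k) :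
    σ.agent.cont t (h, O, w, m) = 1 := by
  -- The threshold `⊤` makes this strategy continue after every signal; spliced into one period, it
  -- is followed by equilibrium play worth at least u̲.
  set b : AgentStrategy F n := pureAgent (fun _ => none) measurable_const (fun _ _ => ⊤)
    measurable_const with hb
  have hbc : (σ.deviateAgent b).agent.cont t (h, O, w, m) = 1 := by
    change (if ENNReal.ofReal (m : ℝ) < ⊤ then (1 : unitInterval) else 0) = 1
    rw [if_pos ENNReal.ofReal_lt_top]
  have hopt := hσ.agent_opt_signal (spliceAgent t b σ.agent) t h O w m
  have hC1 := total_consumption_le_one σ (t + 1) (h.extend (O, w, m))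
  have hK1 := hσ.total_cost_le_one hk hkm (t + 1) (h.extend (O, w, m))
  have hC := ne_top_of_le_ne_top ENNReal.one_ne_top hC1
  have hK := ne_top_of_le_ne_top ENNReal.one_ne_top hK1
  have haut := hσ.ofReal_autarkyPayoff_add_le hk hkm (t + 1) (h.extend (O, w, m))
  have haut' := (ENNReal.toReal_le_toReal (ENNReal.add_ne_top.mpr ⟨ENNReal.ofReal_ne_top, hK⟩)
    hC).mpr haut
  rw [ENNReal.toReal_add ENNReal.ofReal_ne_top hK,
    ENNReal.toReal_ofReal (autarkyPayoff_pos hkm).le] at haut'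
  unfold agentPayoffSignal at hopt
  rw [signalNode_spliceAgent, signalNode_spliceAgent, signalNode_consumption,
    signalNode_consumption, signalNode_of_const _ (g := costFlow k) _ t h O w m
      (r := ENNReal.ofReal k + priceOf O w) (fun _ => rfl),
    signalNode_of_const _ (g := costFlow k) _ t h O w m
      (r := ENNReal.ofReal k + priceOf O w) (fun _ => rfl), hbc] at hopt
  set c := σ.agent.cont t (h, O, w, m) with hc
  have hc0 : (0 : ℝ) ≤ c := c.2.1
  have hc1 : (c : ℝ) ≤ 1 := c.2.2
  have hcC : ENNReal.ofReal (c : ℝ) * total σ consumptionFlow (t + 1) (h.extend (O, w, m)) ≠ ⊤ :=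
    ENNReal.mul_ne_top ENNReal.ofReal_ne_top hC
  have hcK : ENNReal.ofReal (c : ℝ) * total σ (costFlow k) (t + 1) (h.extend (O, w, m)) ≠ ⊤ :=
    ENNReal.mul_ne_top ENNReal.ofReal_ne_top hK
  have hcm : ENNReal.ofReal (1 - (c : ℝ)) * ENNReal.ofReal (m : ℝ) ≠ ⊤ :=
    ENNReal.mul_ne_top ENNReal.ofReal_ne_top ENNReal.ofReal_ne_top
  have hkp : ENNReal.ofReal k + (priceOf O w : ℝ≥0∞) ≠ ⊤ := by simp
  simp only [Set.Icc.coe_one, sub_self, ENNReal.ofReal_zero, zero_mul, zero_add,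
    ENNReal.ofReal_one, one_mul] at hopt
  have key := toReal_sub_le_of_toEReal hC (ENNReal.add_ne_top.mpr ⟨hkp, hK⟩)
    (ENNReal.add_ne_top.mpr ⟨hcm, hcC⟩) (ENNReal.add_ne_top.mpr ⟨hkp, hcK⟩) hopt
  rw [ENNReal.toReal_add hkp hK, ENNReal.toReal_add hcm hcC, ENNReal.toReal_add hkp hcK,
    ENNReal.toReal_mul, ENNReal.toReal_mul, ENNReal.toReal_mul,
    ENNReal.toReal_ofReal (show 0 ≤ 1 - (c : ℝ) by linarith),
    ENNReal.toReal_ofReal m.2.1, ENNReal.toReal_ofReal hc0] at key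
  refine Subtype.ext (le_antisymm hc1 ?_)
  by_contra hlt
  have hlt' : (c : ℝ) < 1 := not_le.mp hlt
  have : 0 < (1 - (c : ℝ)) * ((total σ consumptionFlow (t + 1) (h.extend (O, w, m))).toReal -
      (total σ (costFlow k) (t + 1) (h.extend (O, w, m))).toReal - m) :=
    mul_pos (by linarith) (by linarith)
  nlinarith

/-! ### Monopoly above the threshold -/

/-- If continuing is worth at most M, the null offer yields at most max(m,M) before the search cost.
Continuing is always worth at least u̲, so buying and stopping only above u̲ yields at least the
stopping value at u̲ less the price, which is strictly more. -/
theorem IsEquilibrium.buy_eq_one {k : ℝ} {σ : Profile F 1} (hσ : IsEquilibrium k σ) (hk : 0 < k)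
    (hkm : k < mean F) {M : ℝ} (hM0 : 0 ≤ M)
    (hM : ∀ t h, total σ consumptionFlow t h ≤ ENNReal.ofReal M + total σ (costFlow k) t h)
    (o : Offer F) (ho : max (mean F) M + o.1 < stopValue o.2.1 (autarkyPayoff F k))
    (t : ℕ) (h : History F 1 t) : σ.agent.buy t (h, fun _ => o) (some 0) = 1 := by
  set O : Offers F 1 := fun _ => o with hO
  set u := autarkyPayoff F k with hu
  have hu0 : 0 ≤ u := (autarkyPayoff_pos hkm).le
  -- payoffs conditional on the purchase
  set c : Purchase 1 → ℝ≥0∞ := fun w => ∫⁻ m, signalNode σ consumptionFlow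
    (total σ consumptionFlow) t h O w m ∂(signalOf O w : Measure unitInterval) with hc
  set d : Purchase 1 → ℝ≥0∞ := fun w => ∫⁻ m, signalNode σ (costFlow k)
    (total σ (costFlow k)) t h O w m ∂(signalOf O w : Measure unitInterval) with hd
  have hc1 : ∀ w, c w ≠ ⊤ := fun w => by
    refine ne_top_of_le_ne_top ENNReal.one_ne_top ?_
    calc c w ≤ ∫⁻ _, 1 ∂(signalOf O w : Measure unitInterval) := lintegral_mono fun m =>
          signalNode_consumption_le_one σ (total_consumption_le_one σ) t h O w m
      _ = 1 := by simp
  have hcostle : ∀ (τ : Profile F 1) w m, signalNode τ (costFlow k) (total σ (costFlow k)) t h O w m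
      ≤ ENNReal.ofReal k + priceOf O w + 1 := by
    intro τ w m
    rw [signalNode_of_const _ (g := costFlow k) _ t h O w m
      (r := ENNReal.ofReal k + priceOf O w) (fun _ => rfl)]
    gcongr
    exact mul_le_one' (ENNReal.ofReal_le_one.mpr (τ.agent.cont t (h, O, w, m)).2.2)
      (hσ.total_cost_le_one hk hkm _ _)
  have hcostint : ∀ (τ : Profile F 1) w, ∫⁻ m, signalNode τ (costFlow k) (total σ (costFlow k))
      t h O w m ∂(signalOf O w : Measure unitInterval) ≠ ⊤ := fun τ w => by
    refine ne_top_of_le_ne_top (b := ENNReal.ofReal k + priceOf O w + 1) (by simp) ?_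
    calc _ ≤ ∫⁻ _, (ENNReal.ofReal k + priceOf O w + 1) ∂(signalOf O w : Measure unitInterval) :=
          lintegral_mono fun m => hcostle τ w m
      _ = _ := by simp
  have hd1 : ∀ w, d w ≠ ⊤ := hcostint σ
  set bn := σ.agent.buy t (h, O) none with hbn
  set bs := σ.agent.buy t (h, O) (some 0) with hbs
  have hsum : (bn : ℝ) + bs = 1 := by
    have := σ.agent.sum_buy t (h, O)
    rw [Fintype.sum_option, Fin.sum_univ_one] at this
    exact_mod_cast this
  have hoc : offerNode σ consumptionFlow (total σ consumptionFlow) t h O =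
      bn * c none + bs * c (some 0) := sum_purchase_one _
  have hod : offerNode σ (costFlow k) (total σ (costFlow k)) t h O =
      bn * d none + bs * d (some 0) := sum_purchase_one _
  have hocf : ∀ w (b : ℝ≥0), (b : ℝ≥0∞) * c w ≠ ⊤ := fun w b =>
    ENNReal.mul_ne_top ENNReal.coe_ne_top (hc1 w)
  have hodf : ∀ w (b : ℝ≥0), (b : ℝ≥0∞) * d w ≠ ⊤ := fun w b =>
    ENNReal.mul_ne_top ENNReal.coe_ne_top (hd1 w)
  -- the value of the null offer
  have hnone : (c none).toReal - (d none).toReal ≤ max (mean F) M - k := by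
    have h1 : c none + ENNReal.ofReal k ≤ ENNReal.ofReal (max (mean F) M) + d none := by
      have e1 : c none = signalNode σ consumptionFlow (total σ consumptionFlow) t h O none
          ⟨mean F, mean_mem F⟩ := lintegral_dirac _ _
      have e2 : d none = signalNode σ (costFlow k) (total σ (costFlow k)) t h O none
          ⟨mean F, mean_mem F⟩ := lintegral_dirac _ _
      rw [e1, e2, signalNode_of_const _ (g := costFlow k) _ t h O none _
        (r := ENNReal.ofReal k) (fun _ => by simp [costFlow, priceOf]), signalNode_consumption,
        ENNReal.ofReal_max]
      exact (add_le_add (weighted_le_max (hM _ _)) le_rfl).trans_eq (by ring)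
    have h2 := (ENNReal.toReal_le_toReal (by simp [hc1]) (by simp [hd1])).mpr h1
    rw [ENNReal.toReal_add (hc1 _) (by simp), ENNReal.toReal_add (by simp) (hd1 _),
      ENNReal.toReal_ofReal hk.le, ENNReal.toReal_ofReal (le_max_of_le_right hM0)] at h2
    linarith
  -- buying surely and then following the equilibrium strategy is not profitable
  have hbuy : (c (some 0)).toReal - (d (some 0)).toReal ≤
      (bn * (c none).toReal + bs * (c (some 0)).toReal) -
        (bn * (d none).toReal + bs * (d (some 0)).toReal) := by
    set b : AgentStrategy F 1 :=
      { pureAgent (F := F) (n := 1) (fun _ => some 0) measurable_const (fun _ _ => 0)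
          measurable_const with
        cont := σ.agent.cont
        measurable_cont := σ.agent.measurable_cont } with hb
    have hb1 : (σ.deviateAgent b).agent.buy t (h, O) (some 0) = 1 := by
      simp [Profile.deviateAgent, hb, pureAgent]
    have hopt := hσ.agent_opt_offer (spliceAgent t b σ.agent) t h O
    unfold agentPayoffOffer at hopt
    rw [offerNode_spliceAgent, offerNode_spliceAgent,
      offerNode_of_buy_eq_one _ _ _ hb1, offerNode_of_buy_eq_one _ _ _ hb1, hoc, hod] at hopt
    have := toReal_sub_le_of_toEReal (A := c (some 0)) (B := d (some 0)) (hc1 _) (hd1 _)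
      (ENNReal.add_ne_top.mpr ⟨hocf _ _, hocf _ _⟩) (ENNReal.add_ne_top.mpr ⟨hodf _ _, hodf _ _⟩)
      hopt
    rw [ENNReal.toReal_add (hocf _ _) (hocf _ _), ENNReal.toReal_add (hodf _ _) (hodf _ _)] at this
    simpa only [ENNReal.toReal_mul, ENNReal.coe_toReal] using this
  -- nor is buying and then stopping as if the continuation value were the autarky payoff
  have hstopping : stopValue o.2.1 u - o.1 - k ≤
      (bn * (c none).toReal + bs * (c (some 0)).toReal) -
        (bn * (d none).toReal + bs * (d (some 0)).toReal) := by
    set b : AgentStrategy F 1 := pureAgent (fun _ => some 0) measurable_const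
      (fun _ _ => ENNReal.ofReal u) measurable_const with hb
    have hbc : ∀ m, (σ.deviateAgent b).agent.cont t (h, O, some 0, m) =
      if ENNReal.ofReal (m : ℝ) < ENNReal.ofReal u then 1 else 0 := fun _ => rfl
    set c' := ∫⁻ m, signalNode (σ.deviateAgent b) consumptionFlow (total σ consumptionFlow)
      t h O (some 0) m ∂(signalOf O (some 0) : Measure unitInterval) with hc'
    set d' := ∫⁻ m, signalNode (σ.deviateAgent b) (costFlow k) (total σ (costFlow k))
      t h O (some 0) m ∂(signalOf O (some 0) : Measure unitInterval) with hd'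
    have hb1 : (σ.deviateAgent b).agent.buy t (h, O) (some 0) = 1 := by
      simp [Profile.deviateAgent, hb, pureAgent]
    have hopt := hσ.agent_opt_offer (spliceAgent t b σ.agent) t h O
    unfold agentPayoffOffer at hopt
    rw [offerNode_spliceAgent, offerNode_spliceAgent,
      offerNode_of_buy_eq_one _ _ _ hb1, offerNode_of_buy_eq_one _ _ _ hb1, hoc, hod,
      ← hc', ← hd'] at hopt
    have hc'1 : c' ≠ ⊤ := by
      refine ne_top_of_le_ne_top ENNReal.one_ne_top ?_
      calc c' ≤ ∫⁻ _, 1 ∂(signalOf O (some 0) : Measure unitInterval) := lintegral_mono fun m =>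
            signalNode_consumption_le_one _ (total_consumption_le_one σ) t h O _ m
        _ = 1 := by simp
    have hd'1 : d' ≠ ⊤ := hcostint _ _
    have hval : ENNReal.ofReal (stopValue o.2.1 u) + d' ≤
        c' + (ENNReal.ofReal k + (o.1 : ℝ≥0∞)) := by
      rw [← lintegral_max _ hu0]
      change ∫⁻ m : unitInterval, _ ∂(signalOf O (some 0) : Measure unitInterval) + d' ≤ _
      rw [hd', hc', ← lintegral_add_left (by fun_prop)]
      calc _ ≤ ∫⁻ m, (signalNode (σ.deviateAgent b) consumptionFlow (total σ consumptionFlow)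
              t h O (some 0) m + (ENNReal.ofReal k + (o.1 : ℝ≥0∞)))
              ∂(signalOf O (some 0) : Measure unitInterval) := by
            refine lintegral_mono fun m => ?_
            rw [signalNode_of_const _ (g := costFlow k) _ t h O (some 0) m
              (r := ENNReal.ofReal k + (o.1 : ℝ≥0∞)) (fun _ => rfl), signalNode_consumption, hbc]
            have haut := hσ.ofReal_autarkyPayoff_add_le hk hkm (t + 1)
              (h.extend (O, some 0, m))
            split_ifs with hlt
            · rw [max_eq_right hlt.le]
              simp only [Set.Icc.coe_one, ENNReal.ofReal_one, one_mul, sub_self,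
                ENNReal.ofReal_zero, zero_mul, zero_add]
              refine le_trans (le_of_eq ?_) (add_le_add haut le_rfl)
              ring
            · rw [max_eq_left (not_lt.mp hlt)]
              simp
        _ = _ := by rw [lintegral_add_right _ measurable_const]; simp
    have h2 := (ENNReal.toReal_le_toReal (by simp [hd'1]) (by simp [hc'1])).mpr hval
    rw [ENNReal.toReal_add (by simp) hd'1, ENNReal.toReal_add hc'1 (by simp),
      ENNReal.toReal_add (by simp) (by simp), ENNReal.toReal_ofReal hk.le,
      ENNReal.toReal_ofReal (hu0.trans (le_stopValue _ _)), ENNReal.coe_toReal] at h2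
    have := toReal_sub_le_of_toEReal hc'1 hd'1
      (ENNReal.add_ne_top.mpr ⟨hocf _ _, hocf _ _⟩) (ENNReal.add_ne_top.mpr ⟨hodf _ _, hodf _ _⟩)
      hopt
    rw [ENNReal.toReal_add (hocf _ _) (hocf _ _), ENNReal.toReal_add (hodf _ _) (hodf _ _)] at this
    simp only [ENNReal.toReal_mul, ENNReal.coe_toReal] at this
    linarith
  -- If the null offer had positive probability, `hbuy` would make it at least as good as the
  -- purchase. The equilibrium value would then be at most that of the null offer, contradicting
  -- `hstopping`.
  have hbn0 : (bn : ℝ) = 0 := by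
    by_contra hne
    have hpos : (0 : ℝ) < bn := lt_of_le_of_ne (NNReal.coe_nonneg _) (Ne.symm hne)
    have hbs' : (bs : ℝ) = 1 - bn := by linarith
    rw [hbs'] at hbuy hstopping
    have h1 : (bn : ℝ) * (((c (some 0)).toReal - (d (some 0)).toReal) -
        ((c none).toReal - (d none).toReal)) ≤ 0 := by linarith
    have h2 : ((c (some 0)).toReal - (d (some 0)).toReal) -
        ((c none).toReal - (d none).toReal) ≤ 0 := nonpos_of_mul_nonpos_right h1 hpos
    have hbs0 : 0 ≤ 1 - (bn : ℝ) := by rw [← hbs']; exact NNReal.coe_nonneg _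
    have h3 := mul_nonpos_of_nonneg_of_nonpos hbs0 h2
    linarith
  have : (bs : ℝ) = 1 := by linarith
  exact_mod_cast this

/-- Offer `o` in period `T` and follow `s` in all other periods. -/
def spliceBroker (T : ℕ) (o : Offer F) (s : BrokerStrategy F n) : BrokerStrategy F n where
  offer t := if t = T then Kernel.const _ (Measure.dirac o) else s.offer t
  markov t := by
    split_ifs
    · infer_instance
    · exact s.markov t

/-- The monopolist's one-period deviation to an offer that is bought for sure. Truncating the
continuation at N periods avoids exchanging a supremum with the integral. -/
theorem IsEquilibrium.le_brokerPayoff {k : ℝ} {σ : Profile F 1} (hσ : IsEquilibrium k σ)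
    {o : Offer F} {t : ℕ} {h : History F 1 t}
    (hbuy : σ.agent.buy t (h, fun _ => o) (some 0) = 1) (N : ℕ) :
    (o.1 : ℝ≥0∞) + ∫⁻ m, ENNReal.ofReal (σ.agent.cont t (h, (fun _ => o), some 0, m) : ℝ) *
      totalUpTo σ (revenueFlow 0) N (t + 1) (h.extend ((fun _ => o), some 0, m))
      ∂(o.2.1 : Measure unitInterval) ≤ brokerPayoff σ 0 t h := by
  set τ := σ.deviateBroker 0 (spliceBroker t o (σ.broker 0)) with hτ
  have hbt : ∀ i, (τ.broker i).offer t h = Measure.dirac o := by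
    intro i
    rw [Subsingleton.elim i 0]
    simp [hτ, Profile.deviateBroker, spliceBroker]
  refine le_trans (le_of_eq ?_) ((totalUpTo_le_total τ (revenueFlow 0) (N + 1) t h).trans
    (hσ.broker_opt 0 _ t h))
  have h1 : totalUpTo τ (revenueFlow 0) (N + 1) t h =
      offerNode τ (revenueFlow 0) (totalUpTo τ (revenueFlow 0) N) t h (fun _ => o) := by
    change ∫⁻ O, _ ∂(Measure.pi fun i => (τ.broker i).offer t h) = _
    simp_rw [hbt]
    rw [pi_dirac, lintegral_dirac]
  have h2 : ∀ h' : History F 1 (t + 1), totalUpTo τ (revenueFlow 0) N (t + 1) h' =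
      totalUpTo σ (revenueFlow 0) N (t + 1) h' := by
    refine totalUpTo_congr (σ := τ) (τ := σ) (T := t + 1) (fun t' ht' i => ?_)
      (fun _ _ => ⟨rfl, rfl⟩) _ N _ le_rfl
    have : t' ≠ t := by omega
    obtain rfl : i = 0 := Subsingleton.elim _ _
    simp [hτ, Profile.deviateBroker, spliceBroker, this]
  rw [h1, offerNode_of_buy_eq_one τ _ _ (w := some 0) hbuy]
  simp_rw [signalNode_of_const τ (g := revenueFlow 0) _ t h (fun _ => o) (some 0) _
    (r := (o.1 : ℝ≥0∞)) (fun _ => if_pos rfl), h2]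
  rw [lintegral_add_left measurable_const, lintegral_const, measure_univ, mul_one]
  rfl

/-- Above the threshold a monopolist gets at least the whole gain from full information. -/
theorem IsEquilibrium.le_brokerPayoff_of_costGap_neg {k : ℝ} {σ : Profile F 1}
    (hσ : IsEquilibrium k σ) (hk : 0 < k) (hkm : k < mean F) (hgap : costGap F k < 0) (t : ℕ)
    (h : History F 1 t) :
    ENNReal.ofReal (fullInfoPayoff F k - autarkyPayoff F k) ≤ brokerPayoff σ 0 t h := by
  have hu0 := autarkyPayoff_pos hkm
  have huu := autarkyPayoff_le_fullInfoPayoff hk hkm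
  have haut : autarkyPayoff F k = mean F - k := rfl
  have hgap' := fullInfoPayoff_lt_stopValue hk hkm hgap
  have hsurplus : ∀ t h, total σ consumptionFlow t h + brokerPayoff σ 0 t h ≤
      ENNReal.ofReal (fullInfoPayoff F k) + total σ (costFlow k) t h := fun t h => by
    simpa using total_consumption_add_revenue_le σ hk hkm t h
  have hvle : ∀ t h, brokerPayoff σ 0 t h ≤
      ENNReal.ofReal (fullInfoPayoff F k - autarkyPayoff F k) := by
    intro t h
    have hK := ne_top_of_le_ne_top ENNReal.one_ne_top (hσ.total_cost_le_one hk hkm t h)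
    have h1 := (add_le_add (hσ.ofReal_autarkyPayoff_add_le hk hkm t h) le_rfl).trans
      (hsurplus t h)
    rw [ENNReal.ofReal_sub _ hu0.le]
    refine ENNReal.le_sub_of_add_le_left ENNReal.ofReal_ne_top ?_
    rw [add_right_comm] at h1
    exact (ENNReal.add_le_add_iff_right hK).mp h1
  -- The worst payoff over all histories, on and off the path. It bounds her continuation payoff
  -- after any deviation from below, and hence the agent's continuation payoff from above by ū - r.
  set v : ℝ≥0∞ := ⨅ t, ⨅ h, brokerPayoff σ 0 t h with hv
  have hvh : ∀ t h, v ≤ brokerPayoff σ 0 t h := fun t h =>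
    (iInf_le _ t).trans (iInf_le _ h)
  have hvB : v ≤ ENNReal.ofReal (fullInfoPayoff F k - autarkyPayoff F k) :=
    (hvh t h).trans (hvle t h)
  have hvtop : v ≠ ⊤ := ne_top_of_le_ne_top ENNReal.ofReal_ne_top hvB
  set r := v.toReal with hr
  have hr0 : 0 ≤ r := ENNReal.toReal_nonneg
  have hvr : v = ENNReal.ofReal r := (ENNReal.ofReal_toReal hvtop).symm
  have hrB : r ≤ fullInfoPayoff F k - autarkyPayoff F k :=
    ENNReal.toReal_le_of_le_ofReal (sub_nonneg.mpr huu) hvB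
  have hM0 : 0 ≤ fullInfoPayoff F k - r := by linarith
  have hM : ∀ t h, total σ consumptionFlow t h ≤
      ENNReal.ofReal (fullInfoPayoff F k - r) + total σ (costFlow k) t h := by
    intro t h
    have h1 := (add_le_add le_rfl (hvh t h)).trans (hsurplus t h)
    rw [hvr] at h1
    refine (ENNReal.add_le_add_iff_right (ENNReal.ofReal_ne_top (r := r))).mp (h1.trans_eq ?_)
    rw [add_right_comm, ← ENNReal.ofReal_add hM0 hr0, sub_add_cancel]
  have hlow : fullInfoPayoff F k - r < mean F := by
    by_contra hge
    have hge' := not_lt.mp hge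
    -- Full information at price r + ε costs the agent, with the forgone ū - r, a total of ū + ε <
    -- S(F,u̲). It sells after every history and would raise the infimum above r.
    set ε := (stopValue F (autarkyPayoff F k) - fullInfoPayoff F k) / 2 with hε
    have hε0 : 0 < ε := by rw [hε]; linarith
    set o : Offer F := (⟨r + ε, by positivity⟩, ⟨F, IsMPC.refl F⟩) with ho
    have hcond : max (mean F) (fullInfoPayoff F k - r) + o.1 <
        stopValue o.2.1 (autarkyPayoff F k) := by
      rw [max_eq_right hge']
      change fullInfoPayoff F k - r + (r + ε) < stopValue F (autarkyPayoff F k)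
      linarith
    have hle : ENNReal.ofReal (r + ε) ≤ v := by
      refine le_iInf fun t => le_iInf fun h => ?_
      have := hσ.le_brokerPayoff (hσ.buy_eq_one hk hkm hM0 hM o hcond t h) 0
      refine le_trans ?_ (le_self_add.trans this)
      rw [← ENNReal.ofReal_coe_nnreal]
      exact le_rfl
    rw [hvr, ENNReal.ofReal_le_ofReal_iff hr0] at hle
    linarith
  refine le_trans ?_ (hvh t h)
  rw [hvr]
  refine ENNReal.ofReal_le_ofReal ?_
  obtain ⟨G, q, lo, hi, hG, hq0, hq1, hmean, hexc, hlo⟩ := exists_thresholdSignal hk hkm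
  rcases hlo with hq | hlo
  · rw [hq] at hmean hexc
    linarith
  have hlou : (lo : ℝ) < autarkyPayoff F k := by
    rw [haut]
    nlinarith
  have hhiu : autarkyPayoff F k ≤ hi := by
    by_contra hlt
    have : (1 - q) * ((hi : ℝ) - fullInfoPayoff F k) ≤ 0 :=
      mul_nonpos_of_nonneg_of_nonpos (by linarith) (by linarith)
    linarith
  by_contra hrlt
  have hrlt' := not_le.mp hrlt
  set B := fullInfoPayoff F k - autarkyPayoff F k with hB
  -- The binary signal is worth m + (1-q)B to an agent with continuation u̲. Replacing B by the
  -- midpoint of r < B makes the sale certain. A low signal prolongs the search and brings at least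
  -- r more, so r ≥ (1-q)(r+B)/2 + qr, that is, r ≥ B.
  have hp0 : 0 ≤ (1 - q) * ((r + B) / 2) := mul_nonneg (by linarith) (by linarith)
  set o : Offer F := (⟨(1 - q) * ((r + B) / 2), hp0⟩, G) with ho
  have hstrict : (1 - q) * ((r + B) / 2) < (1 - q) * B :=
    mul_lt_mul_of_pos_left (by linarith) (by linarith)
  have hcond : max (mean F) (fullInfoPayoff F k - r) + o.1 <
      stopValue o.2.1 (autarkyPayoff F k) := by
    rw [max_eq_left hlow.le]
    change mean F + (1 - q) * ((r + B) / 2) < stopValue G.1 (autarkyPayoff F k)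
    rw [stopValue_two_point hG hq0 hq1, max_eq_right hlou.le, max_eq_left hhiu]
    have : (1 - q) * B = q * autarkyPayoff F k + (1 - q) * hi - mean F := by
      rw [hB]; linarith
    linarith
  have hle : ENNReal.ofReal ((1 - q) * ((r + B) / 2) + q * r) ≤ v := by
    refine le_iInf fun t => le_iInf fun h => ?_
    have hN : ∀ N, (o.1 : ℝ≥0∞) + ENNReal.ofReal q *
        totalUpTo σ (revenueFlow 0) N (t + 1) (h.extend ((fun _ => o), some 0, lo)) ≤
        brokerPayoff σ 0 t h := by
      intro N
      refine le_trans ?_ (hσ.le_brokerPayoff (hσ.buy_eq_one hk hkm hM0 hM o hcond t h) N)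
      refine add_le_add le_rfl ?_
      change _ ≤ ∫⁻ m, _ ∂(G.1 : Measure unitInterval)
      rw [hG, lintegral_two_point, hσ.cont_eq_one hk hkm t h _ _ hlou]
      refine le_add_right ?_
      simp
    have hsup : (o.1 : ℝ≥0∞) + ENNReal.ofReal q *
        brokerPayoff σ 0 (t + 1) (h.extend ((fun _ => o), some 0, lo)) ≤
        brokerPayoff σ 0 t h := by
      rw [brokerPayoff, total, ENNReal.mul_iSup, ENNReal.add_iSup]
      exact iSup_le hN
    refine le_trans ?_ hsup
    rw [ENNReal.ofReal_add hp0 (mul_nonneg hq0 hr0), ENNReal.ofReal_mul hq0, ← hvr]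
    refine add_le_add ?_ (mul_le_mul_right (hvh _ _) _)
    rw [← ENNReal.ofReal_coe_nnreal]
    exact le_rfl
  rw [hvr, ENNReal.ofReal_le_ofReal_iff hr0] at hle
  have : (1 - q) * ((B - r) / 2) ≤ 0 := by linarith
  have : 0 < (1 - q) * ((B - r) / 2) := mul_pos (by linarith) (by linarith)
  linarith

/-! ### Equilibrium payoff sets -/

section PayoffSets

variable {k : ℝ}

theorem sum_mem_Icc_of_mem (hk : 0 < k) (hkm : k < mean F) {y : Fin (n + 1) → ℝ}
    (hy : y ∈ equilibriumPayoffs F n k) :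
    autarkyPayoff F k ≤ y (Fin.last n) ∧ y (Fin.last n) ≤ ∑ j, y j ∧
      ∑ j, y j ≤ fullInfoPayoff F k := by
  obtain ⟨σ, hσ, hb, ha⟩ := hy
  have h0 : ∀ i : Fin n, 0 ≤ y i.castSucc := fun i => by
    have := hb i
    have h1 : (0 : EReal) ≤ (y i.castSucc : EReal) := by rw [this]; exact EReal.coe_ennreal_nonneg _
    exact_mod_cast h1
  refine ⟨?_, ?_, ?_⟩
  · have := hσ.autarkyPayoff_le hk 0 Fin.elim0
    rw [← ha, EReal.coe_le_coe_iff] at this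
    exact this
  · rw [Fin.sum_univ_castSucc]
    linarith [Finset.sum_nonneg fun i (_ : i ∈ Finset.univ) => h0 i]
  · rw [Fin.sum_univ_castSucc]
    exact sum_le_fullInfoPayoff σ hk hkm 0 Fin.elim0 hb ha

theorem sum_snoc (v : Fin n → ℝ) (u : ℝ) :
    ∑ j, (Fin.snoc v u : Fin (n + 1) → ℝ) j = ∑ i, v i + u := by
  simp [Fin.sum_univ_castSucc]

theorem surplusSet_eq_of_costGap_nonneg (hF : (F : Measure unitInterval) ≪ volume) (hk : 0 < k)
    (hkm : k < mean F) (hgap : 0 ≤ costGap F k) (hn : 1 ≤ n) :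
    surplusSet (equilibriumPayoffs F n k) =
      Set.Icc (autarkyPayoff F k) (fullInfoPayoff F k) := by
  refine Set.Subset.antisymm ?_ fun u hu => ?_
  · rintro _ ⟨y, hy, rfl⟩
    obtain ⟨h1, h2, h3⟩ := sum_mem_Icc_of_mem hk hkm hy
    exact ⟨h1.trans h2, h3⟩
  · refine ⟨_, snoc_zero_mem_equilibriumPayoffs hF hk hkm hgap ⟨0, hn⟩ hu, ?_⟩
    simp only [sum_snoc, Finset.sum_const_zero, zero_add]

theorem agentSet_eq_of_costGap_nonneg (hF : (F : Measure unitInterval) ≪ volume) (hk : 0 < k)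
    (hkm : k < mean F) (hgap : 0 ≤ costGap F k) (hn : 1 ≤ n) :
    agentSet (equilibriumPayoffs F n k) =
      Set.Icc (autarkyPayoff F k) (fullInfoPayoff F k) := by
  refine Set.Subset.antisymm ?_ fun u hu => ?_
  · rintro _ ⟨y, hy, rfl⟩
    obtain ⟨h1, h2, h3⟩ := sum_mem_Icc_of_mem hk hkm hy
    exact ⟨h1, h2.trans h3⟩
  · exact ⟨_, snoc_zero_mem_equilibriumPayoffs hF hk hkm hgap ⟨0, hn⟩ hu, Fin.snoc_last _ _⟩

theorem fullInfoPayoff_mem_surplusSet (hk : 0 < k) (hkm : k < mean F) (hn : 1 ≤ n) :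
    fullInfoPayoff F k ∈ surplusSet (equilibriumPayoffs F n k) := by
  rcases hn.eq_or_lt with rfl | hn
  · exact ⟨_, snoc_monopoly_mem hk hkm, by simp⟩
  · exact ⟨_, snoc_zero_fullInfoPayoff_mem hk hkm hn, by simp⟩

theorem isLUB_surplusSet (hk : 0 < k) (hkm : k < mean F) (hn : 1 ≤ n) :
    IsLUB (surplusSet (equilibriumPayoffs F n k)) (fullInfoPayoff F k) := by
  refine IsGreatest.isLUB ⟨fullInfoPayoff_mem_surplusSet hk hkm hn, ?_⟩
  rintro _ ⟨y, hy, rfl⟩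
  exact (sum_mem_Icc_of_mem hk hkm hy).2.2

/-- The agent gets at least u̲, the broker at least ū - u̲, and the sum is at most ū, so all three
bounds bind. -/
theorem monopoly_payoffs_eq (hk : 0 < k) (hkm : k < mean F) (hgap : costGap F k < 0)
    {y : Fin (1 + 1) → ℝ} (hy : y ∈ equilibriumPayoffs F 1 k) :
    y (Fin.last 1) = autarkyPayoff F k ∧ ∑ j, y j = fullInfoPayoff F k := by
  obtain ⟨h1, h2, h3⟩ := sum_mem_Icc_of_mem hk hkm hy
  obtain ⟨σ, hσ, hb, ha⟩ := hy
  have h4 := EReal.coe_ennreal_le_coe_ennreal_iff.mpr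
    (hσ.le_brokerPayoff_of_costGap_neg hk hkm hgap 0 Fin.elim0)
  rw [← hb 0, EReal.coe_ennreal_ofReal,
    max_eq_left (sub_nonneg.mpr (autarkyPayoff_le_fullInfoPayoff hk hkm)),
    EReal.coe_le_coe_iff] at h4
  rw [Fin.sum_univ_castSucc, Fin.sum_univ_one] at h2 h3 ⊢
  constructor <;> linarith

theorem isGLB_surplusSet_monopoly (hk : 0 < k) (hkm : k < mean F) (hgap : costGap F k < 0) :
    IsGLB (surplusSet (equilibriumPayoffs F 1 k)) (fullInfoPayoff F k) := by
  refine IsLeast.isGLB ⟨fullInfoPayoff_mem_surplusSet hk hkm le_rfl, ?_⟩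
  rintro _ ⟨y, hy, rfl⟩
  exact (monopoly_payoffs_eq hk hkm hgap hy).2.ge

theorem isLUB_agentSet_monopoly (hk : 0 < k) (hkm : k < mean F) (hgap : costGap F k < 0) :
    IsLUB (agentSet (equilibriumPayoffs F 1 k)) (autarkyPayoff F k) := by
  refine IsGreatest.isLUB ⟨⟨_, snoc_monopoly_mem hk hkm, Fin.snoc_last _ _⟩, ?_⟩
  rintro _ ⟨y, hy, rfl⟩
  exact (monopoly_payoffs_eq hk hkm hgap hy).1.le

theorem exists_isGLB_agentSet (hk : 0 < k) (hkm : k < mean F) (hn : 1 ≤ n) :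
    ∃ low, IsGLB (agentSet (equilibriumPayoffs F n k)) low ∧ autarkyPayoff F k ≤ low := by
  obtain ⟨y, hy, -⟩ := fullInfoPayoff_mem_surplusSet (F := F) hk hkm hn
  have hlb : autarkyPayoff F k ∈ lowerBounds (agentSet (equilibriumPayoffs F n k)) := by
    rintro _ ⟨y, hy, rfl⟩
    exact (sum_mem_Icc_of_mem hk hkm hy).1
  have hglb := isGLB_csInf (s := agentSet (equilibriumPayoffs F n k)) ⟨_, y, hy, rfl⟩ ⟨_, hlb⟩
  exact ⟨_, hglb, hglb.2 hlb⟩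

theorem isSurplusThreshold_of_costGap_eq_zero (hF : (F : Measure unitInterval) ≪ volume)
    {kstar : ℝ} (hmem : kstar ∈ Set.Ioo 0 (mean F)) (h0 : costGap F kstar = 0) :
    IsSurplusThreshold F kstar := by
  refine ⟨hmem, fun n hn => ⟨fun k hk hle => ?_, fun k hlt hkm => ?_⟩⟩
  · refine surplusSet_eq_of_costGap_nonneg hF hk (hle.trans_lt hmem.2) ?_ hn
    rcases hle.eq_or_lt with rfl | hlt
    · exact h0.ge
    · exact h0.ge.trans (costGap_lt hF hk.le hlt).le
  · have hk := hmem.1.trans hlt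
    exact ⟨isLUB_surplusSet hk hkm hn,
      isGLB_surplusSet_monopoly hk hkm (h0 ▸ costGap_lt hF hmem.1.le hlt)⟩

/-- Two different thresholds disagree about monopoly surplus at some cost: one makes it the whole
interval from u̲ to ū, the other puts its infimum at ū. Both can hold only where u̲ = ū, so a cost
with u̲ < ū suffices: k* itself against a smaller candidate, one slightly above k* against a larger
one. -/
theorem IsSurplusThreshold.eq (hF : (F : Measure unitInterval) ≪ volume) {kstar k' : ℝ}
    (hmem : kstar ∈ Set.Ioo 0 (mean F)) (h0 : costGap F kstar = 0)
    (h' : IsSurplusThreshold F k') : k' = kstar := by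
  have hstar := isSurplusThreshold_of_costGap_eq_zero hF hmem h0
  have key : ∀ k, surplusSet (equilibriumPayoffs F 1 k) =
      Set.Icc (autarkyPayoff F k) (fullInfoPayoff F k) →
      IsGLB (surplusSet (equilibriumPayoffs F 1 k)) (fullInfoPayoff F k) →
      autarkyPayoff F k < fullInfoPayoff F k → False := by
    intro k h1 h2 h3
    rw [h1] at h2
    exact h3.ne ((isGLB_Icc h3.le).unique h2)
  rcases lt_trichotomy k' kstar with hlt | heq | hlt
  · have hle := stopValue_autarky_le hmem.1 hmem.2 h0.ge
    have hm := mean_le_stopValue F (autarkyPayoff F kstar)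
    refine (key kstar ((hstar.2 1 le_rfl).1 kstar hmem.1 le_rfl)
      ((h'.2 1 le_rfl).2 kstar hlt hmem.2).2 ?_).elim
    have : autarkyPayoff F kstar = mean F - kstar := rfl
    have := hmem.1
    linarith
  · exact heq
  · obtain ⟨k, hk1, hk2, hkm, hne⟩ := exists_gt_autarkyPayoff_lt hmem h0 hlt
    exact (key k ((h'.2 1 le_rfl).1 k (hmem.1.trans hk1) hk2.le)
      ((hstar.2 1 le_rfl).2 k hk1 hkm).2 hne).elim

end PayoffSets

end

end PersuadedSearch

open MeasureTheory PersuadedSearch in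
theorem theorem2 (F : ProbabilityMeasure unitInterval)
    (hF : (F : Measure unitInterval) ≪ volume) :
    ∃ kstar : ℝ, (IsSurplusThreshold F kstar ∧ ∀ k', IsSurplusThreshold F k' → k' = kstar) ∧
      ∀ n : ℕ, 1 ≤ n →
        (∀ k, 0 < k → k ≤ kstar →
          agentSet (equilibriumPayoffs F n k) =
            Set.Icc (autarkyPayoff F k) (fullInfoPayoff F k)) ∧
        (∀ k, kstar < k → k < mean F →
          ∃ low high : ℝ, IsGLB (agentSet (equilibriumPayoffs F n k)) low ∧
            IsLUB (agentSet (equilibriumPayoffs F 1 k)) high ∧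
            high ≤ low ∧ high = autarkyPayoff F k) := by
  obtain ⟨kstar, hmem, h0⟩ := exists_thresholdCost hF
  refine ⟨kstar, ⟨isSurplusThreshold_of_costGap_eq_zero hF hmem h0,
    fun k' h' => h'.eq hF hmem h0⟩, fun n hn => ⟨fun k hk hle => ?_, fun k hlt hkm => ?_⟩⟩
  · refine agentSet_eq_of_costGap_nonneg hF hk (hle.trans_lt hmem.2) ?_ hn
    rcases hle.eq_or_lt with rfl | hlt
    · exact h0.ge
    · exact h0.ge.trans (costGap_lt hF hk.le hlt).le
  · have hk := hmem.1.trans hlt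
    obtain ⟨low, hlow, hle⟩ := exists_isGLB_agentSet hk hkm hn
    exact ⟨low, _, hlow,
      isLUB_agentSet_monopoly hk hkm (h0 ▸ costGap_lt hF hmem.1.le hlt), hle, rfl⟩
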